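/- For a curve $E:y^2+a_1xy+a_3y=x^3+a_2x^2+a_4x+a_6$ with $a_j\in\mathbb{Z}$ and non-zero discriminant, let $\mathrm{End}(E)$ be the ring of endomorphisms of $E$ defined over $\overline{\mathbb{Q}}$ and $\mathrm{Aut}(E)$ its group of units. $E$ has complex multiplication if $\mathrm{End}(E)\neq\mathbb{Z}$. A prime $p$ splits in $\mathrm{End}(E)$ if $p=\alpha\beta$ with $\alpha,\beta\in\mathrm{End}(E)\setminus\mathrm{Aut}(E)$. For odd $n$, $\psi_n\in\mathbb{Z}[x]$ denotes the $n$-th division polynomial of $E$. (1) Let $E$ have complex multiplication and let $p\neq 2$ be a prime that splits in $\mathrm{End}(E)$. Then $\psi_p$ is reducible: it is a product of two non-constant polynomials in $\mathbb{Z}[x]$. If moreover $p=\alpha\beta$ with $\alpha,\beta\in\mathrm{End}(E)\setminus\mathrm{Aut}(E)$ not associate, i.e. $\beta\neq u\alpha$ for every $u\in\mathrm{Aut}(E)$ (so $p$ is not ramified), then $\psi_p^2=fg$ with $f,g\in\mathbb{Z}[x]$ coprime and $\min(\deg f,\deg g)=2p-2$. (2) Let $a$ be a non-zero integer and $E_a:y^2=x^3+ax$.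 Then $E_a$ has complex multiplication, and for each $i\in\overline{\mathbb{Q}}$ with $i^2=-1$ the map $(x,y)\mapsto(-x,iy)$ defines $\iota\in\mathrm{End}(E_a)$ with $\iota^2=-1$. Every prime $p\equiv 1\pmod 4$ splits in $\mathrm{End}(E_a)$: there are integers $m,n$ with $p=m^2+n^2$, and for all such $m,n$ one has $p=(m+n\iota)(m-n\iota)$, where $m+n\iota$ and $m-n\iota$ are in $\mathrm{End}(E_a)\setminus\mathrm{Aut}(E_a)$ and are not associate. -/

import Mathlib

open Polynomial

/-- Equality of algebraic numbers is decided classically; the group law on `E(ℚ̄)` needs this. -/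
noncomputable instance instDecidableEqAlgebraicNumbers : DecidableEq (AlgebraicClosure ℚ) :=
  Classical.decEq _

namespace CMDiv

section Endomorphisms

variable {K : Type*} [Field K] (E : WeierstrassCurve K)

/-- Homogeneous coordinates in `ℙ²` of a point of `E`: the point at infinity is `[0 : 1 : 0]` and
`(x, y)` is `[x : y : 1]`. -/
def homCoords : E.toAffine.Point → Fin 3 → K
  | .zero => ![0, 1, 0]
  | .some x y _ => ![x, y, 1]

/-- `φ : E(K) → E(K)` is a morphism of projective curves (for `K` algebraically closed): around
every point `P` it is given by three homogeneous polynomials of the same degree, not all zero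
at `P`, which compute `φ` at every point of `E` at which they do not all vanish. -/
def IsMorphism (φ : E.toAffine.Point → E.toAffine.Point) : Prop :=
  ∀ P : E.toAffine.Point, ∃ (d : ℕ) (F : Fin 3 → MvPolynomial (Fin 3) K),
    (∀ j, (F j).IsHomogeneous d) ∧
    (∃ j, MvPolynomial.eval (homCoords E P) (F j) ≠ 0) ∧
    ∀ Q : E.toAffine.Point, (∃ j, MvPolynomial.eval (homCoords E Q) (F j) ≠ 0) →
      ∃ c : K, c ≠ 0 ∧ ∀ j, MvPolynomial.eval (homCoords E Q) (F j) = c * homCoords E (φ Q) j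

variable [DecidableEq K]

/-- `φ` belongs to `End(E)` (for `K` algebraically closed): it is an endomorphism of the group
`E(K)` and a morphism of curves. Sum and product in `End(E)` are those of `AddMonoid.End`, that is,
pointwise addition and composition, and the integer `n` is multiplication by `n`. -/
def IsEndomorphism (φ : AddMonoid.End E.toAffine.Point) : Prop :=
  IsMorphism E φ

/-- `φ` belongs to `Aut(E)`: it is an isomorphism, with its inverse in `End(E)`. -/
def IsAutomorphism (φ : AddMonoid.End E.toAffine.Point) : Prop :=
  IsEndomorphism E φ ∧ ∃ χ : AddMonoid.End E.toAffine.Point,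
    IsEndomorphism E χ ∧ φ * χ = 1 ∧ χ * φ = 1

/-- `E` has complex multiplication: `End(E)` is larger than `ℤ`. -/
def HasCM : Prop :=
  ∃ φ : AddMonoid.End E.toAffine.Point, IsEndomorphism E φ ∧
    ∀ n : ℤ, φ ≠ (n : AddMonoid.End E.toAffine.Point)

/-- `φ = α β` with `α, β` in `End(E)`, neither of them an isomorphism. -/
def IsSplitting (φ α β : AddMonoid.End E.toAffine.Point) : Prop :=
  IsEndomorphism E α ∧ IsEndomorphism E β ∧ ¬ IsAutomorphism E α ∧ ¬ IsAutomorphism E β ∧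
    α * β = φ

/-- `φ` splits in `End(E)`. -/
def Splits (φ : AddMonoid.End E.toAffine.Point) : Prop :=
  ∃ α β : AddMonoid.End E.toAffine.Point, IsSplitting E φ α β

/-- `α` and `β` differ by an automorphism of `E`. -/
def AreAssociate (α β : AddMonoid.End E.toAffine.Point) : Prop :=
  ∃ u : AddMonoid.End E.toAffine.Point, IsAutomorphism E u ∧ β = u * α

end Endomorphisms

/-- The curve over `ℚ̄` given by a Weierstrass equation with integer coefficients. -/
noncomputable abbrev geom (W : WeierstrassCurve ℤ) : WeierstrassCurve (AlgebraicClosure ℚ) :=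
  W.map (Int.castRingHom (AlgebraicClosure ℚ))

/-- The curve `E_a : y² = x³ + a x`. -/
def curveE (a : ℤ) : WeierstrassCurve ℤ := ⟨0, 0, 0, a, 0⟩

/-- The `n`-th division polynomial, for odd `n`, as a polynomial in `x` alone. -/
noncomputable abbrev oddDivPoly (W : WeierstrassCurve ℤ) (n : ℕ) : ℤ[X] := W.preΨ n

/-- For odd `n` the bivariate division polynomial `ψ_n` is `oddDivPoly W n` in the coordinate ring
of the curve. -/
theorem mk_ψ_eq_oddDivPoly (W : WeierstrassCurve ℤ) (n : ℕ) (hn : Odd n) :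
    WeierstrassCurve.Affine.CoordinateRing.mk W.toAffine (W.ψ n) =
      WeierstrassCurve.Affine.CoordinateRing.mk W.toAffine (C (oddDivPoly W n)) := by
  have h : ¬ Even (n : ℤ) := by simpa using hn
  rw [WeierstrassCurve.Affine.CoordinateRing.mk_ψ, WeierstrassCurve.Ψ, if_neg h, mul_one]

end CMDiv

/-!
Over an algebraically closed field of characteristic zero a curve is written as `t² = B(x)` with
`t = 2y + a₁x + a₃` and `B` a cubic, so that a non-zero endomorphism has the form
`(x, t) ↦ (r(x), s(x) t)` with rational functions `r` and `s`. Most of the work is done with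
identities that hold outside a finite set of points; `ratHom_of_isEndomorphism` and
`RatHom.isEndomorphism` show that the group homomorphisms of this shape are exactly the
endomorphisms. A homomorphism that is rational after composition with a non-zero endomorphism is
rational (`RatHom.of_mul`), hence an injective endomorphism is an automorphism and endomorphisms
with the same kernel are associate. Finally `r' = c s` with a constant `c`, the action on the
invariant differential, and in characteristic zero this makes the endomorphism ring commutative
(`RatHom.mul_comm`).

Let `p = αβ` be a splitting of an odd prime. Neither kernel is trivial, both are killed by `p`, and
`β` maps the `p`-torsion onto the kernel of `α` with the kernel of `β` as its kernel. The division
polynomial `ψ_p` has degree `(p² - 1) / 2` and vanishes at the points of order `p`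
(`eval_preΨ_eq_zero`, from the elliptic net relation for the `x`-coordinates of multiples of a
point), so there are at most `p²` points killed by `p`. Hence there are exactly `p²` of them, both
kernels have order `p`, and the roots of `ψ_p` are simple (`IsSplitting.card_eq`). A Galois
automorphism conjugates `α` and `β` into another splitting of `p`. As the endomorphism ring is
commutative, the union of the kernels is the same for both splittings
(`IsSplitting.kernelAbscissae_stable`). The `x`-coordinates of the non-zero points in this union
therefore form the roots of a factor of `ψ_p` over `ℚ`, hence over `ℤ` by the Gauss lemma. Its
degree is at most `p - 1`, which is less than `(p² - 1) / 2`. If `α` and `β` are not associate, the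
kernels are distinct, the degree is `p - 1`, and the squares of the factor and of its cofactor are
coprime since the roots of `ψ_p` are simple.

On `y² = x³ + ax` let `ι` be the endomorphism `(x, y) ↦ (-x, iy)`. If `p = m² + n²` then
`p = (m + nι)(m - nι)`. When `m` is odd and `n` even, `m + nι` fixes the three points of order two.
An injective endomorphism acts on `x`-coordinates by a fractional linear transformation, which is
the identity as soon as it fixes three values (`RatHom.eq_one_or_neg_one`); so `m + nι`, not being
`1` or `-1`, is not injective. The remaining parity is reduced to this one by multiplication by
`ι`. The factors are not associate, because a point in both kernels is killed by the coprime
integers `2m` and `p`.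
-/


set_option linter.unusedSectionVars false

namespace CMDiv

/-! ### Coordinates on the curve in which negation is a sign change -/

section Coordinates

variable {K : Type*} [Field K] (E : WeierstrassCurve K)

/-- The `x`-coordinate of a point; junk value `0` at the point at infinity. -/
def xc : E.toAffine.Point → K
  | .zero => 0
  | .some x _ _ => x

/-- The coordinate `t = 2y + a₁x + a₃`, which changes sign under negation; junk value `0` at the
point at infinity. -/
def tc : E.toAffine.Point → K
  | .zero => 0
  | .some x y _ => 2 * y + E.a₁ * x + E.a₃

/-- The cubic `B` for which the curve has the equation `t² = B(x)`. -/
def cubicB (x : K) : K := 4 * x ^ 3 + E.b₂ * x ^ 2 + 2 * E.b₄ * x + E.b₆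

/-- The derivative of `cubicB`. -/
def cubicB' (x : K) : K := 12 * x ^ 2 + 2 * E.b₂ * x + 2 * E.b₄

variable {E}

@[simp] lemma xc_some {x y : K} (h) : xc E (.some x y h) = x := rfl

@[simp] lemma tc_some {x y : K} (h) : tc E (.some x y h) = 2 * y + E.a₁ * x + E.a₃ := rfl

@[simp] lemma xc_neg (P : E.toAffine.Point) : xc E (-P) = xc E P := by
  cases P <;> rfl

@[simp] lemma tc_neg (P : E.toAffine.Point) : tc E (-P) = -tc E P := by
  rcases P with _ | ⟨x, y, h⟩
  · exact neg_zero.symm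
  · rw [WeierstrassCurve.Affine.Point.neg_some, tc_some, tc_some, WeierstrassCurve.Affine.negY]
    ring

lemma tc_sq {P : E.toAffine.Point} (hP : P ≠ 0) : tc E P ^ 2 = cubicB E (xc E P) := by
  rcases P with _ | ⟨x, y, h⟩
  · exact absurd rfl hP
  · have := (WeierstrassCurve.Affine.equation_iff ..).1 h.1
    simp only [tc_some, xc_some, cubicB, WeierstrassCurve.b₂, WeierstrassCurve.b₄,
      WeierstrassCurve.b₆]
    linear_combination 4 * this

lemma point_ext [NeZero (2 : K)] {P Q : E.toAffine.Point} (hP : P ≠ 0) (hQ : Q ≠ 0)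
    (hx : xc E P = xc E Q) (ht : tc E P = tc E Q) : P = Q := by
  rcases P with _ | ⟨x, y, h⟩
  · exact absurd rfl hP
  rcases Q with _ | ⟨x', y', h'⟩
  · exact absurd rfl hQ
  simp only [tc_some, xc_some] at hx ht
  subst hx
  have : y = y' := mul_left_cancel₀ (two_ne_zero (α := K)) (by linear_combination ht)
  subst this
  rfl

lemma eq_or_eq_neg_of_xc_eq {P Q : E.toAffine.Point} (hP : P ≠ 0) (hQ : Q ≠ 0)
    (hx : xc E P = xc E Q) : P = Q ∨ P = -Q := by
  rcases P with _ | ⟨x, y, h⟩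
  · exact absurd rfl hP
  rcases Q with _ | ⟨x', y', h'⟩
  · exact absurd rfl hQ
  exact WeierstrassCurve.Affine.Point.X_eq_iff.1 hx

lemma exists_point [NeZero (2 : K)] [E.IsElliptic] {x t : K} (h : t ^ 2 = cubicB E x) :
    ∃ P : E.toAffine.Point, P ≠ 0 ∧ xc E P = x ∧ tc E P = t := by
  have h2 := two_ne_zero (α := K)
  have : E.toAffine.Equation x ((t - E.a₁ * x - E.a₃) / 2) := by
    rw [WeierstrassCurve.Affine.equation_iff]
    simp only [cubicB, WeierstrassCurve.b₂, WeierstrassCurve.b₄, WeierstrassCurve.b₆] at h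
    field_simp
    linear_combination h
  refine ⟨.some _ _ (WeierstrassCurve.Affine.equation_iff_nonsingular.1 this),
    WeierstrassCurve.Affine.Point.some_ne_zero _, rfl, ?_⟩
  simp only [tc_some]
  field_simp
  ring

variable [DecidableEq K]

lemma add_ne_zero_of_xc_ne {P Q : E.toAffine.Point} (h : xc E P ≠ xc E Q) : P + Q ≠ 0 := by
  intro h0
  rw [add_eq_zero_iff_eq_neg] at h0
  exact h (by rw [h0, xc_neg])

/-- The chord law in the coordinates `(x, t)`. -/
lemma chord_law [NeZero (2 : K)] {P Q : E.toAffine.Point} (hP : P ≠ 0) (hQ : Q ≠ 0)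
    (h : xc E P ≠ xc E Q) :
    xc E (P + Q) = ((tc E Q - tc E P) / (xc E Q - xc E P)) ^ 2 / 4 - E.b₂ / 4 - xc E P - xc E Q ∧
    tc E (P + Q) = -(tc E P +
      (tc E Q - tc E P) / (xc E Q - xc E P) * (xc E (P + Q) - xc E P)) := by
  rcases P with _ | ⟨x, y, hxy⟩
  · exact absurd rfl hP
  rcases Q with _ | ⟨x', y', hxy'⟩
  · exact absurd rfl hQ
  simp only [xc_some] at h
  have h1 : x - x' ≠ 0 := sub_ne_zero.2 h
  have h2 : x' - x ≠ 0 := sub_ne_zero.2 h.symm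
  have h4 : (2 : K) ≠ 0 := two_ne_zero
  have h44 : (4 : K) ≠ 0 := by
    rw [show (4 : K) = 2 * 2 by norm_num]; exact mul_ne_zero h4 h4
  rw [WeierstrassCurve.Affine.Point.add_of_X_ne h]
  simp only [tc_some, xc_some, WeierstrassCurve.Affine.addX, WeierstrassCurve.Affine.addY,
    WeierstrassCurve.Affine.negY, WeierstrassCurve.Affine.negAddY,
    WeierstrassCurve.Affine.slope_of_X_ne h, WeierstrassCurve.b₂]
  have e : (2 * y' + E.a₁ * x' + E.a₃ - (2 * y + E.a₁ * x + E.a₃)) / (x' - x) =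
      2 * ((y - y') / (x - x')) + E.a₁ := by
    field_simp
    ring
  rw [e]
  constructor
  · field_simp
    ring
  · ring

/-- The tangent law in the coordinates `(x, t)`. -/
lemma tangent_law [NeZero (2 : K)] {P : E.toAffine.Point} (hP : P ≠ 0) (h : tc E P ≠ 0) :
    P + P ≠ 0 ∧
    xc E (P + P) = (cubicB' E (xc E P) / (2 * tc E P)) ^ 2 / 4 - E.b₂ / 4 - 2 * xc E P ∧
    tc E (P + P) = -(tc E P +
      cubicB' E (xc E P) / (2 * tc E P) * (xc E (P + P) - xc E P)) := by
  rcases P with _ | ⟨x, y, hxy⟩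
  · exact absurd rfl hP
  simp only [tc_some] at h
  have h4 : (2 : K) ≠ 0 := two_ne_zero
  have h44 : (4 : K) ≠ 0 := by
    rw [show (4 : K) = 2 * 2 by norm_num]; exact mul_ne_zero h4 h4
  have hy : y ≠ E.toAffine.negY x y := by
    intro h0
    rw [WeierstrassCurve.Affine.negY] at h0
    exact h (by linear_combination h0)
  have hd : y - E.toAffine.negY x y = 2 * y + E.a₁ * x + E.a₃ := by
    rw [WeierstrassCurve.Affine.negY]; ring
  rw [WeierstrassCurve.Affine.Point.add_self_of_Y_ne hy]
  refine ⟨WeierstrassCurve.Affine.Point.some_ne_zero _, ?_⟩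
  simp only [tc_some, xc_some, WeierstrassCurve.Affine.addX, WeierstrassCurve.Affine.addY,
    WeierstrassCurve.Affine.negAddY,
    WeierstrassCurve.Affine.slope_of_Y_ne rfl hy, hd]
  have e : cubicB' E x / (2 * (2 * y + E.a₁ * x + E.a₃)) =
      2 * ((3 * x ^ 2 + 2 * E.a₂ * x + E.a₄ - E.a₁ * y) / (2 * y + E.a₁ * x + E.a₃)) + E.a₁ := by
    simp only [cubicB', WeierstrassCurve.b₂, WeierstrassCurve.b₄]
    generalize hD : 2 * y + E.a₁ * x + E.a₃ = D at h ⊢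
    field_simp
    linear_combination (2 * E.a₁) * hD
  rw [e]
  generalize (3 * x ^ 2 + 2 * E.a₂ * x + E.a₄ - E.a₁ * y) / (2 * y + E.a₁ * x + E.a₃) = S
  simp only [WeierstrassCurve.b₂, WeierstrassCurve.Affine.negY]
  constructor
  · field_simp
    ring
  · ring

end Coordinates

/-! ### Rational functions up to finitely many values, and their derivatives -/

section RationalFunctions

open Filter

variable {K : Type*} [Field K]

/-- `g` agrees with a quotient of polynomials outside a finite set. -/
def IsRat (g : K → K) : Prop :=
  ∃ u v : K[X], v ≠ 0 ∧ ∀ᶠ x in cofinite, g x = u.eval x / v.eval x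

/-- `g` agrees with a quotient of polynomials outside a finite set, and `g'` with the formal
derivative of that quotient. -/
def HasDer (g g' : K → K) : Prop :=
  ∃ u v : K[X], v ≠ 0 ∧ ∀ᶠ x in cofinite, g x = u.eval x / v.eval x ∧
    g' x = (u.derivative.eval x * v.eval x - u.eval x * v.derivative.eval x) / v.eval x ^ 2

lemma eventually_eval_ne_zero {v : K[X]} (hv : v ≠ 0) : ∀ᶠ x in cofinite, v.eval x ≠ 0 := by
  classical
  rw [eventually_cofinite]
  refine (v.roots.toFinset.finite_toSet).subset fun x hx => ?_
  simpa [hv] using hx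

lemma eq_zero_of_frequently_eval_eq_zero {v : K[X]} (h : ∃ᶠ x in cofinite, v.eval x = 0) :
    v = 0 := by
  by_contra hv
  exact h (eventually_eval_ne_zero hv)

lemma HasDer.isRat {g g' : K → K} (h : HasDer g g') : IsRat g := by
  obtain ⟨u, v, hv, h⟩ := h
  exact ⟨u, v, hv, h.mono fun x hx => hx.1⟩

lemma HasDer.isRat_der {g g' : K → K} (h : HasDer g g') : IsRat g' := by
  obtain ⟨u, v, hv, h⟩ := h
  exact ⟨derivative u * v - u * derivative v, v ^ 2, pow_ne_zero _ hv,
    h.mono fun x hx => by simp [hx.2]⟩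

lemma IsRat.exists_hasDer {g : K → K} (h : IsRat g) : ∃ g', HasDer g g' := by
  obtain ⟨u, v, hv, h⟩ := h
  exact ⟨_, u, v, hv, h.mono fun x hx => ⟨hx, rfl⟩⟩

lemma HasDer.congr {g g' h h' : K → K} (H : HasDer g g') (e : ∀ᶠ x in cofinite, h x = g x)
    (e' : ∀ᶠ x in cofinite, h' x = g' x) : HasDer h h' := by
  obtain ⟨u, v, hv, H⟩ := H
  refine ⟨u, v, hv, ?_⟩
  filter_upwards [H, e, e'] with x h1 h2 h3
  exact ⟨h2.trans h1.1, h3.trans h1.2⟩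

lemma hasDer_poly (p : K[X]) : HasDer (fun x => p.eval x) (fun x => p.derivative.eval x) :=
  ⟨p, 1, one_ne_zero, Eventually.of_forall fun x => by simp⟩

lemma hasDer_const (c : K) : HasDer (fun _ => c) (fun _ => 0) := by
  simpa using hasDer_poly (C c)

lemma hasDer_id : HasDer (fun x : K => x) (fun _ => 1) := by
  simpa using hasDer_poly (X : K[X])

lemma HasDer.add {g g' h h' : K → K} (hg : HasDer g g') (hh : HasDer h h') :
    HasDer (fun x => g x + h x) (fun x => g' x + h' x) := by
  obtain ⟨u, v, hv, H⟩ := hg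
  obtain ⟨w, z, hz, H'⟩ := hh
  refine ⟨u * z + w * v, v * z, mul_ne_zero hv hz, ?_⟩
  filter_upwards [H, H', eventually_eval_ne_zero hv, eventually_eval_ne_zero hz] with x h1 h2 h3 h4
  rw [h1.1, h1.2, h2.1, h2.2]
  simp only [derivative_add, derivative_mul, eval_add, eval_mul]
  constructor
  · field_simp
  · field_simp
    ring

lemma HasDer.mul {g g' h h' : K → K} (hg : HasDer g g') (hh : HasDer h h') :
    HasDer (fun x => g x * h x) (fun x => g' x * h x + g x * h' x) := by
  obtain ⟨u, v, hv, H⟩ := hg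
  obtain ⟨w, z, hz, H'⟩ := hh
  refine ⟨u * w, v * z, mul_ne_zero hv hz, ?_⟩
  filter_upwards [H, H', eventually_eval_ne_zero hv, eventually_eval_ne_zero hz] with x h1 h2 h3 h4
  rw [h1.1, h1.2, h2.1, h2.2]
  simp only [derivative_mul, eval_add, eval_mul]
  constructor
  · field_simp
  · field_simp
    ring

lemma HasDer.inv {g g' : K → K} (hg : HasDer g g') :
    HasDer (fun x => (g x)⁻¹) (fun x => -g' x / g x ^ 2) := by
  obtain ⟨u, v, hv, H⟩ := hg
  rcases eq_or_ne u 0 with rfl | hu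
  · refine ⟨0, 1, one_ne_zero, H.mono fun x h => ?_⟩
    simp [h.1, h.2]
  refine ⟨v, u, hu, ?_⟩
  filter_upwards [H, eventually_eval_ne_zero hv, eventually_eval_ne_zero hu] with x h1 h2 h3
  rw [h1.1, h1.2]
  constructor
  · field_simp
  · field_simp
    ring

lemma HasDer.const_mul {g g' : K → K} (c : K) (hg : HasDer g g') :
    HasDer (fun x => c * g x) (fun x => c * g' x) := by
  simpa using (hasDer_const c).mul hg

lemma HasDer.neg {g g' : K → K} (hg : HasDer g g') :
    HasDer (fun x => -g x) (fun x => -g' x) := by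
  simpa using hg.const_mul (-1)

lemma HasDer.sub {g g' h h' : K → K} (hg : HasDer g g') (hh : HasDer h h') :
    HasDer (fun x => g x - h x) (fun x => g' x - h' x) := by
  simpa [sub_eq_add_neg] using hg.add hh.neg

lemma HasDer.div {g g' h h' : K → K} (hg : HasDer g g') (hh : HasDer h h') :
    HasDer (fun x => g x / h x) (fun x => g' x * (h x)⁻¹ + g x * (-h' x / h x ^ 2)) := by
  simpa [div_eq_mul_inv] using hg.mul hh.inv

lemma HasDer.sq {g g' : K → K} (hg : HasDer g g') :
    HasDer (fun x => g x ^ 2) (fun x => 2 * g x * g' x) := by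
  refine (hg.mul hg).congr (.of_forall fun x => pow_two _) (.of_forall fun x => by ring)

lemma isRat_const (c : K) : IsRat (fun _ : K => c) := (hasDer_const c).isRat

lemma isRat_id : IsRat (fun x : K => x) := hasDer_id.isRat

lemma isRat_poly (p : K[X]) : IsRat (fun x => p.eval x) := (hasDer_poly p).isRat

lemma IsRat.add {g h : K → K} (hg : IsRat g) (hh : IsRat h) : IsRat (fun x => g x + h x) := by
  obtain ⟨g', hg⟩ := hg.exists_hasDer
  obtain ⟨h', hh⟩ := hh.exists_hasDer
  exact (hg.add hh).isRat

lemma IsRat.sub {g h : K → K} (hg : IsRat g) (hh : IsRat h) : IsRat (fun x => g x - h x) := by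
  obtain ⟨g', hg⟩ := hg.exists_hasDer
  obtain ⟨h', hh⟩ := hh.exists_hasDer
  exact (hg.sub hh).isRat

lemma IsRat.mul {g h : K → K} (hg : IsRat g) (hh : IsRat h) : IsRat (fun x => g x * h x) := by
  obtain ⟨g', hg⟩ := hg.exists_hasDer
  obtain ⟨h', hh⟩ := hh.exists_hasDer
  exact (hg.mul hh).isRat

lemma IsRat.div {g h : K → K} (hg : IsRat g) (hh : IsRat h) : IsRat (fun x => g x / h x) := by
  obtain ⟨g', hg⟩ := hg.exists_hasDer
  obtain ⟨h', hh⟩ := hh.exists_hasDer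
  exact (hg.div hh).isRat

lemma IsRat.inv {g : K → K} (hg : IsRat g) : IsRat (fun x => (g x)⁻¹) := by
  obtain ⟨g', hg⟩ := hg.exists_hasDer
  exact hg.inv.isRat

lemma IsRat.neg {g : K → K} (hg : IsRat g) : IsRat (fun x => -g x) := by
  obtain ⟨g', hg⟩ := hg.exists_hasDer
  exact hg.neg.isRat

lemma IsRat.sq {g : K → K} (hg : IsRat g) : IsRat (fun x => g x ^ 2) := by
  obtain ⟨g', hg⟩ := hg.exists_hasDer
  exact hg.sq.isRat

lemma IsRat.exists_coprime {g : K → K} (h : IsRat g) :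
    ∃ u v : K[X], v ≠ 0 ∧ IsCoprime u v ∧ ∀ᶠ x in cofinite, g x = u.eval x / v.eval x := by
  classical
  obtain ⟨u, v, hv, h⟩ := h
  obtain ⟨a, ha⟩ := EuclideanDomain.gcd_dvd_left u v
  obtain ⟨b, hb⟩ := EuclideanDomain.gcd_dvd_right u v
  have hd : EuclideanDomain.gcd u v ≠ 0 := fun h0 => hv (by rw [hb, h0, zero_mul])
  have hb0 : b ≠ 0 := fun h0 => hv (by rw [hb, h0, mul_zero])
  refine ⟨a, b, hb0, ?_, ?_⟩
  · refine ⟨EuclideanDomain.gcdA u v, EuclideanDomain.gcdB u v, ?_⟩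
    apply mul_left_cancel₀ hd
    have := EuclideanDomain.gcd_eq_gcd_ab u v
    linear_combination (-1 : K[X]) * this - EuclideanDomain.gcdA u v * ha -
      EuclideanDomain.gcdB u v * hb
  · filter_upwards [h, eventually_eval_ne_zero hd] with x h1 h2
    have ea := congrArg (eval x) ha
    have eb := congrArg (eval x) hb
    rw [eval_mul] at ea eb
    rw [h1, ea, eb, mul_div_mul_left _ _ h2]

lemma IsRat.eventually_eq_of_frequently {g h : K → K} (hg : IsRat g) (hh : IsRat h)
    (H : ∃ᶠ x in cofinite, g x = h x) : ∀ᶠ x in cofinite, g x = h x := by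
  obtain ⟨u, v, hv, hg⟩ := hg
  obtain ⟨w, z, hz, hh⟩ := hh
  have h0 : u * z - w * v = 0 := by
    apply eq_zero_of_frequently_eval_eq_zero
    refine (((H.and_eventually hg).and_eventually hh).and_eventually
      ((eventually_eval_ne_zero hv).and (eventually_eval_ne_zero hz))).mono ?_
    rintro x ⟨⟨⟨h1, h2⟩, h3⟩, h4, h5⟩
    rw [h2, h3, div_eq_div_iff h4 h5] at h1
    simp [h1]
  filter_upwards [hg, hh, eventually_eval_ne_zero hv, eventually_eval_ne_zero hz] with x h1 h2 h3 h4
  rw [h1, h2, div_eq_div_iff h3 h4]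
  have := congrArg (eval x) h0
  simpa [sub_eq_zero] using this

/-- A rational function takes a value either almost everywhere or finitely often. -/
lemma IsRat.eventually_eq_or_ne {g h : K → K} (hg : IsRat g) (hh : IsRat h) :
    (∀ᶠ x in cofinite, g x = h x) ∨ ∀ᶠ x in cofinite, g x ≠ h x := by
  by_cases H : ∃ᶠ x in cofinite, g x = h x
  · exact .inl (hg.eventually_eq_of_frequently hh H)
  · exact .inr (not_frequently.1 H)

/-- A rational function that is not constant has finite fibres. -/
lemma IsRat.tendsto_cofinite {g : K → K} (hg : IsRat g)
    (hc : ¬ ∃ c, ∀ᶠ x in cofinite, g x = c) : Tendsto g cofinite cofinite := by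
  refine Tendsto.cofinite_of_finite_preimage_singleton fun c => ?_
  have := (hg.eventually_eq_or_ne (isRat_const c)).resolve_left fun h => hc ⟨c, h⟩
  rw [eventually_cofinite] at this
  exact this.subset fun x hx => by simpa using hx

/-- The chain rule. -/
lemma HasDer.comp {g g' f f' : K → K} (hg : HasDer g g') (hf : HasDer f f')
    (ht : Tendsto f cofinite cofinite) :
    HasDer (fun x => g (f x)) (fun x => g' (f x) * f' x) := by
  have key : ∀ p : K[X], HasDer (fun x => p.eval (f x))
      (fun x => p.derivative.eval (f x) * f' x) := by
    intro p
    induction p using Polynomial.induction_on' with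
    | add p q hp hq =>
      exact (hp.add hq).congr (.of_forall fun x => by simp) (.of_forall fun x => by simp; ring)
    | monomial n a =>
      induction n with
      | zero => simpa using hasDer_const a
      | succ n ih =>
        refine (ih.mul hf).congr (.of_forall fun x => ?_) (.of_forall fun x => ?_)
        · simp only [eval_monomial]; ring
        · simp only [derivative_monomial, eval_monomial]
          rcases n with _ | n
          · simp
          · simp only [Nat.cast_add, Nat.cast_one, Nat.add_sub_cancel]; ring
  obtain ⟨u, v, hv, h⟩ := hg
  refine ((key u).div (key v)).congr ?_ ?_
  · filter_upwards [ht.eventually h] with x hx using hx.1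
  · filter_upwards [ht.eventually h, ht.eventually (eventually_eval_ne_zero hv)] with x hx hx'
    rw [hx.2]
    field_simp
    ring

lemma IsRat.comp {g f : K → K} (hg : IsRat g) (hf : IsRat f)
    (ht : Tendsto f cofinite cofinite) : IsRat (fun x => g (f x)) := by
  obtain ⟨g', hg⟩ := hg.exists_hasDer
  obtain ⟨f', hf⟩ := hf.exists_hasDer
  exact (hg.comp hf ht).isRat

variable [Infinite K]

/-- The derivative depends only on the values of the function, not on the fraction. -/
lemma HasDer.unique {g g₁ g₂ : K → K} (h₁ : HasDer g g₁) (h₂ : HasDer g g₂) :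
    ∀ᶠ x in cofinite, g₁ x = g₂ x := by
  obtain ⟨u, v, hv, h₁⟩ := h₁
  obtain ⟨w, z, hz, h₂⟩ := h₂
  have h0 : u * z - w * v = 0 := by
    apply eq_zero_of_frequently_eval_eq_zero
    apply Eventually.frequently
    filter_upwards [h₁, h₂, eventually_eval_ne_zero hv, eventually_eval_ne_zero hz] with x a b c d
    have := a.1.symm.trans b.1
    rw [div_eq_div_iff c d] at this
    simp [this]
  have h1 := congrArg derivative h0
  filter_upwards [h₁, h₂, eventually_eval_ne_zero hv, eventually_eval_ne_zero hz] with x a b c d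
  have e0 := congrArg (eval x) h0
  have e1 := congrArg (eval x) h1
  simp only [derivative_sub, derivative_mul, eval_sub, eval_mul, eval_add, eval_zero,
    derivative_zero] at e0 e1
  rw [a.2, b.2, div_eq_div_iff (pow_ne_zero _ c) (pow_ne_zero _ d)]
  linear_combination (v.eval x * z.eval x) * e1 -
    (v.derivative.eval x * z.eval x + z.derivative.eval x * v.eval x) * e0

/-- In characteristic zero a rational function with derivative zero is constant. -/
lemma HasDer.eventually_eq_const [CharZero K] {g g' : K → K} (h : HasDer g g')
    (h0 : ∀ᶠ x in cofinite, g' x = 0) : ∃ c, ∀ᶠ x in cofinite, g x = c := by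
  obtain ⟨u, v, hv, huv, hg⟩ := h.isRat.exists_coprime
  have h1 : HasDer g (fun x => (u.derivative.eval x * v.eval x - u.eval x * v.derivative.eval x) /
    v.eval x ^ 2) := ⟨u, v, hv, hg.mono fun x hx => ⟨hx, rfl⟩⟩
  have h2 : derivative u * v - u * derivative v = 0 := by
    apply eq_zero_of_frequently_eval_eq_zero
    apply Eventually.frequently
    filter_upwards [h.unique h1, h0, eventually_eval_ne_zero hv] with x a b c
    rw [b] at a
    have := (div_eq_zero_iff.1 a.symm).resolve_right (pow_ne_zero _ c)
    simpa using this
  have h3 : v ∣ derivative v := by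
    refine huv.symm.dvd_of_dvd_mul_left ⟨derivative u, ?_⟩
    linear_combination -h2
  have h4 : derivative v = 0 := by
    by_contra hne
    exact absurd (degree_le_of_dvd h3 hne) (not_le.2 (degree_derivative_lt hv))
  have h5 : derivative u = 0 := by
    rw [h4, mul_zero, sub_zero] at h2
    exact (mul_eq_zero.1 h2).resolve_right hv
  rw [eq_C_of_derivative_eq_zero h4, eq_C_of_derivative_eq_zero h5] at hg
  exact ⟨_, hg.mono fun x hx => by simpa using hx⟩

end RationalFunctions

/-! ### Endomorphisms given by rational functions outside a finite set -/

section RationalHoms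

open Filter

variable {K : Type*} [Field K] [CharZero K] {E : WeierstrassCurve K}

lemma hasDer_cubicB (E : WeierstrassCurve K) : HasDer (cubicB E) (cubicB' E) := by
  refine (hasDer_poly (C 4 * X ^ 3 + C E.b₂ * X ^ 2 + C (2 * E.b₄) * X + C E.b₆)).congr
    (.of_forall fun x => ?_) (.of_forall fun x => ?_)
  · simp [cubicB]
  · simp [cubicB']
    ring

lemma eventually_cubicB_ne_zero (E : WeierstrassCurve K) :
    ∀ᶠ x in cofinite, cubicB E x ≠ 0 := by
  have h : (C 4 * X ^ 3 + C E.b₂ * X ^ 2 + C (2 * E.b₄) * X + C E.b₆ : K[X]) ≠ 0 := by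
    intro h
    have := congrArg (coeff · 3) h
    simp at this
  refine (eventually_eval_ne_zero h).mono fun x hx => ?_
  simpa [cubicB] using hx

lemma tendsto_xc : Tendsto (xc E) cofinite cofinite := by
  refine Tendsto.cofinite_of_finite_preimage_singleton fun c => ?_
  by_cases h : ∃ P : E.toAffine.Point, P ≠ 0 ∧ xc E P = c
  · obtain ⟨P, hP, rfl⟩ := h
    refine (Set.toFinite {0, P, -P}).subset fun Q hQ => ?_
    by_cases h0 : Q = 0
    · simp [h0]
    · have := eq_or_eq_neg_of_xc_eq h0 hP (by simpa using hQ)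
      simp [this]
  · push Not at h
    refine (Set.finite_singleton 0).subset fun Q hQ => ?_
    by_contra h0
    exact h Q h0 (by simpa using hQ)

section AlgClosed

variable [IsAlgClosed K] [E.IsElliptic]

lemma exists_point_of_xc (x : K) : ∃ P : E.toAffine.Point, P ≠ 0 ∧ xc E P = x := by
  obtain ⟨t, ht⟩ := IsAlgClosed.exists_pow_nat_eq (cubicB E x) (n := 2) (by norm_num)
  obtain ⟨P, hP, hx, -⟩ := exists_point ht
  exact ⟨P, hP, hx⟩

lemma eventually_xc_iff {p : K → Prop} :
    (∀ᶠ P in cofinite, p (xc E P)) ↔ ∀ᶠ x in cofinite, p x := by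
  refine ⟨fun h => ?_, fun h => tendsto_xc.eventually h⟩
  rw [eventually_cofinite] at h ⊢
  refine (h.image (xc E)).subset fun x hx => ?_
  obtain ⟨P, -, rfl⟩ := exists_point_of_xc (E := E) x
  exact ⟨P, hx, rfl⟩

instance infinite_point : Infinite E.toAffine.Point :=
  Infinite.of_surjective (xc E) fun x => (exists_point_of_xc x).imp fun _ h => h.2

end AlgClosed

lemma eventually_ne_zero : ∀ᶠ P : E.toAffine.Point in cofinite, P ≠ 0 := by
  rw [eventually_cofinite]
  simp

lemma eventually_tc_ne_zero : ∀ᶠ P : E.toAffine.Point in cofinite, tc E P ≠ 0 := by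
  filter_upwards [tendsto_xc.eventually (eventually_cubicB_ne_zero E), eventually_ne_zero]
    with P h1 h2 h3
  exact h1 (by rw [← tc_sq h2, h3]; simp)

/-- A subgroup with finite complement in an infinite group is the whole group. -/
lemma addSubgroup_eq_top_of_eventually {G : Type*} [AddGroup G] [Infinite G] {H : AddSubgroup G}
    (h : ∀ᶠ g in cofinite, g ∈ H) : H = ⊤ := by
  rw [eq_top_iff]
  intro g _
  have h1 : Tendsto (fun k => g + k) cofinite cofinite :=
    (add_right_injective g).tendsto_cofinite
  obtain ⟨k, hk, hk'⟩ := (h.and (h1.eventually h)).exists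
  simpa using H.sub_mem hk' hk

variable [DecidableEq K]

/-- Outside a finite set, `α` is given by `(x, t) ↦ (r(x), s(x) t)` with rational functions
`r` and `s`. -/
structure RatWith (α : AddMonoid.End E.toAffine.Point) (r s : K → K) : Prop where
  isRat_fst : IsRat r
  isRat_snd : IsRat s
  eventually : ∀ᶠ P in cofinite,
    α P ≠ 0 ∧ xc E (α P) = r (xc E P) ∧ tc E (α P) = s (xc E P) * tc E P

/-- `α` is zero or given by rational functions outside a finite set. -/
def RatHom (α : AddMonoid.End E.toAffine.Point) : Prop :=
  α = 0 ∨ ∃ r s, RatWith α r s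

lemma RatHom.exists_of_ne_zero {α : AddMonoid.End E.toAffine.Point} (h : RatHom α) (h0 : α ≠ 0) :
    ∃ r s, RatWith α r s := h.resolve_left h0

namespace RatWith

variable {α β : AddMonoid.End E.toAffine.Point} {r s r₁ s₁ r₂ s₂ : K → K}

lemma finite_ker (h : RatWith α r s) : {P | α P = 0}.Finite := by
  have := h.eventually.mono fun P hP => hP.1
  rw [eventually_cofinite] at this
  simpa using this

lemma tendsto (h : RatWith α r s) : Tendsto α cofinite cofinite := by
  refine Tendsto.cofinite_of_finite_preimage_singleton fun Q => ?_
  by_cases hQ : ∃ P, α P = Q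
  · obtain ⟨P, rfl⟩ := hQ
    refine (h.finite_ker.image (P + ·)).subset fun R hR => ⟨R - P, ?_, by simp⟩
    have : α R = α P := by simpa using hR
    simp [this]
  · push Not at hQ
    refine Set.finite_empty.subset fun R hR => (hQ R ?_).elim
    simpa using hR

section AlgClosed

variable [IsAlgClosed K] [E.IsElliptic]

lemma ne_zero (h : RatWith α r s) : α ≠ 0 := by
  rintro rfl
  obtain ⟨P, hP⟩ := h.eventually.exists
  exact hP.1 rfl

lemma not_const (h : RatWith α r s) : ¬ ∃ c, ∀ᶠ x in cofinite, r x = c := by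
  rintro ⟨c, hc⟩
  have h1 : ∀ᶠ x in cofinite, x ≠ c := by rw [eventually_cofinite]; simp
  obtain ⟨P, h2, h3, h4⟩ := (h.eventually.and ((tendsto_xc.eventually hc).and
    ((tendsto_xc.comp h.tendsto).eventually h1))).exists
  exact h4 (by rw [Function.comp, h2.2.1, h3])

lemma tendsto_fst (h : RatWith α r s) : Tendsto r cofinite cofinite :=
  h.isRat_fst.tendsto_cofinite h.not_const

lemma curve (h : RatWith α r s) :
    ∀ᶠ x in cofinite, s x ^ 2 * cubicB E x = cubicB E (r x) := by
  rw [← eventually_xc_iff (E := E)]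
  filter_upwards [h.eventually, eventually_ne_zero] with P hP h0
  rw [← hP.2.1, ← tc_sq hP.1, hP.2.2, ← tc_sq h0]
  ring

lemma snd_ne_zero (h : RatWith α r s) : ∀ᶠ x in cofinite, s x ≠ 0 := by
  filter_upwards [h.curve, h.tendsto_fst.eventually (eventually_cubicB_ne_zero E)] with x h1 h2 h3
  exact h2 (by rw [← h1, h3]; ring)

end AlgClosed

end RatWith

section AlgClosed

variable [IsAlgClosed K]

/-- A non-constant rational function takes almost every value at a point with a prescribed
property that holds almost everywhere. -/
lemma IsRat.eventually_exists_preimage {g : K → K} (hg : IsRat g)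
    (hc : ¬ ∃ c, ∀ᶠ x in cofinite, g x = c) {p : K → Prop} (hp : ∀ᶠ x in cofinite, p x) :
    ∀ᶠ c in cofinite, ∃ x, p x ∧ g x = c := by
  obtain ⟨u, v, hv, huv, hg⟩ := hg.exists_coprime
  -- If `u - c v` and `u - d v` were both constant, so would be `u` and `v`.
  have h1 : {c : K | (u - C c * v).degree = 0}.Subsingleton := by
    intro c hc1 d hd
    by_contra hcd
    have e1 : u - C c * v = C ((u - C c * v).coeff 0) := eq_C_of_degree_eq_zero hc1
    have e2 : u - C d * v = C ((u - C d * v).coeff 0) := eq_C_of_degree_eq_zero hd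
    refine hc ⟨((u - C c * v).coeff 0 + c * (((u - C c * v).coeff 0 - (u - C d * v).coeff 0) /
      (d - c))) / (((u - C c * v).coeff 0 - (u - C d * v).coeff 0) / (d - c)), ?_⟩
    filter_upwards [hg] with x hx
    have f1 := congrArg (eval x) e1
    have f2 := congrArg (eval x) e2
    rw [eval_C] at f1 f2
    rw [← f1, ← f2, hx]
    have hdc : d - c ≠ 0 := sub_ne_zero.2 (Ne.symm hcd)
    have e3 : ((u - C c * v).eval x - (u - C d * v).eval x) / (d - c) = v.eval x := by
      simp only [eval_sub, eval_mul, eval_C]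
      field_simp
      ring
    rw [e3]
    simp
  have h2 : ∀ᶠ x in cofinite, p x ∧ g x = u.eval x / v.eval x := hp.and hg
  rw [eventually_cofinite] at h2 ⊢
  refine (h1.finite.union (h2.image fun x => u.eval x / v.eval x)).subset fun c hc => ?_
  by_contra hn
  simp only [Set.mem_union, not_or, Set.mem_ofPred_eq, Set.mem_image, not_exists] at hn
  obtain ⟨x, hx⟩ := IsAlgClosed.exists_root _ hn.1
  have hx' : u.eval x = c * v.eval x := by
    simpa [IsRoot, sub_eq_zero] using hx
  have hvx : v.eval x ≠ 0 := by
    intro h0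
    obtain ⟨a, b, hab⟩ := huv
    have := congrArg (eval x) hab
    simp [hx', h0] at this
  have hxc : u.eval x / v.eval x = c := by rw [hx']; field_simp
  have hgood : p x ∧ g x = u.eval x / v.eval x := by
    by_contra hbad
    exact hn.2 x ⟨hbad, hxc⟩
  exact hc ⟨x, hgood.1, hgood.2.trans hxc⟩

variable [E.IsElliptic] {α β : AddMonoid.End E.toAffine.Point} {r s r₁ s₁ r₂ s₂ : K → K}

lemma hom_ext_of_eventually (h : ∀ᶠ P in cofinite, α P = β P) : α = β := by
  have h1 : AddMonoidHom.eqLocus α β = ⊤ :=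
    addSubgroup_eq_top_of_eventually (h.mono fun P hP => hP)
  ext P
  have : P ∈ AddMonoidHom.eqLocus α β := h1 ▸ AddSubgroup.mem_top P
  exact this

/-- The values of `r` cover almost all `x`-coordinates, so the range has finite complement. -/
lemma RatWith.surjective (h : RatWith α r s) : Function.Surjective α := by
  have h0 : ∀ᶠ x in cofinite, ∀ P : E.toAffine.Point, P ≠ 0 → xc E P = x →
      α P ≠ 0 ∧ xc E (α P) = r x := by
    have := h.eventually
    rw [eventually_cofinite] at this ⊢
    refine (this.image (xc E)).subset fun x hx => ?_
    simp only [Set.mem_ofPred_eq, not_forall] at hx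
    obtain ⟨P, hP, rfl, hb⟩ := hx
    exact ⟨P, fun hP' => hb ⟨hP'.1, hP'.2.1⟩, rfl⟩
  have h1 := (tendsto_xc (E := E)).eventually
    (h.isRat_fst.eventually_exists_preimage h.not_const h0)
  have h2 : AddMonoidHom.range (α : E.toAffine.Point →+ E.toAffine.Point) = ⊤ := by
    refine addSubgroup_eq_top_of_eventually ?_
    filter_upwards [h1, eventually_ne_zero] with R hR hR0
    obtain ⟨x, hx, hxR⟩ := hR
    obtain ⟨P, hP, rfl⟩ := exists_point_of_xc (E := E) x
    obtain ⟨h3, h4⟩ := hx P hP rfl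
    rcases eq_or_eq_neg_of_xc_eq h3 hR0 (h4.trans hxR) with h5 | h5
    · exact ⟨P, h5⟩
    · exact ⟨-P, (map_neg α P).trans (by rw [h5, neg_neg])⟩
  exact AddMonoidHom.range_eq_top.1 h2

lemma RatHom.surjective (h : RatHom α) (h0 : α ≠ 0) : Function.Surjective α := by
  obtain ⟨r, s, hrs⟩ := h.exists_of_ne_zero h0
  exact hrs.surjective

lemma RatHom.finite_ker (h : RatHom α) (h0 : α ≠ 0) : {P | α P = 0}.Finite := by
  obtain ⟨r, s, hrs⟩ := h.exists_of_ne_zero h0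
  exact hrs.finite_ker

lemma ratWith_one : RatWith (1 : AddMonoid.End E.toAffine.Point) (fun x => x) (fun _ => 1) :=
  ⟨isRat_id, isRat_const 1, eventually_ne_zero.mono fun _ hP => ⟨hP, rfl, (one_mul _).symm⟩⟩

lemma RatWith.neg (h : RatWith α r s) : RatWith (-α) r (fun x => -s x) := by
  refine ⟨h.isRat_fst, h.isRat_snd.neg, h.eventually.mono fun P hP => ?_⟩
  have e : (-α) P = -α P := rfl
  rw [e, xc_neg, tc_neg]
  exact ⟨neg_ne_zero.2 hP.1, hP.2.1, by rw [hP.2.2]; ring⟩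

lemma RatWith.comp (h₁ : RatWith α r₁ s₁) (h₂ : RatWith β r₂ s₂) :
    RatWith (α * β) (fun x => r₁ (r₂ x)) (fun x => s₁ (r₂ x) * s₂ x) := by
  refine ⟨h₁.isRat_fst.comp h₂.isRat_fst h₂.tendsto_fst,
    (h₁.isRat_snd.comp h₂.isRat_fst h₂.tendsto_fst).mul h₂.isRat_snd, ?_⟩
  filter_upwards [h₂.eventually, h₂.tendsto.eventually h₁.eventually] with P h3 h4
  have e : (α * β) P = α (β P) := rfl
  rw [e, h4.2.1, h4.2.2, h3.2.1, h3.2.2]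
  exact ⟨h4.1, rfl, by ring⟩

/-- The two rational functions describing the sum of two homomorphisms: the chord law. -/
lemma RatWith.add_of_ne (h₁ : RatWith α r₁ s₁) (h₂ : RatWith β r₂ s₂)
    (hne : ∀ᶠ x in cofinite, r₁ x ≠ r₂ x) :
    RatWith (α + β)
      (fun x => ((s₂ x - s₁ x) / (r₂ x - r₁ x)) ^ 2 * cubicB E x / 4 - E.b₂ / 4 - r₁ x - r₂ x)
      (fun x => -(s₁ x + (s₂ x - s₁ x) / (r₂ x - r₁ x) *
        (((s₂ x - s₁ x) / (r₂ x - r₁ x)) ^ 2 * cubicB E x / 4 - E.b₂ / 4 - r₁ x - r₂ x -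
          r₁ x))) := by
  have hm := (h₂.isRat_snd.sub h₁.isRat_snd).div (h₂.isRat_fst.sub h₁.isRat_fst)
  have hr := ((((hm.sq.mul (hasDer_cubicB E).isRat).div (isRat_const 4)).sub
    (isRat_const (E.b₂ / 4))).sub h₁.isRat_fst).sub h₂.isRat_fst
  refine ⟨hr, (h₁.isRat_snd.add (hm.mul (hr.sub h₁.isRat_fst))).neg, ?_⟩
  filter_upwards [h₁.eventually, h₂.eventually, tendsto_xc.eventually hne, eventually_ne_zero]
    with P a b c d
  have e : (α + β) P = α P + β P := rfl
  have hx : xc E (α P) ≠ xc E (β P) := by rw [a.2.1, b.2.1]; exact c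
  obtain ⟨k1, k2⟩ := chord_law a.1 b.1 hx
  rw [e]
  have hd : r₂ (xc E P) - r₁ (xc E P) ≠ 0 := sub_ne_zero.2 c.symm
  refine ⟨add_ne_zero_of_xc_ne hx, ?_, ?_⟩
  · rw [k1, a.2.1, a.2.2, b.2.1, b.2.2, ← tc_sq d]
    field_simp
  · rw [k2, k1, a.2.1, a.2.2, b.2.1, b.2.2, ← tc_sq d]
    field_simp

/-- The two rational functions describing multiplication by two: the tangent law. -/
lemma ratWith_one_add_one : RatWith (1 + 1 : AddMonoid.End E.toAffine.Point)
    (fun x => cubicB' E x ^ 2 / (16 * cubicB E x) - E.b₂ / 4 - 2 * x)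
    (fun x => -(1 + cubicB' E x / (2 * cubicB E x) *
      (cubicB' E x ^ 2 / (16 * cubicB E x) - E.b₂ / 4 - 2 * x - x))) := by
  have hB := (hasDer_cubicB E).isRat
  have hB' := (hasDer_cubicB E).isRat_der
  have hr := ((hB'.sq.div ((isRat_const 16).mul hB)).sub (isRat_const (E.b₂ / 4))).sub
    ((isRat_const 2).mul isRat_id)
  refine ⟨hr, ((isRat_const 1).add ((hB'.div ((isRat_const 2).mul hB)).mul (hr.sub isRat_id))).neg,
    ?_⟩
  filter_upwards [eventually_ne_zero, eventually_tc_ne_zero] with P h0 ht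
  obtain ⟨k0, k1, k2⟩ := tangent_law h0 ht
  have e : (1 + 1 : AddMonoid.End E.toAffine.Point) P = P + P := rfl
  rw [e, k2, k1, ← tc_sq h0]
  refine ⟨k0, ?_, ?_⟩
  · field_simp
    ring
  · field_simp
    ring

lemma ratHom_zero : RatHom (0 : AddMonoid.End E.toAffine.Point) := .inl rfl

lemma ratHom_one : RatHom (1 : AddMonoid.End E.toAffine.Point) := .inr ⟨_, _, ratWith_one⟩

lemma RatHom.neg (h : RatHom α) : RatHom (-α) := by
  rcases h with rfl | ⟨r, s, h⟩
  · exact .inl neg_zero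
  · exact .inr ⟨_, _, h.neg⟩

lemma RatHom.mul (h₁ : RatHom α) (h₂ : RatHom β) : RatHom (α * β) := by
  rcases h₁ with rfl | ⟨r, s, h₁⟩
  · exact .inl (zero_mul _)
  rcases h₂ with rfl | ⟨r', s', h₂⟩
  · exact .inl (mul_zero _)
  exact .inr ⟨_, _, h₁.comp h₂⟩

/-- An endomorphism is determined up to sign by its effect on `x`-coordinates. -/
lemma RatWith.eq_or_eq_neg_of_eventually (h₁ : RatWith α r₁ s₁) (h₂ : RatWith β r₂ s₂)
    (he : ∀ᶠ x in cofinite, r₁ x = r₂ x) : α = β ∨ α = -β := by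
  have key : ∀ {γ δ : AddMonoid.End E.toAffine.Point} {r s r' s' : K → K},
      RatWith γ r s → RatWith δ r' s' → (∀ᶠ x in cofinite, r x = r' x) →
      (∀ᶠ x in cofinite, s x = s' x) → γ = δ := by
    intro γ δ r s r' s' h h' e e'
    refine hom_ext_of_eventually ?_
    filter_upwards [h.eventually, h'.eventually, tendsto_xc.eventually e,
      tendsto_xc.eventually e'] with P a b c d
    exact point_ext a.1 b.1 (by rw [a.2.1, b.2.1, c]) (by rw [a.2.2, b.2.2, d])
  have hs : ∀ᶠ x in cofinite, s₁ x = s₂ x ∨ s₁ x = -s₂ x := by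
    filter_upwards [h₁.curve, h₂.curve, he, eventually_cubicB_ne_zero E] with x a b c d
    rw [c, ← b] at a
    exact sq_eq_sq_iff_eq_or_eq_neg.1 (mul_right_cancel₀ d a)
  rcases h₁.isRat_snd.eventually_eq_or_ne h₂.isRat_snd with h | h
  · exact .inl (key h₁ h₂ he h)
  · exact .inr (key h₁ h₂.neg he (by
      filter_upwards [h, hs] with x a b using b.resolve_left a))

lemma RatHom.add (h₁ : RatHom α) (h₂ : RatHom β) : RatHom (α + β) := by
  rcases h₁ with rfl | ⟨r, s, h₁⟩
  · rwa [zero_add]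
  rcases h₂ with rfl | ⟨r', s', h₂⟩
  · rw [add_zero]; exact .inr ⟨_, _, h₁⟩
  rcases h₁.isRat_fst.eventually_eq_or_ne h₂.isRat_fst with h | h
  · rcases h₁.eq_or_eq_neg_of_eventually h₂ h with rfl | rfl
    · rw [show α + α = (1 + 1) * α by rw [add_mul, one_mul]]
      exact .inr ⟨_, _, ratWith_one_add_one.comp h₁⟩
    · exact .inl (neg_add_cancel _)
  · exact .inr ⟨_, _, h₁.add_of_ne h₂ h⟩

lemma ratHom_natCast (n : ℕ) : RatHom (n : AddMonoid.End E.toAffine.Point) := by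
  induction n with
  | zero => simpa using ratHom_zero
  | succ n ih => rw [Nat.cast_succ]; exact ih.add ratHom_one

lemma ratHom_intCast (n : ℤ) : RatHom (n : AddMonoid.End E.toAffine.Point) := by
  obtain ⟨k, rfl | rfl⟩ := n.eq_nat_or_neg
  · simpa using ratHom_natCast k
  · simpa using (ratHom_natCast k).neg

end AlgClosed

end RationalHoms

/-! ### The action on the invariant differential, and commutativity -/

section Differential

open Filter

variable {K : Type*} [Field K] [CharZero K] [IsAlgClosed K] [DecidableEq K]
  {E : WeierstrassCurve K} [E.IsElliptic]
  {α β : AddMonoid.End E.toAffine.Point} {r s r₁ s₁ r₂ s₂ : K → K}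

/-- `α` multiplies the invariant differential `dx / t` by the constant `c`: if `α` is given by
`(x, t) ↦ (r(x), s(x) t)`, then `r' = c s`. -/
def Scales (α : AddMonoid.End E.toAffine.Point) (c : K) : Prop :=
  ∃ r s, RatWith α r s ∧ HasDer r (fun x => c * s x)

lemma RatWith.unique (h₁ : RatWith α r₁ s₁) (h₂ : RatWith α r₂ s₂) :
    (∀ᶠ x in cofinite, r₁ x = r₂ x) ∧ ∀ᶠ x in cofinite, s₁ x = s₂ x := by
  rw [← eventually_xc_iff (E := E), ← eventually_xc_iff (E := E), ← eventually_and]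
  filter_upwards [h₁.eventually, h₂.eventually, eventually_tc_ne_zero] with P a b c
  exact ⟨a.2.1.symm.trans b.2.1, mul_right_cancel₀ c (a.2.2.symm.trans b.2.2)⟩

lemma Scales.unique {c d : K} (hc : Scales α c) (hd : Scales α d) : c = d := by
  obtain ⟨r, s, h, hder⟩ := hc
  obtain ⟨r', s', h', hder'⟩ := hd
  obtain ⟨e1, e2⟩ := h.unique h'
  have := hder.unique (hder'.congr e1 (.of_forall fun _ => rfl))
  obtain ⟨x, a, b, c'⟩ := (this.and (e2.and h.snd_ne_zero)).exists
  rw [← b] at a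
  exact mul_right_cancel₀ c' a

lemma Scales.ne_zero {c : K} (hc : Scales α c) : c ≠ 0 := by
  rintro rfl
  obtain ⟨r, s, h, hder⟩ := hc
  exact h.not_const (hder.eventually_eq_const (.of_forall fun x => zero_mul _))

lemma Scales.neg {c : K} (hc : Scales α c) : Scales (-α) (-c) := by
  obtain ⟨r, s, h, hder⟩ := hc
  exact ⟨_, _, h.neg, by simpa using hder⟩

lemma Scales.mul {c d : K} (hc : Scales α c) (hd : Scales β d) : Scales (α * β) (c * d) := by
  obtain ⟨r, s, h, hder⟩ := hc
  obtain ⟨r', s', h', hder'⟩ := hd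
  refine ⟨_, _, h.comp h', (hder.comp hder' h'.tendsto_fst).congr (.of_forall fun _ => rfl)
    (.of_forall fun x => by ring)⟩

/-- The derivative of the equation `s² B = B ∘ r`. -/
lemma RatWith.curve_der (h : RatWith α r s) {c : K} (hr : HasDer r (fun x => c * s x))
    {s' : K → K} (hs : HasDer s s') :
    ∀ᶠ x in cofinite, 2 * cubicB E x * s' x + s x * cubicB' E x = c * cubicB' E (r x) := by
  have h1 := (hs.sq.mul (hasDer_cubicB E)).unique
    (((hasDer_cubicB E).comp hr h.tendsto_fst).congr h.curve (.of_forall fun _ => rfl))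
  filter_upwards [h1, h.snd_ne_zero] with x a b
  apply mul_left_cancel₀ b
  linear_combination a

/-- Additivity of the action on the invariant differential, when the chord law applies. -/
lemma scales_add_of_ne (h₁ : RatWith α r₁ s₁) (h₂ : RatWith β r₂ s₂) {c₁ c₂ : K}
    (d₁ : HasDer r₁ (fun x => c₁ * s₁ x)) (d₂ : HasDer r₂ (fun x => c₂ * s₂ x))
    (hne : ∀ᶠ x in cofinite, r₁ x ≠ r₂ x) : Scales (α + β) (c₁ + c₂) := by
  obtain ⟨s₁', e₁⟩ := h₁.isRat_snd.exists_hasDer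
  obtain ⟨s₂', e₂⟩ := h₂.isRat_snd.exists_hasDer
  refine ⟨_, _, h₁.add_of_ne h₂ hne, ?_⟩
  have hm := (e₂.sub e₁).div (d₂.sub d₁)
  refine ((((hm.sq.mul (hasDer_cubicB E)).const_mul 4⁻¹).sub (hasDer_const (E.b₂ / 4))).sub
    d₁ |>.sub d₂).congr (.of_forall fun x => by ring) ?_
  filter_upwards [hne, h₁.curve, h₂.curve, h₁.curve_der d₁ e₁, h₂.curve_der d₂ e₂]
    with x ne k₁ k₂ f₁ f₂
  have hd : r₂ x - r₁ x ≠ 0 := sub_ne_zero.2 ne.symm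
  -- `m t` is the slope of the chord, and `m'` is the derivative of `m`.
  obtain ⟨m, hm⟩ : ∃ m, m = (s₂ x - s₁ x) / (r₂ x - r₁ x) := ⟨_, rfl⟩
  obtain ⟨m', hm'⟩ : ∃ m', m' = (s₂' x - s₁' x) * (r₂ x - r₁ x)⁻¹ +
    (s₂ x - s₁ x) * (-(c₂ * s₂ x - c₁ * s₁ x) / (r₂ x - r₁ x) ^ 2) := ⟨_, rfl⟩
  rw [← hm, ← hm']
  have g1 : m * (r₂ x - r₁ x) = s₂ x - s₁ x := by rw [hm]; field_simp
  have g2 : m' * (r₂ x - r₁ x) = s₂' x - s₁' x - m * (c₂ * s₂ x - c₁ * s₁ x) := by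
    rw [hm', hm]; field_simp; ring
  generalize r₂ x = R₂ at *
  generalize r₁ x = R₁ at *
  generalize s₂ x = S₂ at *
  generalize s₁ x = S₁ at *
  generalize s₂' x = S₂' at *
  generalize s₁' x = S₁' at *
  -- The difference of the two equations `s² B = B ∘ r`, divided by `R₂ - R₁`.
  have key : 2 * m * S₁ * cubicB E x + m ^ 2 * (R₂ - R₁) * cubicB E x =
      cubicB' E R₁ + (R₂ - R₁) * (E.b₂ + 8 * R₁ + 4 * R₂) := by
    apply mul_left_cancel₀ hd
    have h2 : S₂ = S₁ + m * (R₂ - R₁) := by rw [g1]; ring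
    rw [h2] at k₂
    generalize cubicB E x = B at *
    simp only [cubicB, cubicB'] at *
    linear_combination k₂ - k₁
  have h2 : S₂ = S₁ + m * (R₂ - R₁) := by rw [g1]; ring
  apply mul_left_cancel₀ hd
  subst h2
  generalize cubicB E x = B at *
  generalize cubicB' E x = B' at *
  simp only [cubicB, cubicB'] at *
  linear_combination -(m * B / 2) * g2 - m / 4 * (f₂ - f₁) - (c₁ - c₂) * m / 4 * key

lemma scales_one_add_one : Scales (1 + 1 : AddMonoid.End E.toAffine.Point) 2 := by
  refine ⟨_, _, ratWith_one_add_one, ?_⟩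
  have hB := hasDer_cubicB E
  have hB' : HasDer (cubicB' E) (fun x => 24 * x + 2 * E.b₂) := by
    refine (hasDer_poly (C 12 * X ^ 2 + C (2 * E.b₂) * X + C (2 * E.b₄))).congr
      (.of_forall fun x => ?_) (.of_forall fun x => ?_)
    · simp [cubicB']
    · simp
      ring
  refine (((hB'.sq.div (hB.const_mul 16)).sub (hasDer_const (E.b₂ / 4))).sub
    (hasDer_id.const_mul 2)).congr (.of_forall fun x => rfl) ?_
  filter_upwards [eventually_cubicB_ne_zero E] with x hx
  generalize hb : cubicB E x = B at *
  field_simp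
  simp only [cubicB'] at *
  ring

/-- Successive halves of a point of order two: they are distinct since their orders are. -/
lemma exists_halving_sequence : ∃ P : ℕ → E.toAffine.Point, Function.Injective P ∧
    ∀ k, P (k + 1) + P (k + 1) = P k := by
  obtain ⟨x, hx⟩ := IsAlgClosed.exists_root
    (C 4 * X ^ 3 + C E.b₂ * X ^ 2 + C (2 * E.b₄) * X + C E.b₆ : K[X])
    (by rw [degree_cubic (by norm_num)]; norm_num)
  have hx' : (0 : K) ^ 2 = cubicB E x := by
    simpa [cubicB] using hx.symm
  obtain ⟨T, hT0, -, hT⟩ := exists_point hx'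
  have hTT : T + T = 0 := by
    have : T = -T := point_ext hT0 (neg_ne_zero.2 hT0) (by simp) (by simp [hT])
    nth_rw 2 [this]
    exact add_neg_cancel T
  have hsurj := (ratWith_one_add_one (E := E)).surjective
  choose half hhalf using hsurj
  have hhalf' : ∀ Q, half Q + half Q = Q := hhalf
  let P : ℕ → E.toAffine.Point := fun k => half^[k] T
  have hP : ∀ k, P (k + 1) + P (k + 1) = P k := fun k => by
    simp only [P, Function.iterate_succ_apply']
    exact hhalf' _
  have hpow : ∀ k, (2 ^ k) • P k = T := by
    intro k
    induction k with
    | zero => simp [P]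
    | succ k ih => rw [pow_succ, mul_smul, two_smul, hP, ih]
  refine ⟨P, ?_, hP⟩
  have hlt : ∀ i j, i < j → P i ≠ P j := by
    intro i j hij h
    obtain ⟨d, rfl⟩ := Nat.exists_eq_add_of_lt hij
    have h1 := hpow (i + d + 1)
    rw [← h, show i + d + 1 = (d + 1) + i by ring, pow_add, mul_smul, hpow, pow_succ, mul_smul,
      two_smul, hTT, smul_zero] at h1
    exact hT0 h1.symm
  intro i j h
  rcases lt_trichotomy i j with hij | hij | hij
  · exact (hlt i j hij h).elim
  · exact hij
  · exact (hlt j i hij h.symm).elim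

/-- A non-zero endomorphism acts on the invariant differential by a constant: the factor is a
rational function invariant under duplication, hence constant along a halving sequence. -/
lemma RatWith.exists_scales (h : RatWith α r s) : ∃ c, HasDer r (fun x => c * s x) := by
  obtain ⟨r', hr⟩ := h.isRat_fst.exists_hasDer
  obtain ⟨r₂, s₂, h₂, hr₂⟩ := scales_one_add_one (E := E)
  have hf : IsRat (fun x => r' x / s x) := hr.isRat_der.div h.isRat_snd
  have hcomm : α * (1 + 1) = (1 + 1) * α := by rw [mul_add, add_mul, mul_one, one_mul]
  have h3 := h.comp h₂
  rw [hcomm] at h3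
  obtain ⟨e1, e2⟩ := h3.unique (h₂.comp h)
  have d1 := (hr.comp hr₂ h₂.tendsto_fst).unique
    ((hr₂.comp hr h.tendsto_fst).congr e1 (.of_forall fun _ => rfl))
  -- `α` commutes with duplication; compare the derivatives of both composites.
  have hinv : ∀ᶠ x in cofinite, r' (r₂ x) / s (r₂ x) = r' x / s x := by
    filter_upwards [d1, e2, h.snd_ne_zero, h₂.tendsto_fst.eventually h.snd_ne_zero,
      h₂.snd_ne_zero] with x a b c d e
    rw [div_eq_div_iff d c]
    apply mul_right_cancel₀ (mul_ne_zero two_ne_zero e)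
    linear_combination s x * a - 2 * r' x * b
  obtain ⟨P, hinj, hP⟩ := exists_halving_sequence (E := E)
  have hev : ∀ᶠ k in cofinite,
      r' (xc E (P k)) / s (xc E (P k)) = r' (xc E (P (k + 1))) / s (xc E (P (k + 1))) := by
    have hinj' : Function.Injective fun k => P (k + 1) := fun i j hij => by
      simpa using hinj hij
    filter_upwards [hinj'.tendsto_cofinite.eventually (tendsto_xc.eventually hinv),
      hinj'.tendsto_cofinite.eventually h₂.eventually] with k a b
    have e : (1 + 1 : AddMonoid.End E.toAffine.Point) (P (k + 1)) = P k := hP k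
    rw [← b.2.1, e] at a
    exact a
  rw [Nat.cofinite_eq_atTop, eventually_atTop] at hev
  obtain ⟨N, hN⟩ := hev
  have hconst : ∀ k ≥ N, r' (xc E (P k)) / s (xc E (P k)) = r' (xc E (P N)) / s (xc E (P N)) := by
    intro k hk
    induction k, hk using Nat.le_induction with
    | base => rfl
    | succ k hk ih => rw [← hN k hk, ih]
  set c := r' (xc E (P N)) / s (xc E (P N))
  have hfreq : ∃ᶠ x in cofinite, r' x / s x = c := by
    have : Tendsto (fun k => xc E (P k)) atTop cofinite :=
      (tendsto_xc.comp hinj.tendsto_cofinite).mono_left Nat.cofinite_eq_atTop.ge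
    exact this.frequently ((eventually_atTop.2 ⟨N, hconst⟩).frequently)
  refine ⟨c, hr.congr (.of_forall fun _ => rfl) ?_⟩
  filter_upwards [hf.eventually_eq_of_frequently (isRat_const c) hfreq, h.snd_ne_zero] with x a b
  rw [← a]
  field_simp

/-- In characteristic zero the endomorphism ring is commutative: it acts faithfully on the
invariant differential. -/
theorem RatHom.mul_comm (hα : RatHom α) (hβ : RatHom β) : α * β = β * α := by
  rcases hα with rfl | ⟨r₁, s₁, h₁⟩
  · rw [zero_mul, mul_zero]
  rcases hβ with rfl | ⟨r₂, s₂, h₂⟩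
  · rw [zero_mul, mul_zero]
  obtain ⟨a, ha⟩ := h₁.exists_scales
  obtain ⟨b, hb⟩ := h₂.exists_scales
  have hab : Scales (α * β) (a * b) := Scales.mul ⟨_, _, h₁, ha⟩ ⟨_, _, h₂, hb⟩
  have hba : Scales (β * α) (a * b) := by
    have : Scales (β * α) (b * a) := Scales.mul ⟨_, _, h₂, hb⟩ ⟨_, _, h₁, ha⟩
    rwa [_root_.mul_comm] at this
  -- If `αβ` and `-βα` are not equal up to sign, the chord law gives their sum the factor
  -- `ab - ab = 0`.
  obtain ⟨r, s, h, hd⟩ := id hab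
  obtain ⟨r', s', h', hd'⟩ := hba.neg
  rcases h.isRat_fst.eventually_eq_or_ne h'.isRat_fst with he | he
  · rcases h.eq_or_eq_neg_of_eventually h' he with e | e
    · rw [e] at hab
      exact absurd (hab.unique hba.neg) fun h0 => hba.ne_zero (self_eq_neg.1 h0)
    · rw [e, neg_neg]
  · exact absurd (add_neg_cancel _) (scales_add_of_ne h h' hd hd' he).ne_zero

end Differential

/-! ### Descent of rational functions along a rational function -/

section Descent

open Filter

variable {K : Type*} [Field K] [CharZero K] [IsAlgClosed K]

/-- For almost every `c`, the fibre of `u / v` over `c` consists of simple points that all have a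
prescribed property. -/
lemma eventually_fibre {u v : K[X]} (huv : IsCoprime u v)
    (hW : derivative u * v - u * derivative v ≠ 0) {p : K → Prop} (hp : ∀ᶠ x in cofinite, p x) :
    ∀ᶠ c in cofinite, (u - C c * v).roots.Nodup ∧
      ∀ x, (u - C c * v).eval x = 0 → v.eval x ≠ 0 ∧ u.eval x / v.eval x = c ∧ p x := by
  have h1 := hp.and (eventually_eval_ne_zero hW)
  rw [eventually_cofinite] at h1 ⊢
  refine (h1.image fun x => u.eval x / v.eval x).subset fun c hc => ?_
  by_contra hn
  have key : ∀ x, (u - C c * v).eval x = 0 → v.eval x ≠ 0 ∧ u.eval x / v.eval x = c ∧ p x ∧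
      (derivative u * v - u * derivative v).eval x ≠ 0 := by
    intro x hx
    have hx' : u.eval x = c * v.eval x := by simpa [sub_eq_zero] using hx
    have hvx : v.eval x ≠ 0 := by
      intro h0
      obtain ⟨a, b, hab⟩ := huv
      have := congrArg (eval x) hab
      simp [hx', h0] at this
    have hxc : u.eval x / v.eval x = c := by rw [hx']; field_simp
    refine ⟨hvx, hxc, ?_⟩
    by_contra hbad
    exact hn ⟨x, hbad, hxc⟩
  refine hc ⟨?_, fun x hx => ⟨(key x hx).1, (key x hx).2.1, (key x hx).2.2.1⟩⟩
  classical
  rw [Multiset.nodup_iff_count_le_one]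
  intro x
  by_contra hlt
  rw [count_roots, not_le] at hlt
  have h0 : u - C c * v ≠ 0 := by
    intro h0
    rw [h0, rootMultiplicity_zero] at hlt
    omega
  obtain ⟨e1, e2⟩ := (one_lt_rootMultiplicity_iff_isRoot h0).1 hlt
  have k := key x e1
  apply k.2.2.2
  simp only [IsRoot, derivative_sub, derivative_mul, derivative_C, zero_mul, zero_add, eval_sub,
    eval_mul, eval_C] at e1 e2
  simp only [eval_sub, eval_mul]
  linear_combination v.eval x * e2 - v.derivative.eval x * e1

/-- Suppose `g ∘ (u / v) = b` with `b` rational. The remainders of numerator and denominator of `b`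
modulo the monic polynomial `u - c v` in `x` have coefficients polynomial in `c`, and `g(c)` is
their ratio. -/
lemma isRat_of_comp_of_monic {g b : K → K} {u v : K[X]} (hu : u.Monic) (huv : IsCoprime u v)
    (hdeg : v.degree < u.degree) (hW : derivative u * v - u * derivative v ≠ 0) (hb : IsRat b)
    (H : ∀ᶠ x in cofinite, g (u.eval x / v.eval x) = b x) : IsRat g := by
  obtain ⟨w, z, hz, hb⟩ := hb
  -- The inner variable plays the role of `c`: `P` specializes to `u - c v`.
  let P : K[X][X] := u.map C - C X * v.map C
  have hP : P.Monic := by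
    refine (hu.map C).sub_of_left ?_
    rw [hu.degree_map]
    refine lt_of_le_of_lt ((degree_C_mul X_ne_zero).le.trans degree_map_le) hdeg
  have hPc : ∀ c, P.map (evalRingHom c) = u - C c * v := by
    intro c
    have : (evalRingHom c).comp (C : K →+* K[X]) = RingHom.id K := by ext; simp
    simp only [P, Polynomial.map_sub, Polynomial.map_mul, Polynomial.map_map, this,
      Polynomial.map_id, map_C, coe_evalRingHom, eval_X]
  have hmod : ∀ (q : K[X]) c, ((q.map C) %ₘ P).map (evalRingHom c) = q %ₘ (u - C c * v) := by
    intro q c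
    have : (evalRingHom c).comp (C : K →+* K[X]) = RingHom.id K := by ext; simp
    rw [map_modByMonic _ hP, hPc, Polynomial.map_map, this, Polynomial.map_id]
  have hgen := eventually_fibre huv hW ((H.and hb).and (eventually_eval_ne_zero hz))
  have hmon : ∀ c, (u - C c * v).Monic := fun c => hPc c ▸ hP.map _
  -- The roots of `u - c v` are simple, and `w = g(c) z` at each of them.
  have hrel : ∀ᶠ c in cofinite, w %ₘ (u - C c * v) = C (g c) * (z %ₘ (u - C c * v)) := by
    filter_upwards [hgen] with c hc
    have hdvd : (u - C c * v) ∣ w - C (g c) * z := by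
      rcases eq_or_ne (w - C (g c) * z) 0 with h0 | h0
      · rw [h0]; exact dvd_zero _
      refine (IsAlgClosed.splits _).dvd_of_roots_le_roots (hmon c).ne_zero ?_
      rw [Multiset.le_iff_subset hc.1]
      intro x hx
      rw [mem_roots (hmon c).ne_zero] at hx
      obtain ⟨h1, h2, ⟨h3, h4⟩, h5⟩ := hc.2 x hx
      rw [h2, h4] at h3
      rw [mem_roots h0, IsRoot, eval_sub, eval_mul, eval_C, h3]
      field_simp
      simp
    rw [← (modByMonic_eq_zero_iff_dvd (hmon c)), sub_modByMonic, sub_eq_zero] at hdvd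
    rw [hdvd, ← smul_eq_C_mul, smul_modByMonic, smul_eq_C_mul]
  -- The remainder of `z` does not vanish, because `z` is non-zero at the roots of `u - c v`.
  obtain ⟨i, hi⟩ : ∃ i, ((z.map C) %ₘ P).coeff i ≠ 0 := by
    by_contra hn
    push Not at hn
    have h0 : (z.map C) %ₘ P = 0 := Polynomial.ext fun i => by rw [hn i, coeff_zero]
    obtain ⟨c, hc⟩ := hgen.exists
    have hdegc : (u - C c * v).degree ≠ 0 := by
      rw [← hPc, hP.degree_map]
      intro h1
      have h2 : P = 1 := hP.natDegree_eq_zero.1 (natDegree_eq_of_degree_eq_some h1)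
      have h3 : u.degree = 0 := by
        have : u.degree = P.degree := by
          rw [← hu.degree_map (C : K →+* K[X])]
          refine (degree_sub_eq_left_of_degree_lt ?_).symm
          rw [hu.degree_map]
          exact lt_of_le_of_lt ((degree_C_mul X_ne_zero).le.trans degree_map_le) hdeg
        rw [this, h1]
      have h4 : v = 0 := degree_eq_bot.1 (Nat.WithBot.lt_zero_iff.1 (by rwa [h3] at hdeg))
      exact hW (by simp [h4])
    obtain ⟨x, hx⟩ := IsAlgClosed.exists_root _ hdegc
    have h1 := hmod z c
    rw [h0, Polynomial.map_zero] at h1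
    have h2 := congrArg (eval x) (modByMonic_add_div z (u - C c * v))
    rw [← h1, zero_add, eval_mul, hx.eq_zero, zero_mul] at h2
    exact (hc.2 x hx).2.2.2 h2.symm
  refine ⟨((w.map C) %ₘ P).coeff i, ((z.map C) %ₘ P).coeff i, hi, ?_⟩
  filter_upwards [hrel, eventually_eval_ne_zero hi] with c h1 h2
  rw [← hmod, ← hmod] at h1
  have h3 := congrArg (coeff · i) h1
  simp only [coeff_map, coeff_C_mul, coe_evalRingHom] at h3
  rw [h3]
  field_simp

lemma isRat_of_comp_of_degree_lt {g b : K → K} {u v : K[X]} (huv : IsCoprime u v)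
    (hdeg : v.degree < u.degree) (hW : derivative u * v - u * derivative v ≠ 0) (hb : IsRat b)
    (H : ∀ᶠ x in cofinite, g (u.eval x / v.eval x) = b x) : IsRat g := by
  have hu : u ≠ 0 := by rintro rfl; simp at hdeg
  have hl : u.leadingCoeff⁻¹ ≠ 0 := inv_ne_zero (leadingCoeff_ne_zero.2 hu)
  have hunit : IsUnit (C u.leadingCoeff⁻¹) := isUnit_C.2 (isUnit_iff_ne_zero.2 hl)
  refine isRat_of_comp_of_monic (u := u * C u.leadingCoeff⁻¹) (v := v * C u.leadingCoeff⁻¹)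
    (monic_mul_leadingCoeff_inv hu)
    ((isCoprime_mul_unit_right hunit u v).2 huv) ?_ ?_ hb (H.mono fun x hx => ?_)
  · rwa [degree_mul_C hl, degree_mul_C hl]
  · intro h0
    apply hW
    simp only [derivative_mul, derivative_C, mul_zero, add_zero] at h0
    have : (derivative u * v - u * derivative v) *
        (C u.leadingCoeff⁻¹ * C u.leadingCoeff⁻¹) = 0 := by
      linear_combination h0
    exact (mul_eq_zero.1 this).resolve_right (mul_ne_zero hunit.ne_zero hunit.ne_zero)
  · rw [eval_mul, eval_mul, eval_C, mul_div_mul_right _ _ hl]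
    exact hx

/-- A fraction that is not constant has finitely many critical points. -/
lemma wronskian_ne_zero {a : K → K} (hc : ¬ ∃ c, ∀ᶠ x in cofinite, a x = c) {u v : K[X]}
    (hv : v ≠ 0) (h : ∀ᶠ x in cofinite, a x = u.eval x / v.eval x) :
    derivative u * v - u * derivative v ≠ 0 := by
  intro h0
  have h1 : HasDer a (fun _ => 0) := by
    refine ⟨u, v, hv, h.mono fun x hx => ⟨hx, ?_⟩⟩
    have := congrArg (eval x) h0
    simp only [eval_sub, eval_mul, eval_zero] at this
    rw [this, zero_div]
  exact hc (h1.eventually_eq_const (.of_forall fun _ => rfl))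

/-- If `g ∘ a` is rational for a non-constant rational function `a`, then `g` is rational. -/
theorem isRat_of_comp {g a b : K → K} (ha : IsRat a) (hc : ¬ ∃ c, ∀ᶠ x in cofinite, a x = c)
    (hb : IsRat b) (H : ∀ᶠ x in cofinite, g (a x) = b x) : IsRat g := by
  obtain ⟨u, v, hv, huv, h⟩ := ha.exists_coprime
  have hW := wronskian_ne_zero hc hv h
  have H' : ∀ᶠ x in cofinite, g (u.eval x / v.eval x) = b x := by
    filter_upwards [h, H] with x h1 h2
    rwa [← h1]
  -- The case `deg v < deg u` is reached by composing with `c ↦ c⁻¹` and `c ↦ c + e`.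
  have hlt : ∀ {g : K → K} {u v : K[X]}, IsCoprime u v → u.degree < v.degree →
      derivative u * v - u * derivative v ≠ 0 →
      (∀ᶠ x in cofinite, g (u.eval x / v.eval x) = b x) → IsRat g := by
    intro g u v huv hd hW H
    have h1 : IsRat fun c => g c⁻¹ := by
      refine isRat_of_comp_of_degree_lt huv.symm hd ?_ hb (H.mono fun x hx => ?_)
      · intro h0; apply hW; linear_combination -h0
      · rwa [inv_div]
    have h2 : IsRat fun c => g (c⁻¹)⁻¹ := h1.comp isRat_id.inv inv_injective.tendsto_cofinite
    simpa using h2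
  rcases lt_trichotomy u.degree v.degree with hd | hd | hd
  · exact hlt huv hd hW H'
  · have hu : u ≠ 0 := by
      rintro rfl
      rw [degree_zero] at hd
      exact hv (degree_eq_bot.1 hd.symm)
    obtain ⟨e, he⟩ : ∃ e, u.leadingCoeff = e * v.leadingCoeff :=
      ⟨u.leadingCoeff / v.leadingCoeff, by
        field_simp [leadingCoeff_ne_zero.2 hv]⟩
    have he0 : e ≠ 0 := by
      rintro rfl
      rw [zero_mul] at he
      exact hu (leadingCoeff_eq_zero.1 he)
    have h1 : IsRat fun c => g (c + e) := by
      refine hlt (u := u - C e * v) (v := v) ?_ ?_ ?_ ?_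
      · obtain ⟨p, q, hpq⟩ := huv
        exact ⟨p, q + C e * p, by linear_combination hpq⟩
      · rw [← hd]
        refine degree_sub_lt_left ?_ hu ?_
        · rw [degree_C_mul he0, hd]
        · rw [leadingCoeff_mul, leadingCoeff_C, he]
      · intro h0
        apply hW
        simp only [derivative_sub, derivative_mul, derivative_C] at h0
        linear_combination h0
      · filter_upwards [H', eventually_eval_ne_zero hv] with x hx hx'
        rw [← hx]
        congr 1
        simp only [eval_sub, eval_mul, eval_C]
        field_simp
        ring
    have h2 : IsRat fun c => g (c - e + e) :=
      h1.comp (isRat_id.sub (isRat_const e)) (sub_left_injective.tendsto_cofinite)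
    simpa using h2
  · exact isRat_of_comp_of_degree_lt huv hd hW hb H'

variable [DecidableEq K] {E : WeierstrassCurve K} [E.IsElliptic]
  {α β w : AddMonoid.End E.toAffine.Point}

/-- A group homomorphism whose composite with a non-zero rational homomorphism is rational is
rational itself. -/
theorem RatHom.of_mul (hα : RatHom α) (hα0 : α ≠ 0) (hβ : RatHom (w * α)) : RatHom w := by
  have hsurj := hα.surjective hα0
  by_cases h0 : w * α = 0
  · left
    ext Q
    obtain ⟨P, rfl⟩ := hsurj Q
    exact DFunLike.congr_fun h0 P
  obtain ⟨r₁, s₁, h₁⟩ := hα.exists_of_ne_zero hα0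
  obtain ⟨r₂, s₂, h₂⟩ := hβ.exists_of_ne_zero h0
  right
  -- With `pt x` a point above `x`, the candidates for the two rational functions of `w` are
  -- `x(w(pt x))` and `t(w(pt x)) / t(pt x)`; they do not depend on the choice of `pt x`.
  choose pt hpt0 hpt using exists_point_of_xc (E := E)
  have hker : ∀ᶠ P in cofinite, w P ≠ 0 := by
    rw [eventually_cofinite]
    refine (h₂.finite_ker.image α).subset fun Q hQ => ?_
    obtain ⟨P, rfl⟩ := hsurj Q
    exact ⟨P, by simpa using hQ, rfl⟩
  have hpm : ∀ P, P ≠ 0 → pt (xc E P) = P ∨ pt (xc E P) = -P := fun P hP =>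
    eq_or_eq_neg_of_xc_eq (hpt0 _) hP (hpt _)
  have hr : ∀ P, P ≠ 0 → xc E (w (pt (xc E P))) = xc E (w P) := by
    intro P hP
    rcases hpm P hP with h | h
    · rw [h]
    · rw [h, show w (-P) = -w P from map_neg w P, xc_neg]
  have hs : ∀ P, P ≠ 0 → tc E P ≠ 0 →
      tc E (w (pt (xc E P))) / tc E (pt (xc E P)) * tc E P = tc E (w P) := by
    intro P hP ht
    rcases hpm P hP with h | h
    · rw [h]; field_simp
    · rw [h, show w (-P) = -w P from map_neg w P, tc_neg, tc_neg]; field_simp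
  refine ⟨fun x => xc E (w (pt x)), fun x => tc E (w (pt x)) / tc E (pt x), ?_, ?_, ?_⟩
  · refine isRat_of_comp h₁.isRat_fst h₁.not_const h₂.isRat_fst ?_
    rw [← eventually_xc_iff (E := E)]
    filter_upwards [h₁.eventually, h₂.eventually] with P a b
    rw [← a.2.1, ← b.2.1, hr _ a.1]
    rfl
  · refine isRat_of_comp h₁.isRat_fst h₁.not_const (h₂.isRat_snd.div h₁.isRat_snd) ?_
    rw [← eventually_xc_iff (E := E)]
    filter_upwards [h₁.eventually, h₂.eventually, eventually_tc_ne_zero,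
      tendsto_xc.eventually h₁.snd_ne_zero, h₁.tendsto.eventually eventually_tc_ne_zero]
      with P a b c d e
    have h3 := hs _ a.1 e
    have h4 : tc E (w (α P)) = s₂ (xc E P) * tc E P := b.2.2
    rw [h4, a.2.2, ← mul_assoc] at h3
    rw [← a.2.1, eq_div_iff d]
    exact mul_right_cancel₀ c h3
  · filter_upwards [hker, eventually_ne_zero, eventually_tc_ne_zero] with P a b c
    exact ⟨a, (hr P b).symm, (hs P b c).symm⟩

end Descent

/-! ### Morphisms are given by rational functions -/

section MorphismToRational

open Filter

variable {K : Type*} [Field K] [CharZero K] [IsAlgClosed K] [DecidableEq K]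
  {E : WeierstrassCurve K} [E.IsElliptic]

lemma homCoords_zero : homCoords E 0 = ![0, 1, 0] := rfl

lemma homCoords_of_ne_zero {P : E.toAffine.Point} (hP : P ≠ 0) :
    homCoords E P = ![xc E P, (tc E P - E.a₁ * xc E P - E.a₃) / 2, 1] := by
  rcases P with _ | ⟨x, y, h⟩
  · exact absurd rfl hP
  · simp only [homCoords, xc_some, tc_some]
    congr 2
    ring

/-- The cubic `cubicB` as a polynomial. -/
noncomputable def polyB (E : WeierstrassCurve K) : K[X] :=
  C 4 * X ^ 3 + C E.b₂ * X ^ 2 + C (2 * E.b₄) * X + C E.b₆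

lemma eval_polyB (x : K) : (polyB E).eval x = cubicB E x := by
  simp [polyB, cubicB]

lemma natDegree_polyB : (polyB E).natDegree = 3 := natDegree_cubic (by norm_num)

/-- On the affine curve every polynomial function has the form `p(x) + q(x) t`. -/
lemma exists_eval_homCoords (G : MvPolynomial (Fin 3) K) : ∃ p q : K[X],
    ∀ P : E.toAffine.Point, P ≠ 0 →
      MvPolynomial.eval (homCoords E P) G = p.eval (xc E P) + q.eval (xc E P) * tc E P := by
  induction G using MvPolynomial.induction_on with
  | C a => exact ⟨C a, 0, fun P hP => by simp⟩
  | add G H hG hH =>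
    obtain ⟨p, q, h⟩ := hG
    obtain ⟨p', q', h'⟩ := hH
    refine ⟨p + p', q + q', fun P hP => ?_⟩
    rw [map_add, h P hP, h' P hP, eval_add, eval_add]
    ring
  | mul_X G i hG =>
    obtain ⟨p, q, h⟩ := hG
    fin_cases i
    · refine ⟨p * X, q * X, fun P hP => ?_⟩
      rw [map_mul, h P hP, MvPolynomial.eval_X, homCoords_of_ne_zero hP]
      simp
      ring
    · refine ⟨C 2⁻¹ * (q * polyB E - (C E.a₁ * X + C E.a₃) * p),
        C 2⁻¹ * (p - (C E.a₁ * X + C E.a₃) * q), fun P hP => ?_⟩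
      rw [map_mul, h P hP, MvPolynomial.eval_X, homCoords_of_ne_zero hP]
      simp only [eval_mul, eval_sub, eval_add, eval_C, eval_X, eval_polyB, ← tc_sq hP]
      simp
      ring
    · refine ⟨p, q, fun P hP => ?_⟩
      rw [map_mul, h P hP, MvPolynomial.eval_X, homCoords_of_ne_zero hP]
      simp

/-- A function `p(x) + q(x) t` with `p`, `q` not both zero has finitely many zeros: its norm
`p² - q² B` is a non-zero polynomial, as `B` has odd degree. -/
lemma eventually_add_mul_tc_ne_zero {p q : K[X]} (h : ¬ (p = 0 ∧ q = 0)) :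
    ∀ᶠ P : E.toAffine.Point in cofinite, p.eval (xc E P) + q.eval (xc E P) * tc E P ≠ 0 := by
  have hB : polyB E ≠ 0 := fun h0 => by
    have := natDegree_polyB (E := E)
    rw [h0, natDegree_zero] at this
    omega
  have hN : p ^ 2 - q ^ 2 * polyB E ≠ 0 := by
    intro h0
    rw [sub_eq_zero] at h0
    by_cases hq : q = 0
    · exact h ⟨by simpa [hq] using h0, hq⟩
    · have := congrArg natDegree h0
      rw [natDegree_pow, natDegree_mul (pow_ne_zero _ hq) hB, natDegree_pow, natDegree_polyB] at this
      omega
  filter_upwards [tendsto_xc.eventually (eventually_eval_ne_zero hN), eventually_ne_zero]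
    with P h1 h2 h3
  apply h1
  simp only [eval_sub, eval_pow, eval_mul, eval_polyB, ← tc_sq h2]
  linear_combination (p.eval (xc E P) - q.eval (xc E P) * tc E P) * h3

/-- A polynomial that vanishes at almost all points of the curve vanishes at all affine points. -/
lemma eval_homCoords_eq_zero_of_eventually {G : MvPolynomial (Fin 3) K}
    (h : ∀ᶠ P in cofinite, MvPolynomial.eval (homCoords E P) G = 0) {P : E.toAffine.Point}
    (hP : P ≠ 0) : MvPolynomial.eval (homCoords E P) G = 0 := by
  obtain ⟨p, q, hpq⟩ := exists_eval_homCoords (E := E) G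
  have h0 : p = 0 ∧ q = 0 := by
    by_contra hn
    obtain ⟨Q, h1, h2, h3⟩ :=
      (h.and (eventually_ne_zero.and (eventually_add_mul_tc_ne_zero hn))).exists
    rw [hpq Q h2] at h1
    exact h3 h1
  rw [hpq P hP, h0.1, h0.2]
  simp

lemma eventually_eval_homCoords_ne_zero {G : MvPolynomial (Fin 3) K} {P : E.toAffine.Point}
    (hP : P ≠ 0) (h : MvPolynomial.eval (homCoords E P) G ≠ 0) :
    ∀ᶠ P in cofinite, MvPolynomial.eval (homCoords E P) G ≠ 0 := by
  obtain ⟨p, q, hpq⟩ := exists_eval_homCoords (E := E) G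
  have h0 : ¬ (p = 0 ∧ q = 0) := by
    rintro ⟨rfl, rfl⟩
    exact h (by rw [hpq P hP]; simp)
  filter_upwards [eventually_add_mul_tc_ne_zero h0, eventually_ne_zero] with Q h1 h2
  rwa [hpq Q h2]

/-- An endomorphism is given by rational functions: the homogeneous coordinates that describe it
near an affine point are brought to the form `(r(x), s(x) t)` by using that it is odd. -/
theorem ratHom_of_isEndomorphism {φ : AddMonoid.End E.toAffine.Point} (h : IsEndomorphism E φ) :
    RatHom φ := by
  by_cases hφ : φ = 0
  · exact .inl hφ
  obtain ⟨P₀, hP₀⟩ := exists_ne (0 : E.toAffine.Point)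
  obtain ⟨d, F, -, ⟨j, hj⟩, hF⟩ := h P₀
  have hev := eventually_eval_homCoords_ne_zero hP₀ hj
  obtain ⟨p₀, q₀, h₀⟩ := exists_eval_homCoords (E := E) (F 0)
  obtain ⟨p₁, q₁, h₁⟩ := exists_eval_homCoords (E := E) (F 1)
  obtain ⟨p₂, q₂, h₂⟩ := exists_eval_homCoords (E := E) (F 2)
  -- Otherwise `φ` maps almost every point to the point at infinity.
  have hne : ¬ (p₂ = 0 ∧ q₂ = 0) := by
    rintro ⟨rfl, rfl⟩
    apply hφ
    refine hom_ext_of_eventually ?_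
    filter_upwards [hev, eventually_ne_zero] with Q a b
    obtain ⟨c, hc, H⟩ := hF Q ⟨j, a⟩
    by_contra hQ
    have := H 2
    rw [h₂ Q b, homCoords_of_ne_zero hQ] at this
    simp at this
    exact hc this.symm
  have hneg : Tendsto (fun P : E.toAffine.Point => -P) cofinite cofinite :=
    neg_injective.tendsto_cofinite
  have key : ∀ᶠ Q : E.toAffine.Point in cofinite, φ Q ≠ 0 ∧
      (p₂.eval (xc E Q) + q₂.eval (xc E Q) * tc E Q ≠ 0) ∧
      (p₂.eval (xc E Q) + q₂.eval (xc E Q) * tc E Q) * xc E (φ Q) =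
        p₀.eval (xc E Q) + q₀.eval (xc E Q) * tc E Q ∧
      (p₂.eval (xc E Q) + q₂.eval (xc E Q) * tc E Q) * tc E (φ Q) =
        (C 2 * p₁ + (C E.a₁ * p₀ + C E.a₃ * p₂)).eval (xc E Q) +
        (C 2 * q₁ + (C E.a₁ * q₀ + C E.a₃ * q₂)).eval (xc E Q) * tc E Q := by
    filter_upwards [eventually_add_mul_tc_ne_zero hne, eventually_ne_zero] with Q a b
    obtain ⟨c, hc, H⟩ := hF Q ⟨2, by rwa [h₂ Q b]⟩
    have H0 := H 0
    have H1 := H 1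
    have H2 := H 2
    have hQ : φ Q ≠ 0 := by
      intro h0
      rw [h₂ Q b, h0, homCoords_zero] at H2
      simp at H2
      exact a H2
    rw [h₀ Q b, homCoords_of_ne_zero hQ] at H0
    rw [h₁ Q b, homCoords_of_ne_zero hQ] at H1
    rw [h₂ Q b, homCoords_of_ne_zero hQ] at H2
    simp only [Fin.isValue, Matrix.cons_val_zero, Matrix.cons_val_one, Matrix.cons_val, mul_one]
      at H0 H1 H2
    refine ⟨hQ, a, ?_, ?_⟩
    · rw [H0, H2]
    · simp only [eval_add, eval_mul, eval_C]
      linear_combination (tc E (φ Q) - E.a₃) * H2 - 2 * H1 - E.a₁ * H0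
  generalize C 2 * p₁ + (C E.a₁ * p₀ + C E.a₃ * p₂) = p₃ at key
  generalize C 2 * q₁ + (C E.a₁ * q₀ + C E.a₃ * q₂) = q₃ at key
  -- Divide by `p₂ + q₂ t`, clear the denominator with `p₂ - q₂ t`, and average the relations at
  -- `Q` and `-Q`.
  have hN := isRat_poly (p₂ ^ 2 - q₂ ^ 2 * polyB E)
  right
  refine ⟨_, _, (isRat_poly (p₀ * p₂ - q₀ * q₂ * polyB E)).div hN,
    (isRat_poly (q₃ * p₂ - p₃ * q₂)).div hN, ?_⟩
  filter_upwards [key, hneg.eventually key, eventually_ne_zero] with Q a b h0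
  have e : φ (-Q) = -φ Q := map_neg φ Q
  rw [e] at b
  simp only [xc_neg, tc_neg] at b
  obtain ⟨-, b2, b3, b4⟩ := b
  obtain ⟨a1, a2, a3, a4⟩ := a
  have hNe : (p₂ ^ 2 - q₂ ^ 2 * polyB E).eval (xc E Q) ≠ 0 := by
    simp only [eval_sub, eval_pow, eval_mul, eval_polyB, ← tc_sq h0]
    intro h1
    apply mul_ne_zero a2 b2
    linear_combination h1
  refine ⟨a1, ?_, ?_⟩
  · rw [eq_div_iff hNe]
    simp only [eval_sub, eval_pow, eval_mul, eval_polyB, ← tc_sq h0]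
    linear_combination (p₂.eval (xc E Q) - q₂.eval (xc E Q) * tc E Q) / 2 * a3 +
      (p₂.eval (xc E Q) + q₂.eval (xc E Q) * tc E Q) / 2 * b3
  · rw [div_mul_eq_mul_div, eq_div_iff hNe]
    simp only [eval_sub, eval_pow, eval_mul, eval_polyB, ← tc_sq h0]
    linear_combination (p₂.eval (xc E Q) - q₂.eval (xc E Q) * tc E Q) / 2 * a4 -
      (p₂.eval (xc E Q) + q₂.eval (xc E Q) * tc E Q) / 2 * b4

end MorphismToRational

/-! ### Rational homomorphisms are morphisms -/

section LocalMorphisms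

open Filter

lemma eval_smul_of_isHomogeneous {R σ : Type*} [CommSemiring R] {F : MvPolynomial σ R} {d : ℕ}
    (hF : F.IsHomogeneous d) (c : R) (x : σ → R) :
    MvPolynomial.eval (fun i => c * x i) F = c ^ d * MvPolynomial.eval x F := by
  rw [MvPolynomial.eval_eq, MvPolynomial.eval_eq, Finset.mul_sum]
  refine Finset.sum_congr rfl fun m hm => ?_
  have h1 : m.degree = d := by
    rw [Finsupp.degree_eq_weight_one]
    exact hF (MvPolynomial.mem_support_iff.1 hm)
  have h2 : ∏ i ∈ m.support, c ^ m i = c ^ d := by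
    rw [Finset.prod_pow_eq_pow_sum, ← h1]
    rfl
  simp_rw [mul_pow]
  rw [Finset.prod_mul_distrib, h2]
  ring

variable {K : Type*} [Field K] {E : WeierstrassCurve K}

/-- Near `P` the map `φ` is given by homogeneous polynomials of the same degree. -/
def IsMorphismAt (φ : E.toAffine.Point → E.toAffine.Point) (P : E.toAffine.Point) : Prop :=
  ∃ (d : ℕ) (F : Fin 3 → MvPolynomial (Fin 3) K),
    (∀ j, (F j).IsHomogeneous d) ∧
    (∃ j, MvPolynomial.eval (homCoords E P) (F j) ≠ 0) ∧
    ∀ Q : E.toAffine.Point, (∃ j, MvPolynomial.eval (homCoords E Q) (F j) ≠ 0) →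
      ∃ c : K, c ≠ 0 ∧ ∀ j, MvPolynomial.eval (homCoords E Q) (F j) = c * homCoords E (φ Q) j

lemma IsMorphismAt.comp {φ ψ : E.toAffine.Point → E.toAffine.Point} {P : E.toAffine.Point}
    (hψ : IsMorphismAt ψ (φ P)) (hφ : IsMorphismAt φ P) : IsMorphismAt (fun Q => ψ (φ Q)) P := by
  obtain ⟨d, F, hF, ⟨k, hk⟩, H⟩ := hφ
  obtain ⟨e, G, hG, ⟨l, hl⟩, H'⟩ := hψ
  -- The factor `F k` makes the composite forms vanish where `F` does not describe `φ`.
  have hev : ∀ Q j, MvPolynomial.eval (homCoords E Q) (MvPolynomial.aeval F (G j) * F k) =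
      MvPolynomial.eval (fun i => MvPolynomial.eval (homCoords E Q) (F i)) (G j) *
        MvPolynomial.eval (homCoords E Q) (F k) := by
    intro Q j
    rw [map_mul]
    congr 1
    rw [MvPolynomial.aeval_eq_bind₁]
    exact MvPolynomial.eval₂Hom_bind₁ (RingHom.id K) (homCoords E Q) F (G j)
  have hval : ∀ Q, MvPolynomial.eval (homCoords E Q) (F k) ≠ 0 → ∃ c : K, c ≠ 0 ∧ ∀ j,
      MvPolynomial.eval (homCoords E Q) (MvPolynomial.aeval F (G j) * F k) =
        c * MvPolynomial.eval (homCoords E (φ Q)) (G j) := by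
    intro Q hQ
    obtain ⟨c, hc, h⟩ := H Q ⟨k, hQ⟩
    refine ⟨c ^ e * MvPolynomial.eval (homCoords E Q) (F k),
      mul_ne_zero (pow_ne_zero _ hc) hQ, fun j => ?_⟩
    rw [hev, show (fun i => MvPolynomial.eval (homCoords E Q) (F i)) =
      fun i => c * homCoords E (φ Q) i from funext h, eval_smul_of_isHomogeneous (hG j)]
    ring
  refine ⟨d * e + d, fun j => MvPolynomial.aeval F (G j) * F k,
    fun j => ((hG j).aeval F hF).mul (hF k), ⟨l, ?_⟩, fun Q hQ => ?_⟩
  · obtain ⟨c, hc, h⟩ := hval P hk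
    rw [h]
    exact mul_ne_zero hc hl
  · obtain ⟨j, hj⟩ := hQ
    have hk' : MvPolynomial.eval (homCoords E Q) (F k) ≠ 0 := by
      intro h0
      rw [map_mul, h0, mul_zero] at hj
      exact hj rfl
    obtain ⟨c, hc, h⟩ := hval Q hk'
    rw [h] at hj
    obtain ⟨c', hc', h'⟩ := H' (φ Q) ⟨j, right_ne_zero_of_mul hj⟩
    exact ⟨c * c', mul_ne_zero hc hc', fun i => by rw [h, h', mul_assoc]⟩

/-- A line through `Q` that misses `P`. -/
lemma exists_linear_form {P Q : E.toAffine.Point} (hPQ : P ≠ Q) :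
    ∃ L : MvPolynomial (Fin 3) K, L.IsHomogeneous 1 ∧
      MvPolynomial.eval (homCoords E Q) L = 0 ∧ MvPolynomial.eval (homCoords E P) L ≠ 0 := by
  have hlin : ∀ i (c : K), (MvPolynomial.X i - MvPolynomial.C c * MvPolynomial.X 2 :
      MvPolynomial (Fin 3) K).IsHomogeneous 1 := fun i c =>
    (MvPolynomial.isHomogeneous_X _ _).sub (by
      simpa using (MvPolynomial.isHomogeneous_C (Fin 3) c).mul (MvPolynomial.isHomogeneous_X K 2))
  rcases Q with _ | ⟨x, y, h⟩
  · rcases P with _ | ⟨x', y', h'⟩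
    · exact absurd rfl hPQ
    · exact ⟨MvPolynomial.X 2, MvPolynomial.isHomogeneous_X _ _, by simp [homCoords],
        by simp [homCoords]⟩
  · rcases P with _ | ⟨x', y', h'⟩
    · exact ⟨_, hlin 1 y, by simp [homCoords], by simp [homCoords]⟩
    · by_cases hx : x' = x
      · refine ⟨_, hlin 1 y, by simp [homCoords], ?_⟩
        simp only [homCoords, map_sub, map_mul, MvPolynomial.eval_X, MvPolynomial.eval_C]
        simp only [Fin.isValue, Matrix.cons_val_one, Matrix.cons_val_zero, Matrix.cons_val, mul_one]
        intro h0
        rw [sub_eq_zero] at h0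
        subst hx h0
        exact hPQ rfl
      · refine ⟨_, hlin 0 x, by simp [homCoords], ?_⟩
        simpa [homCoords, sub_eq_zero] using hx

/-- It suffices to have the description of `φ` at `P` and at almost all points: linear forms
remove the exceptions. -/
lemma isMorphismAt_of_eventually {φ : E.toAffine.Point → E.toAffine.Point} {P : E.toAffine.Point}
    {d : ℕ} {F : Fin 3 → MvPolynomial (Fin 3) K} (hF : ∀ j, (F j).IsHomogeneous d)
    (hP : ∃ j, MvPolynomial.eval (homCoords E P) (F j) ≠ 0)
    (hP' : ∃ c : K, c ≠ 0 ∧ ∀ j, MvPolynomial.eval (homCoords E P) (F j) = c * homCoords E (φ P) j)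
    (H : ∀ᶠ Q in cofinite, ∃ c : K, c ≠ 0 ∧
      ∀ j, MvPolynomial.eval (homCoords E Q) (F j) = c * homCoords E (φ Q) j) :
    IsMorphismAt φ P := by
  classical
  rw [eventually_cofinite] at H
  have hL : ∀ Q : E.toAffine.Point, ∃ L : MvPolynomial (Fin 3) K, L.IsHomogeneous 1 ∧
      (Q ≠ P → MvPolynomial.eval (homCoords E Q) L = 0) ∧
      MvPolynomial.eval (homCoords E P) L ≠ 0 := by
    intro Q
    by_cases hQ : Q = P
    · have hO : ∃ i : Fin 3, homCoords E P i ≠ 0 := by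
        rcases P with _ | ⟨x, y, h⟩
        · exact ⟨1, by simp [homCoords]⟩
        · exact ⟨2, by simp [homCoords]⟩
      obtain ⟨i, hi⟩ := hO
      exact ⟨MvPolynomial.X i, MvPolynomial.isHomogeneous_X _ _, fun h => absurd hQ h, by simpa⟩
    · obtain ⟨L, h1, h2, h3⟩ := exists_linear_form (Ne.symm hQ)
      exact ⟨L, h1, fun _ => h2, h3⟩
  choose L hL1 hL2 hL3 using hL
  let M := ∏ Q ∈ H.toFinset, L Q
  have hM : M.IsHomogeneous (∑ Q ∈ H.toFinset, 1) :=
    MvPolynomial.IsHomogeneous.prod _ _ _ fun Q _ => hL1 Q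
  refine ⟨d + ∑ Q ∈ H.toFinset, 1, fun j => F j * M, fun j => (hF j).mul hM, ?_, fun Q hQ => ?_⟩
  · obtain ⟨j, hj⟩ := hP
    refine ⟨j, ?_⟩
    rw [map_mul, map_prod]
    exact mul_ne_zero hj (Finset.prod_ne_zero_iff.2 fun Q _ => hL3 Q)
  · obtain ⟨j, hj⟩ := hQ
    rw [map_mul] at hj
    have hMQ := right_ne_zero_of_mul hj
    obtain ⟨c, hc, h⟩ : ∃ c : K, c ≠ 0 ∧
        ∀ j, MvPolynomial.eval (homCoords E Q) (F j) = c * homCoords E (φ Q) j := by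
      by_cases hQP : Q = P
      · rw [hQP]; exact hP'
      by_contra hbad
      apply hMQ
      rw [map_prod]
      exact Finset.prod_eq_zero (i := Q) (H.mem_toFinset.2 hbad) (hL2 Q hQP)
    exact ⟨c * MvPolynomial.eval (homCoords E Q) M, mul_ne_zero hc hMQ, fun i => by
      rw [map_mul, h]; ring⟩

variable [CharZero K] [DecidableEq K]

/-- Translation by an affine point `S` is given by three quadratic forms at all points except `S`
itself. They are `c x₃`, `c t₃` and `c = 4 (x - x(S))³`, where `(x₃, t₃)` is given by the chord law
and `4 x³` is replaced by `t² - b₂ x² - 2 b₄ x - b₆`. -/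
lemma isMorphismAt_add_right [IsAlgClosed K] [E.IsElliptic] {S P : E.toAffine.Point} (hS : S ≠ 0)
    (hP : P ≠ S) : IsMorphismAt (fun Q => Q + S) P := by
  let e := xc E S
  let f := tc E S
  have he : f ^ 2 = cubicB E e := tc_sq hS
  let X0 : MvPolynomial (Fin 3) K := MvPolynomial.X 0
  let Z : MvPolynomial (Fin 3) K := MvPolynomial.X 2
  let k : K → MvPolynomial (Fin 3) K := MvPolynomial.C
  let T : MvPolynomial (Fin 3) K := k 2 * MvPolynomial.X 1 + (k E.a₁ * X0 + k E.a₃ * Z)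
  -- Coefficients of the linear part of the numerator of `x₃`
  let m : K := 4 * e ^ 2 + 2 * E.b₂ * e + 2 * E.b₄
  let n : K := 2 * E.b₄ * e + 2 * E.b₆
  let qf : K → K → K → K → K → K → MvPolynomial (Fin 3) K := fun a b c d g h =>
    k a * (T * T) + k b * (T * X0) + k c * (T * Z) + k d * (X0 * X0) + k g * (X0 * Z) +
      k h * (Z * Z)
  let A := qf e (-2 * f) (2 * e * f) (-e * E.b₂ + m - 4 * e ^ 2) (-2 * e * E.b₄ + n - e * m)
    (-e * E.b₆ - e * n)
  let D := qf f (-(m + 8 * e ^ 2)) (-(n - 4 * e ^ 3 + 2 * f ^ 2)) (12 * e * f + E.b₂ * f)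
    (f * (2 * E.b₂ * e + 4 * E.b₄)) (f * (2 * E.b₄ * e + 3 * E.b₆))
  let Cc := qf 1 0 0 (-E.b₂ - 12 * e) (-2 * E.b₄ + 12 * e ^ 2) (-E.b₆ - 4 * e ^ 3)
  have hX0 : X0.IsHomogeneous 1 := MvPolynomial.isHomogeneous_X _ _
  have hZ : Z.IsHomogeneous 1 := MvPolynomial.isHomogeneous_X _ _
  have hk : ∀ {G : MvPolynomial (Fin 3) K} {d : ℕ} (c : K), G.IsHomogeneous d →
      (k c * G).IsHomogeneous d := fun c hG => by
    simpa using (MvPolynomial.isHomogeneous_C (Fin 3) c).mul hG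
  have hT : T.IsHomogeneous 1 :=
    (hk _ (MvPolynomial.isHomogeneous_X _ _)).add ((hk _ hX0).add (hk _ hZ))
  have hqf : ∀ a b c d g h, (qf a b c d g h).IsHomogeneous 2 := fun a b c d g h =>
    (((((hk _ (hT.mul hT)).add (hk _ (hT.mul hX0))).add (hk _ (hT.mul hZ))).add
      (hk _ (hX0.mul hX0))).add (hk _ (hX0.mul hZ))).add (hk _ (hZ.mul hZ))
  let F : Fin 3 → MvPolynomial (Fin 3) K :=
    ![A, k 2⁻¹ * (D - (k E.a₁ * A + k E.a₃ * Cc)), Cc]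
  have hF : ∀ j, (F j).IsHomogeneous 2 := by
    intro j
    fin_cases j
    · exact hqf ..
    · exact hk _ ((hqf ..).sub ((hk _ (hqf ..)).add (hk _ (hqf ..))))
    · exact hqf ..
  have hqO : ∀ a b c d g h, MvPolynomial.eval (homCoords E 0) (qf a b c d g h) = 4 * a := by
    intro a b c d g h
    simp only [qf, T, X0, Z, k, homCoords_zero, map_add, map_mul, MvPolynomial.eval_C,
      MvPolynomial.eval_X]
    simp
    ring
  have hqQ : ∀ Q : E.toAffine.Point, Q ≠ 0 → ∀ a b c d g h,
      MvPolynomial.eval (homCoords E Q) (qf a b c d g h) =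
        a * tc E Q ^ 2 + b * tc E Q * xc E Q + c * tc E Q + d * xc E Q ^ 2 + g * xc E Q + h := by
    intro Q hQ a b c d g h
    simp only [qf, T, X0, Z, k, homCoords_of_ne_zero hQ, map_add, map_mul, MvPolynomial.eval_C,
      MvPolynomial.eval_X]
    simp
    ring
  have hF1 : ∀ Q : E.toAffine.Point, MvPolynomial.eval (homCoords E Q) (F 1) =
      2⁻¹ * (MvPolynomial.eval (homCoords E Q) D - (E.a₁ * MvPolynomial.eval (homCoords E Q) A +
        E.a₃ * MvPolynomial.eval (homCoords E Q) Cc)) := by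
    intro Q
    simp [F, k]
  have hF0 : ∀ Q : E.toAffine.Point, MvPolynomial.eval (homCoords E Q) (F 0) =
      MvPolynomial.eval (homCoords E Q) A := fun Q => rfl
  have hF2 : ∀ Q : E.toAffine.Point, MvPolynomial.eval (homCoords E Q) (F 2) =
      MvPolynomial.eval (homCoords E Q) Cc := fun Q => rfl
  -- The values of the forms at an affine point
  have hC : ∀ Q : E.toAffine.Point, Q ≠ 0 → MvPolynomial.eval (homCoords E Q) Cc =
      4 * (xc E Q - e) ^ 3 := by
    intro Q hQ
    have := tc_sq hQ
    simp only [cubicB] at this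
    rw [hqQ Q hQ]
    linear_combination this
  have hA : ∀ Q : E.toAffine.Point, Q ≠ 0 → MvPolynomial.eval (homCoords E Q) A =
      (xc E Q - e) * ((tc E Q - f) ^ 2 - (E.b₂ + 4 * xc E Q + 4 * e) * (xc E Q - e) ^ 2) := by
    intro Q hQ
    have h1 := tc_sq hQ
    simp only [cubicB] at h1 he
    rw [hqQ Q hQ]
    simp only [m, n]
    linear_combination (2 * e - xc E Q) * h1 + (e - xc E Q) * he
  have hD : ∀ Q : E.toAffine.Point, Q ≠ 0 → MvPolynomial.eval (homCoords E Q) D =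
      -(4 * (xc E Q - e) ^ 3 * tc E Q + (tc E Q - f) *
        ((tc E Q - f) ^ 2 - (E.b₂ + 8 * xc E Q + 4 * e) * (xc E Q - e) ^ 2)) := by
    intro Q hQ
    have h1 := tc_sq hQ
    simp only [cubicB] at h1 he
    rw [hqQ Q hQ]
    simp only [m, n]
    linear_combination (tc E Q - 2 * f) * h1 + (tc E Q - f) * he
  have hgood : ∀ Q : E.toAffine.Point, Q ≠ S → ∃ c : K, c ≠ 0 ∧
      ∀ j, MvPolynomial.eval (homCoords E Q) (F j) = c * homCoords E (Q + S) j := by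
    intro Q hQS
    by_cases hQ : Q = 0
    · subst hQ
      refine ⟨4, by norm_num, fun j => ?_⟩
      rw [zero_add, homCoords_of_ne_zero hS]
      fin_cases j
      · exact hqO ..
      · refine (hF1 0).trans ?_
        rw [hqO, hqO, hqO]
        simp [e, f]
        ring
      · refine (hqO ..).trans ?_
        simp
    -- Here `Q = -S`, and the forms give the point at infinity.
    by_cases hx : xc E Q = e
    · have hQ' : Q = -S := (eq_or_eq_neg_of_xc_eq hQ hS hx).resolve_left hQS
      have ht : tc E Q = -f := by rw [hQ', tc_neg]
      have hf : f ≠ 0 := by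
        intro h0
        exact hQS (point_ext hQ hS hx (by rw [ht, h0, neg_zero]; exact h0.symm))
      have h0 : Q + S = 0 := by rw [hQ', neg_add_cancel]
      have e0 := hA Q hQ
      have e2 := hC Q hQ
      have e1 := hD Q hQ
      rw [hx, ht, sub_self] at e0 e1
      rw [hx, sub_self] at e2
      refine ⟨4 * f ^ 3, mul_ne_zero (by norm_num) (pow_ne_zero _ hf), fun j => ?_⟩
      rw [h0, homCoords_zero]
      fin_cases j
      · refine e0.trans ?_
        simp
      · refine (hF1 Q).trans ?_
        rw [e0, e1, e2]
        simp
        ring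
      · refine e2.trans ?_
        simp
    · have hd : xc E Q - e ≠ 0 := sub_ne_zero.2 hx
      have hd' : e - xc E Q ≠ 0 := sub_ne_zero.2 (Ne.symm hx)
      obtain ⟨k1, k2⟩ := chord_law hQ hS hx
      rw [k1] at k2
      have hQS' : Q + S ≠ 0 := add_ne_zero_of_xc_ne hx
      have e0 : MvPolynomial.eval (homCoords E Q) A =
          4 * (xc E Q - e) ^ 3 * xc E (Q + S) := by
        rw [hA Q hQ, k1]
        simp only [← show e = xc E S from rfl, ← show f = tc E S from rfl]
        field_simp
        ring
      have e1 : MvPolynomial.eval (homCoords E Q) D =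
          4 * (xc E Q - e) ^ 3 * tc E (Q + S) := by
        rw [hD Q hQ, k2]
        simp only [← show e = xc E S from rfl, ← show f = tc E S from rfl]
        field_simp
        ring
      have e2 := hC Q hQ
      refine ⟨4 * (xc E Q - e) ^ 3, mul_ne_zero (by norm_num) (pow_ne_zero _ hd), fun j => ?_⟩
      rw [homCoords_of_ne_zero hQS']
      fin_cases j
      · exact e0
      · refine (hF1 Q).trans ?_
        rw [e0, e1, e2]
        simp
        ring
      · refine e2.trans ?_
        simp
  have hne : ∀ Q : E.toAffine.Point, ∃ j, homCoords E Q j ≠ 0 := by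
    rintro (_ | ⟨x, y, h⟩)
    · exact ⟨1, by simp [homCoords]⟩
    · exact ⟨2, by simp [homCoords]⟩
  refine isMorphismAt_of_eventually hF ?_ (hgood P hP) ?_
  · obtain ⟨c, hc, h⟩ := hgood P hP
    obtain ⟨j, hj⟩ := hne (P + S)
    exact ⟨j, by rw [h]; exact mul_ne_zero hc hj⟩
  · have : ∀ᶠ Q in cofinite, Q ≠ S := by rw [eventually_cofinite]; simp
    exact this.mono hgood

end LocalMorphisms

/-! ### Endomorphisms, automorphisms and kernels -/

section RationalToMorphism

open Filter

variable {K : Type*} [Field K]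

/-- The homogeneous polynomial of degree `N` in the variables `0` and `2` that dehomogenizes
to `p`. -/
noncomputable def homogXZ (N : ℕ) (p : K[X]) : MvPolynomial (Fin 3) K :=
  MvPolynomial.rename ![0, 2] (p.homogenize N)

lemma isHomogeneous_homogXZ (N : ℕ) (p : K[X]) : (homogXZ N p).IsHomogeneous N :=
  MvPolynomial.IsHomogeneous.rename_isHomogeneous (isHomogeneous_homogenize p)

lemma eval_homogXZ {N : ℕ} {p : K[X]} (hN : p.natDegree ≤ N) {x : Fin 3 → K} (hx : x 2 = 1) :
    MvPolynomial.eval x (homogXZ N p) = p.eval (x 0) := by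
  rw [homogXZ, MvPolynomial.eval_rename]
  exact eval₂_homogenize_of_eq_one hN (RingHom.id K) (x ∘ ![0, 2]) hx

variable [CharZero K] [IsAlgClosed K] [DecidableEq K] {E : WeierstrassCurve K} [E.IsElliptic]
  {α β : AddMonoid.End E.toAffine.Point} {r s : K → K}

/-- Rational functions describe a morphism near almost every point. -/
lemma RatWith.eventually_isMorphismAt (h : RatWith α r s) :
    ∀ᶠ P in cofinite, IsMorphismAt α P := by
  obtain ⟨u, v, hv, hr⟩ := h.isRat_fst
  obtain ⟨w, z, hz, hs⟩ := h.isRat_snd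
  obtain ⟨N, h0, h1, h2⟩ : ∃ N, (u * z).natDegree ≤ N ∧ (w * v).natDegree ≤ N ∧
      (v * z).natDegree ≤ N :=
    ⟨(u * z).natDegree + (w * v).natDegree + (v * z).natDegree, by omega, by omega, by omega⟩
  let X0 : MvPolynomial (Fin 3) K := MvPolynomial.X 0
  let Z : MvPolynomial (Fin 3) K := MvPolynomial.X 2
  let k : K → MvPolynomial (Fin 3) K := MvPolynomial.C
  let T : MvPolynomial (Fin 3) K := k 2 * MvPolynomial.X 1 + (k E.a₁ * X0 + k E.a₃ * Z)
  let A := Z * homogXZ N (u * z)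
  let D := T * homogXZ N (w * v)
  let Cc := Z * homogXZ N (v * z)
  let F : Fin 3 → MvPolynomial (Fin 3) K :=
    ![A, k 2⁻¹ * (D - (k E.a₁ * A + k E.a₃ * Cc)), Cc]
  have hX0 : X0.IsHomogeneous 1 := MvPolynomial.isHomogeneous_X _ _
  have hZ : Z.IsHomogeneous 1 := MvPolynomial.isHomogeneous_X _ _
  have hk : ∀ {G : MvPolynomial (Fin 3) K} {d : ℕ} (c : K), G.IsHomogeneous d →
      (k c * G).IsHomogeneous d := fun c hG => by
    simpa using (MvPolynomial.isHomogeneous_C (Fin 3) c).mul hG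
  have hT : T.IsHomogeneous 1 :=
    (hk _ (MvPolynomial.isHomogeneous_X _ _)).add ((hk _ hX0).add (hk _ hZ))
  have hA : A.IsHomogeneous (1 + N) := hZ.mul (isHomogeneous_homogXZ N _)
  have hD : D.IsHomogeneous (1 + N) := hT.mul (isHomogeneous_homogXZ N _)
  have hC : Cc.IsHomogeneous (1 + N) := hZ.mul (isHomogeneous_homogXZ N _)
  have hF : ∀ j, (F j).IsHomogeneous (1 + N) := by
    intro j
    fin_cases j
    · exact hA
    · exact hk _ (hD.sub ((hk _ hA).add (hk _ hC)))
    · exact hC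
  have hgood : ∀ᶠ Q in cofinite, (∃ c : K, c ≠ 0 ∧
      ∀ j, MvPolynomial.eval (homCoords E Q) (F j) = c * homCoords E (α Q) j) ∧
      MvPolynomial.eval (homCoords E Q) (F 2) ≠ 0 := by
    filter_upwards [h.eventually, eventually_ne_zero, tendsto_xc.eventually hr,
      tendsto_xc.eventually hs, tendsto_xc.eventually (eventually_eval_ne_zero hv),
      tendsto_xc.eventually (eventually_eval_ne_zero hz)] with Q a b c d e f
    have hQ2 : homCoords E Q 2 = 1 := by rw [homCoords_of_ne_zero b]; rfl
    have hQ0 : homCoords E Q 0 = xc E Q := by rw [homCoords_of_ne_zero b]; rfl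
    have eC : MvPolynomial.eval (homCoords E Q) Cc = v.eval (xc E Q) * z.eval (xc E Q) := by
      simp only [Cc, Z, map_mul, MvPolynomial.eval_X]
      rw [eval_homogXZ h2 hQ2, hQ2, hQ0, eval_mul, one_mul]
    have eA : MvPolynomial.eval (homCoords E Q) A =
        v.eval (xc E Q) * z.eval (xc E Q) * xc E (α Q) := by
      simp only [A, Z, map_mul, MvPolynomial.eval_X]
      rw [eval_homogXZ h0 hQ2, hQ2, hQ0, eval_mul, a.2.1, c]
      field_simp
    have eD : MvPolynomial.eval (homCoords E Q) D =
        v.eval (xc E Q) * z.eval (xc E Q) * tc E (α Q) := by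
      have eT : MvPolynomial.eval (homCoords E Q) T = tc E Q := by
        simp only [T, X0, Z, k, homCoords_of_ne_zero b, map_add, map_mul, MvPolynomial.eval_C,
          MvPolynomial.eval_X]
        simp
        ring
      simp only [D, map_mul]
      rw [eT, eval_homogXZ h1 hQ2, hQ0, eval_mul, a.2.2, d]
      field_simp
    refine ⟨⟨_, mul_ne_zero e f, fun j => ?_⟩, ?_⟩
    · rw [homCoords_of_ne_zero a.1]
      fin_cases j
      · exact eA
      · have : MvPolynomial.eval (homCoords E Q) (F 1) =
            2⁻¹ * (MvPolynomial.eval (homCoords E Q) D -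
              (E.a₁ * MvPolynomial.eval (homCoords E Q) A +
                E.a₃ * MvPolynomial.eval (homCoords E Q) Cc)) := by simp [F, k]
        refine this.trans ?_
        rw [eA, eD, eC]
        simp
        ring
      · refine eC.trans ?_
        simp
    · exact ne_of_eq_of_ne eC (mul_ne_zero e f)
  exact hgood.mono fun P hP =>
    isMorphismAt_of_eventually hF ⟨2, hP.2⟩ hP.1 (hgood.mono fun Q hQ => hQ.1)

/-- A homomorphism given by rational functions outside a finite set is a morphism everywhere:
near an arbitrary point `P` it is `Q ↦ α (Q + T) - α T` for a suitable point `T`. -/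
theorem RatHom.isEndomorphism (hα : RatHom α) : IsEndomorphism E α := by
  rcases hα with rfl | ⟨r, s, h⟩
  · refine fun P => ⟨0, ![0, 1, 0], ?_, ⟨1, by simp⟩, fun Q _ => ⟨1, one_ne_zero, ?_⟩⟩
    · intro j
      fin_cases j
      · exact MvPolynomial.isHomogeneous_zero _ _ _
      · exact MvPolynomial.isHomogeneous_one _ _
      · exact MvPolynomial.isHomogeneous_zero _ _ _
    · intro j
      rw [show (0 : AddMonoid.End E.toAffine.Point) Q = 0 from rfl, homCoords_zero]
      fin_cases j <;> simp
  intro P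
  have hadd : Tendsto (fun T => P + T) cofinite cofinite :=
    (add_right_injective P).tendsto_cofinite
  have hne : ∀ R : E.toAffine.Point, ∀ᶠ Q in cofinite, Q ≠ R := fun R => by
    rw [eventually_cofinite]; simp
  obtain ⟨T, h1, h2, h3, h4, h5⟩ := ((hne 0).and ((hne P).and
    ((hadd.eventually h.eventually_isMorphismAt).and ((h.eventually.mono fun P hP => hP.1).and
    ((h.comp ratWith_one_add_one).tendsto.eventually (hne (-α P))))))).exists
  have e : (α * (1 + 1)) T = α T + α T := map_add α T T
  rw [e] at h5
  have h6 : α (P + T) ≠ -α T := by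
    intro h0
    apply h5
    rw [show α (P + T) = α P + α T from map_add α P T] at h0
    rw [eq_neg_iff_add_eq_zero]
    rw [eq_neg_iff_add_eq_zero] at h0
    rw [← h0]
    abel
  have h7 : IsMorphismAt (fun Q => Q + -α T) (α (P + T)) :=
    isMorphismAt_add_right (neg_ne_zero.2 h4) h6
  have h8 : IsMorphismAt (fun Q => Q + T) P := isMorphismAt_add_right h1 (Ne.symm h2)
  have h9 := (h7.comp (φ := fun Q => α (Q + T)) (IsMorphismAt.comp (φ := fun Q => Q + T) (by
    rw [add_comm] at h3 ⊢; exact h3) h8))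
  have e2 : (fun Q => α (Q + T) + -α T) = α := by
    funext Q
    rw [show α (Q + T) = α Q + α T from map_add α Q T, add_neg_cancel_right]
  rw [e2] at h9
  exact h9

/-- An injective endomorphism is an automorphism: its inverse is rational by `RatHom.of_mul`. -/
lemma RatHom.isAutomorphism (hα : RatHom α) (hα0 : α ≠ 0) (hinj : ∀ P, α P = 0 → P = 0) :
    IsAutomorphism E α := by
  have hinj' : Function.Injective α := by
    intro P Q hPQ
    have : α (P - Q) = 0 := by
      rw [show α (P - Q) = α P - α Q from map_sub α P Q, hPQ, sub_self]
    exact sub_eq_zero.1 (hinj _ this)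
  let e : E.toAffine.Point ≃+ E.toAffine.Point :=
    AddEquiv.ofBijective (α : E.toAffine.Point →+ E.toAffine.Point) ⟨hinj', hα.surjective hα0⟩
  let χ : AddMonoid.End E.toAffine.Point := e.symm.toAddMonoidHom
  have h1 : χ * α = 1 := by
    ext P
    exact e.symm_apply_apply P
  have h2 : α * χ = 1 := by
    ext P
    exact e.apply_symm_apply P
  exact ⟨hα.isEndomorphism, χ,
    (RatHom.of_mul hα hα0 (h1 ▸ ratHom_one)).isEndomorphism, h2, h1⟩

lemma IsAutomorphism.eq_zero_of_apply {u : AddMonoid.End E.toAffine.Point}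
    (hu : IsAutomorphism E u) {P : E.toAffine.Point} (h : u P = 0) : P = 0 := by
  obtain ⟨-, χ, -, -, h1⟩ := hu
  have : (χ * u) P = χ (u P) := rfl
  rw [h1, h] at this
  exact this.trans (map_zero χ)

/-- Non-zero endomorphisms with the same kernel are associate: each is surjective and factors
through the other. -/
lemma areAssociate_of_ker_eq (hα : RatHom α) (hβ : RatHom β) (hα0 : α ≠ 0) (hβ0 : β ≠ 0)
    (h : ∀ P, α P = 0 ↔ β P = 0) : AreAssociate E α β := by
  have hs := hα.surjective hα0
  obtain ⟨u, hu⟩ : ∃ u : AddMonoid.End E.toAffine.Point, u * α = β := by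
    choose g hg using hs
    have key : ∀ P, β (g (α P)) = β P := by
      intro P
      have h1 : β (g (α P) - P) = 0 := by
        rw [← h, show α (g (α P) - P) = α (g (α P)) - α P from map_sub α _ _, hg, sub_self]
      rw [show β (g (α P) - P) = β (g (α P)) - β P from map_sub β _ _] at h1
      exact sub_eq_zero.1 h1
    refine ⟨AddMonoidHom.mk' (fun Q => β (g Q)) fun Q R => ?_, ?_⟩
    · obtain ⟨P, rfl⟩ := hα.surjective hα0 Q
      obtain ⟨P', rfl⟩ := hα.surjective hα0 R
      rw [← show α (P + P') = α P + α P' from map_add α _ _, key, key, key]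
      exact map_add β _ _
    · ext P
      exact key P
  have hu' : RatHom u := RatHom.of_mul hα hα0 (hu ▸ hβ)
  refine ⟨u, hu'.isAutomorphism ?_ ?_, hu.symm⟩
  · rintro rfl
    exact hβ0 (by rw [← hu, zero_mul])
  · intro Q hQ
    obtain ⟨P, rfl⟩ := hs Q
    have : β P = 0 := by rw [← hu]; exact hQ
    exact (h P).2 this

end RationalToMorphism

/-! ### Division polynomials vanish at torsion points -/

section DivisionPolynomials

variable {K : Type*} [Field K] [CharZero K] [DecidableEq K] {E : WeierstrassCurve K}

lemma chord_xc_add {A B : E.toAffine.Point} (hA : A ≠ 0) (hB : B ≠ 0) (h : xc E A ≠ xc E B) :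
    4 * (xc E B - xc E A) ^ 2 * xc E (A + B) =
      (tc E B - tc E A) ^ 2 - (E.b₂ + 4 * xc E A + 4 * xc E B) * (xc E B - xc E A) ^ 2 := by
  have hd : xc E B - xc E A ≠ 0 := sub_ne_zero.2 h.symm
  rw [(chord_law hA hB h).1]
  field_simp
  ring

lemma chord_xc_sub {A B : E.toAffine.Point} (hA : A ≠ 0) (hB : B ≠ 0) (h : xc E A ≠ xc E B) :
    4 * (xc E B - xc E A) ^ 2 * xc E (A - B) =
      (tc E B + tc E A) ^ 2 - (E.b₂ + 4 * xc E A + 4 * xc E B) * (xc E B - xc E A) ^ 2 := by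
  have := chord_xc_add hA (neg_ne_zero.2 hB) (by rwa [xc_neg])
  rw [xc_neg, tc_neg, ← sub_eq_add_neg] at this
  rw [this]
  ring

lemma xc_add_add_xc_sub {A B : E.toAffine.Point} (hA : A ≠ 0) (hB : B ≠ 0)
    (h : xc E A ≠ xc E B) :
    (xc E B - xc E A) ^ 2 * (xc E (A + B) + xc E (A - B)) =
      2 * xc E A * xc E B * (xc E A + xc E B) + E.b₂ * (xc E A * xc E B) +
        E.b₄ * (xc E A + xc E B) + E.b₆ := by
  have a1 := chord_xc_add hA hB h
  have a2 := chord_xc_sub hA hB h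
  have kA := tc_sq hA
  have kB := tc_sq hB
  rw [cubicB] at kA kB
  have h4 : (4 : K) ≠ 0 := by norm_num
  refine mul_left_cancel₀ h4 ?_
  linear_combination a1 + a2 + 2 * kA + 2 * kB

lemma xc_add_mul_xc_sub {A B : E.toAffine.Point} (hA : A ≠ 0) (hB : B ≠ 0)
    (h : xc E A ≠ xc E B) :
    (xc E B - xc E A) ^ 2 * (xc E (A + B) * xc E (A - B)) =
      xc E A ^ 2 * xc E B ^ 2 - E.b₄ * (xc E A * xc E B) - E.b₆ * (xc E A + xc E B) - E.b₈ := by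
  have a1 := chord_xc_add hA hB h
  have a2 := chord_xc_sub hA hB h
  have kA := tc_sq hA
  have kB := tc_sq hB
  have b8 := E.b_relation
  have hd : xc E B - xc E A ≠ 0 := sub_ne_zero.2 h.symm
  rw [cubicB] at kA kB
  have h4 : (16 : K) ≠ 0 := by norm_num
  refine mul_left_cancel₀ (mul_ne_zero h4 (pow_ne_zero 2 hd)) ?_
  -- The product of the two chord formulas is a polynomial in the squares of `t(A)` and `t(B)`.
  have e : 16 * (xc E B - xc E A) ^ 2 *
      ((xc E B - xc E A) ^ 2 * (xc E (A + B) * xc E (A - B))) =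
      (tc E A ^ 2 + tc E B ^ 2 -
        (E.b₂ + 4 * xc E A + 4 * xc E B) * (xc E B - xc E A) ^ 2) ^ 2 -
        4 * tc E A ^ 2 * tc E B ^ 2 := by
    rw [show 16 * (xc E B - xc E A) ^ 2 *
      ((xc E B - xc E A) ^ 2 * (xc E (A + B) * xc E (A - B))) =
      (4 * (xc E B - xc E A) ^ 2 * xc E (A + B)) * (4 * (xc E B - xc E A) ^ 2 * xc E (A - B))
      by ring, a1, a2]
    ring
  rw [e, kA, kB]
  linear_combination (4 * (xc E B - xc E A) ^ 2) * b8

/-- By the sum and product formulas for `x(A + B)` and `x(A - B)`, the expression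
`(x(A) - x(B))² (x(C) - x(A + B)) (x(C) - x(A - B))` is symmetric in `A`, `B` and `C`. -/
lemma xc_add_sub_symm {A B C : E.toAffine.Point} (hA : A ≠ 0) (hB : B ≠ 0) (hC : C ≠ 0)
    (hAB : xc E A ≠ xc E B) (hBC : xc E C ≠ xc E B) :
    (xc E B - xc E A) ^ 2 * ((xc E C - xc E (A + B)) * (xc E C - xc E (A - B))) =
      (xc E B - xc E C) ^ 2 * ((xc E (C + B) - xc E A) * (xc E (C - B) - xc E A)) := by
  have a1 := xc_add_add_xc_sub hA hB hAB
  have a2 := xc_add_mul_xc_sub hA hB hAB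
  have c1 := xc_add_add_xc_sub hC hB hBC
  have c2 := xc_add_mul_xc_sub hC hB hBC
  linear_combination -xc E C * a1 + a2 + xc E A * c1 - c2

/-- The limiting case `C = B` of `xc_add_sub_symm`. -/
lemma xc_add_sub_double {A B : E.toAffine.Point} (hA : A ≠ 0) (hB : B ≠ 0)
    (hAB : xc E A ≠ xc E B) (hB2 : tc E B ≠ 0) :
    (xc E B - xc E A) ^ 2 * ((xc E B - xc E (A + B)) * (xc E B - xc E (A - B))) =
      tc E B ^ 2 * (xc E (B + B) - xc E A) := by
  have a1 := xc_add_add_xc_sub hA hB hAB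
  have a2 := xc_add_mul_xc_sub hA hB hAB
  have d := (tangent_law hB hB2).2.1
  have kB := tc_sq hB
  have b8 := E.b_relation
  have d' : 16 * (tc E B ^ 2 * xc E (B + B)) =
      cubicB' E (xc E B) ^ 2 - 4 * (E.b₂ + 8 * xc E B) * tc E B ^ 2 := by
    rw [d]
    field_simp
    ring
  rw [cubicB] at kB
  rw [cubicB'] at d'
  have h4 : (16 : K) ≠ 0 := by norm_num
  refine mul_left_cancel₀ h4 ?_
  linear_combination -16 * xc E B * a1 + 16 * a2 - d' +
    (16 * xc E A + 4 * (E.b₂ + 8 * xc E B)) * kB - 4 * b8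

lemma xc_nsmul_ne {Q : E.toAffine.Point} {M : ℕ} (hQ : ∀ j, 1 ≤ j → j ≤ M → j • Q ≠ 0)
    {i j : ℕ} (hi : 1 ≤ i) (hij : i < j) (hM : i + j ≤ M) :
    xc E (i • Q) ≠ xc E (j • Q) := by
  intro h
  obtain ⟨k, rfl⟩ := Nat.exists_eq_add_of_lt hij
  rcases eq_or_eq_neg_of_xc_eq (hQ i hi (by lia)) (hQ _ (by lia) (by lia)) h with h | h
  · refine hQ (k + 1) (by lia) (by lia) ?_
    rw [add_assoc, add_nsmul, left_eq_add] at h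
    exact h
  · refine hQ _ (by lia) hM ?_
    rw [add_nsmul, h, neg_add_cancel]

lemma tc_ne_zero_of_add_self_ne {Q : E.toAffine.Point} (h : Q + Q ≠ 0) : tc E Q ≠ 0 := by
  intro ht
  have hQ : Q ≠ 0 := by rintro rfl; exact h (add_zero 0)
  refine h (add_eq_zero_iff_eq_neg.2 (point_ext hQ (neg_ne_zero.2 hQ) (xc_neg Q).symm ?_))
  rw [tc_neg, ht, neg_zero]

/-- The values of the division polynomials at `Q`, computed from the `x`-coordinates of the
multiples of `Q` by the recursion `h (n + 1) h (n - 1) = h n ^ 2 (x(Q) - x(nQ))`. The recursion is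
meaningful as long as the multiples involved do not vanish. -/
noncomputable def divSeq (Q : E.toAffine.Point) : ℕ → K
  | 0 => 0
  | 1 => 1
  | 2 => tc E Q
  | (n + 3) => divSeq Q (n + 2) ^ 2 * (xc E Q - xc E ((n + 2) • Q)) / divSeq Q (n + 1)

lemma divSeq_ne_zero {Q : E.toAffine.Point} {M : ℕ} (hQ : ∀ j, 1 ≤ j → j ≤ M → j • Q ≠ 0) :
    ∀ n, 1 ≤ n → n ≤ M → divSeq Q n ≠ 0
  | 0, h, _ => by lia
  | 1, _, _ => by rw [divSeq]; exact one_ne_zero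
  | 2, _, h => by
    rw [divSeq]
    exact tc_ne_zero_of_add_self_ne (two_nsmul Q ▸ hQ 2 (by lia) h)
  | (n + 3), _, h => by
    have h1 := divSeq_ne_zero hQ (n + 1) (by lia) (by lia)
    have h2 := divSeq_ne_zero hQ (n + 2) (by lia) (by lia)
    have h3 := xc_nsmul_ne hQ (i := 1) (j := n + 2) le_rfl (by lia) (by lia)
    rw [one_nsmul] at h3
    rw [divSeq]
    exact div_ne_zero (mul_ne_zero (pow_ne_zero 2 h2) (sub_ne_zero.2 h3)) h1

lemma divSeq_one_step {Q : E.toAffine.Point} {M : ℕ} (hQ : ∀ j, 1 ≤ j → j ≤ M → j • Q ≠ 0)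
    (k : ℕ) (hk : k + 2 ≤ M + 1) :
    divSeq Q (k + 2) * divSeq Q k = divSeq Q (k + 1) ^ 2 * (xc E Q - xc E ((k + 1) • Q)) := by
  rcases k with _ | k
  · simp [divSeq]
  · rw [divSeq, div_mul_cancel₀ _ (divSeq_ne_zero hQ _ (by lia) (by lia))]

/-- The elliptic net relation
`h (n + m) h (n - m) = h n ^ 2 h m ^ 2 (x(mQ) - x(nQ))`, with `n = m + k`. -/
lemma divSeq_net {Q : E.toAffine.Point} {M : ℕ} (hQ : ∀ j, 1 ≤ j → j ≤ M → j • Q ≠ 0) :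
    ∀ m k : ℕ, 1 ≤ m → 2 * m + k ≤ M + 1 →
      divSeq Q (2 * m + k) * divSeq Q k =
        divSeq Q (m + k) ^ 2 * divSeq Q m ^ 2 * (xc E (m • Q) - xc E ((m + k) • Q))
  | 0, _, h, _ => by lia
  | 1, k, _, h => by
    have := divSeq_one_step hQ k (by lia)
    rw [show 2 * 1 + k = k + 2 by ring, this, add_comm 1 k, one_nsmul, divSeq]
    ring
  | 2, k, _, h => by
    rcases k with _ | k
    · simp [divSeq]
    have r1 := divSeq_one_step hQ (k + 3) (by lia)
    have r2 := divSeq_one_step hQ (k + 1) (by lia)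
    have r3 := divSeq_one_step hQ (k + 2) (by lia)
    have hB : Q ≠ 0 := one_nsmul Q ▸ hQ 1 le_rfl (by lia)
    have hBB : Q + Q ≠ 0 := two_nsmul Q ▸ hQ 2 (by lia) (by lia)
    have hn := hQ (k + 3) (by lia) (by lia)
    have hne := xc_nsmul_ne hQ (i := 1) (j := k + 3) le_rfl (by lia) (by lia)
    rw [one_nsmul] at hne
    have key := xc_add_sub_double hn hB hne.symm (tc_ne_zero_of_add_self_ne hBB)
    rw [show (k + 3) • Q + Q = (k + 4) • Q from (succ_nsmul Q _).symm,
      show (k + 3) • Q - Q = (k + 2) • Q by rw [succ_nsmul Q (k + 2), add_sub_cancel_right],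
      ← two_nsmul] at key
    have h3 := divSeq_ne_zero hQ (k + 3) (by lia) (by lia)
    rw [show 2 * 2 + (k + 1) = k + 5 by ring, show 2 + (k + 1) = k + 3 by ring]
    rw [show divSeq Q 2 = tc E Q from rfl]
    simp only [add_assoc, Nat.reduceAdd] at r1 r2 r3 ⊢
    refine mul_left_cancel₀ (pow_ne_zero 2 h3) ?_
    calc _ = (divSeq Q (k + 5) * divSeq Q (k + 3)) * (divSeq Q (k + 3) * divSeq Q (k + 1)) := by
          ring
      _ = (divSeq Q (k + 4) * divSeq Q (k + 2)) ^ 2 *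
          ((xc E Q - xc E ((k + 4) • Q)) * (xc E Q - xc E ((k + 2) • Q))) := by
          rw [r1, r2]; ring
      _ = divSeq Q (k + 3) ^ 4 * ((xc E Q - xc E ((k + 3) • Q)) ^ 2 *
          ((xc E Q - xc E ((k + 4) • Q)) * (xc E Q - xc E ((k + 2) • Q)))) := by
          rw [r3]; ring
      _ = _ := by rw [key]; ring
  | (j + 3), k, _, h => by
    -- With `n = j + k + 3` and `m = j + 2`, multiply the relations for `(n + 1, m)` and
    -- `(n - 1, m)`, apply the symmetry, and cancel the relation for `(n, m - 1)`.
    have i1 := divSeq_net hQ (j + 2) (k + 2) (by lia) (by lia)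
    have i2 := divSeq_net hQ (j + 2) k (by lia) (by lia)
    have i3 := divSeq_net hQ (j + 1) (k + 2) (by lia) (by lia)
    have r1 := divSeq_one_step hQ (j + k + 2) (by lia)
    have r2 := divSeq_one_step hQ (j + 1) (by lia)
    have hB : Q ≠ 0 := one_nsmul Q ▸ hQ 1 le_rfl (by lia)
    have hn := hQ (j + k + 3) (by lia) (by lia)
    have hm := hQ (j + 2) (by lia) (by lia)
    have hne := xc_nsmul_ne hQ (i := 1) (j := j + k + 3) le_rfl (by lia) (by lia)
    have hne' := xc_nsmul_ne hQ (i := 1) (j := j + 2) le_rfl (by lia) (by lia)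
    rw [one_nsmul] at hne hne'
    have key := xc_add_sub_symm hn hB hm hne.symm hne'.symm
    rw [show (j + k + 3) • Q + Q = (j + k + 4) • Q from (succ_nsmul Q _).symm,
      show (j + k + 3) • Q - Q = (j + k + 2) • Q by
        rw [succ_nsmul Q (j + k + 2), add_sub_cancel_right],
      show (j + 2) • Q + Q = (j + 3) • Q from (succ_nsmul Q _).symm,
      show (j + 2) • Q - Q = (j + 1) • Q by
        rw [succ_nsmul Q (j + 1), add_sub_cancel_right]] at key
    have n1 := divSeq_ne_zero hQ (2 * j + k + 4) (by lia) (by lia)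
    have n2 := divSeq_ne_zero hQ (k + 2) (by lia) (by lia)
    rw [show 2 * (j + 2) + (k + 2) = 2 * j + k + 6 by ring,
      show j + 2 + (k + 2) = j + k + 4 by ring] at i1
    rw [show 2 * (j + 2) + k = 2 * j + k + 4 by ring, show j + 2 + k = j + k + 2 by ring] at i2
    rw [show 2 * (j + 1) + (k + 2) = 2 * j + k + 4 by ring,
      show j + 1 + (k + 2) = j + k + 3 by ring] at i3
    rw [show 2 * (j + 3) + k = 2 * j + k + 6 by ring, show j + 3 + k = j + k + 3 by ring]
    simp only [add_assoc, Nat.reduceAdd] at r1 r2 i1 i2 i3 key n1 n2 ⊢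
    refine mul_left_cancel₀ (mul_ne_zero n1 n2) ?_
    calc _ = (divSeq Q (2 * j + (k + 6)) * divSeq Q (k + 2)) *
          (divSeq Q (2 * j + (k + 4)) * divSeq Q k) := by ring
      _ = (divSeq Q (j + (k + 4)) * divSeq Q (j + (k + 2))) ^ 2 * divSeq Q (j + 2) ^ 4 *
          ((xc E ((j + 2) • Q) - xc E ((j + (k + 4)) • Q)) *
            (xc E ((j + 2) • Q) - xc E ((j + (k + 2)) • Q))) := by rw [i1, i2]; ring
      _ = divSeq Q (j + (k + 3)) ^ 4 * divSeq Q (j + 2) ^ 4 *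
          ((xc E Q - xc E ((j + (k + 3)) • Q)) ^ 2 *
          ((xc E ((j + 2) • Q) - xc E ((j + (k + 4)) • Q)) *
            (xc E ((j + 2) • Q) - xc E ((j + (k + 2)) • Q)))) := by rw [r1]; ring
      _ = divSeq Q (j + (k + 3)) ^ 4 *
          (divSeq Q (j + 2) ^ 2 * (xc E Q - xc E ((j + 2) • Q))) ^ 2 *
          ((xc E ((j + 3) • Q) - xc E ((j + (k + 3)) • Q)) *
            (xc E ((j + 1) • Q) - xc E ((j + (k + 3)) • Q))) := by rw [key]; ring
      _ = _ := by rw [← r2, i3]; ring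

lemma divSeq_three {Q : E.toAffine.Point} (hQ : Q ≠ 0) (ht : tc E Q ≠ 0) :
    divSeq Q 3 = E.Ψ₃.eval (xc E Q) := by
  have h2 := (tangent_law hQ ht).2.1
  have kQ := tc_sq hQ
  have b8 := E.b_relation
  have e : divSeq Q 3 = tc E Q ^ 2 * (xc E Q - xc E (Q + Q)) := by
    rw [divSeq, divSeq, divSeq, div_one, zero_add, two_nsmul]
  have d : 16 * (tc E Q ^ 2 * xc E (Q + Q)) =
      cubicB' E (xc E Q) ^ 2 - 4 * (E.b₂ + 8 * xc E Q) * tc E Q ^ 2 := by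
    rw [h2]
    field_simp
    ring
  rw [cubicB] at kQ
  rw [cubicB'] at d
  rw [e]
  simp only [WeierstrassCurve.Ψ₃, eval_add, eval_mul, eval_C, eval_X, eval_pow, eval_ofNat]
  have h4 : (16 : K) ≠ 0 := by norm_num
  refine mul_left_cancel₀ h4 ?_
  linear_combination -d + (16 * xc E Q + 4 * (E.b₂ + 8 * xc E Q)) * kQ - 4 * b8

lemma divSeq_four {Q : E.toAffine.Point} (hQ : Q ≠ 0) (ht : tc E Q ≠ 0)
    (hne : xc E (Q + Q) ≠ xc E Q) :
    divSeq Q 4 = E.preΨ₄.eval (xc E Q) * tc E Q := by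
  obtain ⟨h0, h2, h2'⟩ := tangent_law hQ ht
  have h3 := (chord_law h0 hQ hne).1
  have kQ := tc_sq hQ
  have b8 := E.b_relation
  have hd : xc E Q - xc E (Q + Q) ≠ 0 := sub_ne_zero.2 hne.symm
  have e3 := divSeq_three hQ ht
  have e3' : divSeq Q 3 = tc E Q ^ 2 * (xc E Q - xc E (Q + Q)) := by
    rw [divSeq, divSeq, divSeq, div_one, zero_add, two_nsmul]
  have e4 : divSeq Q 4 * tc E Q = divSeq Q 3 ^ 2 * (xc E Q - xc E (Q + Q + Q)) := by
    have : divSeq Q 4 = divSeq Q 3 ^ 2 * (xc E Q - xc E (3 • Q)) / tc E Q := by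
      rw [divSeq, show divSeq Q (1 + 1) = tc E Q from rfl]
    rw [this, div_mul_cancel₀ _ ht, show 3 • Q = Q + Q + Q by rw [succ_nsmul, two_nsmul]]
  have d : (xc E Q - xc E (Q + Q + Q)) * (xc E Q - xc E (Q + Q)) ^ 2 =
      cubicB' E (xc E Q) / 2 * (xc E Q - xc E (Q + Q)) - tc E Q ^ 2 := by
    have hX : E.b₂ = (cubicB' E (xc E Q) / (2 * tc E Q)) ^ 2 - 8 * xc E Q - 4 * xc E (Q + Q) := by
      rw [h2]; ring
    rw [h3, h2', hX]
    field_simp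
    ring
  have e5 : divSeq Q 4 * tc E Q =
      tc E Q ^ 2 * (cubicB' E (xc E Q) / 2 * divSeq Q 3 - (tc E Q ^ 2) ^ 2) := by
    rw [e4, e3']
    linear_combination tc E Q ^ 4 * d
  refine mul_right_cancel₀ ht ?_
  rw [e5, e3, kQ]
  have : cubicB' E (xc E Q) / 2 * E.Ψ₃.eval (xc E Q) - cubicB E (xc E Q) ^ 2 =
      E.preΨ₄.eval (xc E Q) := by
    simp only [WeierstrassCurve.Ψ₃, WeierstrassCurve.preΨ₄, eval_add, eval_mul, eval_C, eval_X,
      eval_pow, eval_ofNat, cubicB, cubicB']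
    linear_combination -xc E Q ^ 2 * b8
  rw [this, mul_assoc, ← pow_two, kQ]
  ring

/-- The sequence `divSeq` is the normalised elliptic divisibility sequence of division polynomials,
evaluated at `Q`. -/
lemma normEDS_eq_divSeq {Q : E.toAffine.Point} {M : ℕ} (hM : 2 ≤ M)
    (hQ : ∀ j, 1 ≤ j → j ≤ M → j • Q ≠ 0) (n : ℕ) :
    n ≤ M + 1 → normEDS (tc E Q) (E.Ψ₃.eval (xc E Q)) (E.preΨ₄.eval (xc E Q)) n = divSeq Q n := by
  have hQ0 : Q ≠ 0 := one_nsmul Q ▸ hQ 1 le_rfl (by lia)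
  have ht : tc E Q ≠ 0 := tc_ne_zero_of_add_self_ne (two_nsmul Q ▸ hQ 2 (by lia) hM)
  induction n using normEDSRec' with
  | zero => intro _; simp [divSeq]
  | one => intro _; simp [divSeq]
  | two => intro _; rw [divSeq]; exact normEDS_two ..
  | three => intro _; rw [divSeq_three hQ0 ht]; exact normEDS_three ..
  | four =>
    intro h
    have := xc_nsmul_ne hQ (i := 1) (j := 2) le_rfl (by lia) (by lia)
    rw [one_nsmul, two_nsmul] at this
    rw [divSeq_four hQ0 ht this.symm]
    exact normEDS_four ..
  | even m ih =>
    intro h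
    have e := normEDS_even (tc E Q) (E.Ψ₃.eval (xc E Q)) (E.preΨ₄.eval (xc E Q)) ((m : ℤ) + 3)
    have i1 := ih (m + 1) (by lia) (by lia)
    have i2 := ih (m + 2) (by lia) (by lia)
    have i3 := ih (m + 3) (by lia) (by lia)
    have i4 := ih (m + 4) (by lia) (by lia)
    have i5 := ih (m + 5) (by lia) (by lia)
    push_cast at i1 i2 i3 i4 i5 ⊢
    rw [show (m : ℤ) + 3 - 1 = m + 2 by ring, show (m : ℤ) + 3 + 2 = m + 5 by ring,
      show (m : ℤ) + 3 - 2 = m + 1 by ring, show (m : ℤ) + 3 + 1 = m + 4 by ring,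
      i1, i2, i3, i4, i5] at e
    refine mul_right_cancel₀ ht ?_
    rw [e]
    have n1 := divSeq_net hQ (m + 2) 2 (by lia) (by lia)
    have n2 := divSeq_one_step hQ (m + 3) (by lia)
    have n3 := divSeq_one_step hQ (m + 1) (by lia)
    rw [show 2 * (m + 2) + 2 = 2 * (m + 3) by ring, show m + 2 + 2 = m + 4 by ring,
      show divSeq Q 2 = tc E Q from rfl] at n1
    simp only [add_assoc, Nat.reduceAdd] at n2 n3
    rw [n1]
    linear_combination divSeq Q (m + 2) ^ 2 * n2 - divSeq Q (m + 4) ^ 2 * n3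
  | odd m ih =>
    intro h
    have e := normEDS_odd (tc E Q) (E.Ψ₃.eval (xc E Q)) (E.preΨ₄.eval (xc E Q)) ((m : ℤ) + 2)
    have i1 := ih (m + 1) (by lia) (by lia)
    have i2 := ih (m + 2) (by lia) (by lia)
    have i3 := ih (m + 3) (by lia) (by lia)
    have i4 := ih (m + 4) (by lia) (by lia)
    push_cast at i1 i2 i3 i4 ⊢
    rw [show (m : ℤ) + 2 - 1 = m + 1 by ring, show (m : ℤ) + 2 + 2 = m + 4 by ring,
      show (m : ℤ) + 2 + 1 = m + 3 by ring, i1, i2, i3, i4] at e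
    rw [e]
    have n1 := divSeq_net hQ (m + 2) 1 (by lia) (by lia)
    have n2 := divSeq_one_step hQ (m + 2) (by lia)
    have n3 := divSeq_one_step hQ (m + 1) (by lia)
    rw [show m + 2 + 1 = m + 3 by ring, show divSeq Q 1 = 1 from rfl] at n1
    simp only [add_assoc, Nat.reduceAdd] at n1 n2 n3 ⊢
    linear_combination divSeq Q (m + 2) ^ 2 * n2 - divSeq Q (m + 3) ^ 2 * n3 - n1

/-- The division polynomial `ψ_p` vanishes at the points of order `p`. -/
theorem eval_preΨ_eq_zero {p : ℕ} (hp : p.Prime) (h2 : p ≠ 2) {Q : E.toAffine.Point} (hQ : Q ≠ 0)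
    (hpQ : p • Q = 0) : (E.preΨ p).eval (xc E Q) = 0 := by
  have hodd := hp.odd_of_ne_two h2
  have h3 : 3 ≤ p := by have := hp.two_le; lia
  have := Fact.mk hp
  have hord : addOrderOf Q = p := addOrderOf_eq_prime hpQ hQ
  have hM : ∀ j, 1 ≤ j → j ≤ p - 1 → j • Q ≠ 0 := by
    intro j hj hj' h0
    have := Nat.le_of_dvd (by lia) (addOrderOf_dvd_of_nsmul_eq_zero h0)
    lia
  have key := normEDS_eq_divSeq (by lia) hM p (by lia)
  have hlast : divSeq Q p = 0 := by
    obtain ⟨k, rfl⟩ : ∃ k, p = k + 3 := ⟨p - 3, by lia⟩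
    have : (k + 2) • Q = -Q := by
      rw [← add_eq_zero_iff_eq_neg, ← succ_nsmul]
      exact hpQ
    rw [divSeq, this, xc_neg, sub_self, mul_zero, zero_div]
  have hb : (E.Ψ₂Sq ^ 2).eval (xc E Q) = tc E Q ^ 4 := by
    rw [show tc E Q ^ 4 = (tc E Q ^ 2) ^ 2 by ring, tc_sq hQ]
    simp [WeierstrassCurve.Ψ₂Sq, cubicB]
  rw [hlast, normEDS, if_neg (by simpa using hodd), mul_one] at key
  rw [← key, WeierstrassCurve.preΨ, ← coe_evalRingHom, map_preNormEDS, coe_evalRingHom, hb]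

end DivisionPolynomials

/-! ### Injective endomorphisms with three fixed points -/

section Rigidity

open Filter

variable {K : Type*} [Field K] [CharZero K] [IsAlgClosed K] [DecidableEq K]
  {E : WeierstrassCurve K} [E.IsElliptic] {α : AddMonoid.End E.toAffine.Point} {r s : K → K}

/-- Multiplication by the positive integer `n` scales the invariant differential by `n`. -/
lemma scales_natCast (n : ℕ) : Scales ((n + 1 : ℕ) : AddMonoid.End E.toAffine.Point) (n + 1) := by
  have h1 : Scales (1 : AddMonoid.End E.toAffine.Point) 1 :=
    ⟨_, _, ratWith_one, hasDer_id.congr (.of_forall fun _ => rfl)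
      (.of_forall fun _ => one_mul _)⟩
  induction n with
  | zero => simpa using h1
  | succ n ih =>
    have ⟨r, s, h, hr⟩ := ih
    have ⟨r₁, s₁, h', hr'⟩ := h1
    rw [Nat.cast_succ (n + 1), show ((n + 1 : ℕ) : K) = n + 1 from Nat.cast_succ n]
    rcases h.isRat_fst.eventually_eq_or_ne h'.isRat_fst with e | e
    · rcases h.eq_or_eq_neg_of_eventually h' e with e' | e'
      · rw [e'] at ih ⊢
        rw [ih.unique h1]
        rw [one_add_one_eq_two (R := K)]
        exact scales_one_add_one
      · rw [e'] at ih
        have e2 := ih.unique h1.neg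
        exact absurd (show ((n + 1 + 1 : ℕ) : K) = 0 by push_cast; rw [e2]; ring)
          (Nat.cast_ne_zero.2 (by lia))
    · exact scales_add_of_ne h h' hr hr' e

lemma intCast_end_ne_zero {n : ℤ} (hn : n ≠ 0) : (n : AddMonoid.End E.toAffine.Point) ≠ 0 := by
  have key : ∀ k : ℕ, ((k + 1 : ℕ) : AddMonoid.End E.toAffine.Point) ≠ 0 := by
    intro k h0
    obtain ⟨r, s, h, -⟩ := scales_natCast (E := E) k
    exact h.ne_zero h0
  obtain ⟨k, rfl | rfl⟩ := n.eq_nat_or_neg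
  · obtain ⟨k, rfl⟩ := Nat.exists_eq_succ_of_ne_zero (by simpa using hn)
    exact_mod_cast key k
  · obtain ⟨k, rfl⟩ := Nat.exists_eq_succ_of_ne_zero (by simpa using hn)
    rw [Int.cast_neg, neg_ne_zero]
    exact_mod_cast key k

/-- A fraction describing `α` generically is valid at every point at which it makes sense. -/
lemma RatWith.eval_eq (h : RatWith α r s) {u v : K[X]} (hv : v ≠ 0)
    (hr : ∀ᶠ x in cofinite, r x = u.eval x / v.eval x) {P : E.toAffine.Point} (hP : P ≠ 0)
    (hαP : α P ≠ 0) : u.eval (xc E P) = v.eval (xc E P) * xc E (α P) := by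
  obtain ⟨d, F, -, ⟨j, hj⟩, hF⟩ := RatHom.isEndomorphism (.inr ⟨r, s, h⟩) P
  let u' : MvPolynomial (Fin 3) K := aeval (MvPolynomial.X 0) u
  let v' : MvPolynomial (Fin 3) K := aeval (MvPolynomial.X 0) v
  have he : ∀ (w : K[X]) {Q : E.toAffine.Point}, Q ≠ 0 →
      MvPolynomial.eval (homCoords E Q) (aeval (MvPolynomial.X 0) w) = w.eval (xc E Q) := by
    intro w Q hQ
    have := Polynomial.hom_eval₂ w (algebraMap K (MvPolynomial (Fin 3) K))
      (MvPolynomial.eval (homCoords E Q)) (MvPolynomial.X 0)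
    rw [aeval_def, this, MvPolynomial.eval_X, homCoords_of_ne_zero hQ, eval]
    congr 1
    ext
    simp
  have hz : ∀ᶠ Q in cofinite, MvPolynomial.eval (homCoords E Q) (u' * F 2 - v' * F 0) = 0 := by
    filter_upwards [eventually_eval_homCoords_ne_zero hP hj, h.eventually, eventually_ne_zero,
      tendsto_xc.eventually hr, tendsto_xc.eventually (eventually_eval_ne_zero hv)]
      with Q h1 h2 h3 h4 h5
    obtain ⟨c, hc, H⟩ := hF Q ⟨j, h1⟩
    have H0 := H 0
    have H2 := H 2
    rw [homCoords_of_ne_zero h2.1] at H0 H2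
    simp only [Fin.isValue, Matrix.cons_val_zero, Matrix.cons_val, mul_one] at H0 H2
    rw [map_sub, map_mul, map_mul, he u h3, he v h3, H0, H2, h2.2.1, h4]
    field_simp
    ring
  have hz' := eval_homCoords_eq_zero_of_eventually hz hP
  obtain ⟨c, hc, H⟩ := hF P ⟨j, hj⟩
  have H0 := H 0
  have H2 := H 2
  rw [homCoords_of_ne_zero hαP] at H0 H2
  simp only [Fin.isValue, Matrix.cons_val_zero, Matrix.cons_val, mul_one] at H0 H2
  rw [map_sub, map_mul, map_mul, he u hP, he v hP, H0, H2] at hz'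
  refine mul_right_cancel₀ hc ?_
  linear_combination hz'

/-- An injective endomorphism acts on `x`-coordinates by a fractional linear transformation. -/
lemma RatWith.natDegree_le_one (h : RatWith α r s) (hinj : Function.Injective α) {u v : K[X]}
    (hv : v ≠ 0) (huv : IsCoprime u v) (hr : ∀ᶠ x in cofinite, r x = u.eval x / v.eval x) :
    u.natDegree ≤ 1 ∧ v.natDegree ≤ 1 := by
  have hp : ∀ᶠ x in cofinite, ∀ P : E.toAffine.Point, P ≠ 0 → xc E P = x →
      α P ≠ 0 ∧ xc E (α P) = u.eval x / v.eval x := by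
    rw [← eventually_xc_iff (E := E)]
    have hneg : Tendsto (fun P : E.toAffine.Point => -P) cofinite cofinite :=
      neg_injective.tendsto_cofinite
    have h1 := h.eventually.and (tendsto_xc.eventually hr)
    filter_upwards [h1, hneg.eventually h1, eventually_ne_zero] with P a b h0 Q hQ hx
    rcases eq_or_eq_neg_of_xc_eq hQ h0 hx with rfl | rfl
    · exact ⟨a.1.1, a.1.2.1.trans a.2⟩
    · rw [xc_neg] at b
      exact ⟨b.1.1, b.1.2.1.trans b.2⟩
  have key := (eventually_fibre huv (wronskian_ne_zero h.not_const hv hr) hp).mono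
    (p := fun c => _) (q := fun c => (u - C c * v).natDegree ≤ 1) fun c hc => ?_
  · obtain ⟨c, hc⟩ := key.exists
    have h2 : ∀ᶠ x in cofinite, x ≠ c := by rw [eventually_cofinite]; simp
    obtain ⟨d, hd, hdc⟩ := (key.and h2).exists
    have hv1 : v.natDegree ≤ 1 := by
      have e : C (d - c) * v = (u - C c * v) - (u - C d * v) := by rw [C_sub]; ring
      rw [← natDegree_C_mul (sub_ne_zero.2 hdc), e]
      exact (natDegree_sub_le _ _).trans (max_le hc hd)
    refine ⟨?_, hv1⟩
    rw [show u = (u - C c * v) + C c * v by ring]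
    exact (natDegree_add_le _ _).trans (max_le hc ((natDegree_C_mul_le _ _).trans hv1))
  · rw [(IsAlgClosed.splits _).natDegree_eq_card_roots,
      ← Multiset.toFinset_card_of_nodup hc.1, Finset.card_le_one]
    intro x hx y hy
    obtain ⟨-, hx2, hx3⟩ := hc.2 x (isRoot_of_mem_roots (Multiset.mem_toFinset.1 hx))
    obtain ⟨-, hy2, hy3⟩ := hc.2 y (isRoot_of_mem_roots (Multiset.mem_toFinset.1 hy))
    obtain ⟨P, hP, rfl⟩ := exists_point_of_xc (E := E) x
    obtain ⟨Q, hQ, rfl⟩ := exists_point_of_xc (E := E) y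
    obtain ⟨p1, p2⟩ := hx3 P hP rfl
    obtain ⟨q1, q2⟩ := hy3 Q hQ rfl
    rcases eq_or_eq_neg_of_xc_eq p1 q1 (by rw [p2, q2, hx2, hy2]) with e | e
    · rw [hinj e]
    · rw [← show α (-Q) = -α Q from map_neg α Q] at e
      rw [hinj e, xc_neg]

/-- A fractional linear transformation with three fixed points is the identity. -/
lemma RatHom.eq_one_or_neg_one (hα : RatHom α) (hinj : Function.Injective α)
    (T : Fin 3 → E.toAffine.Point) (hT : Function.Injective fun j => xc E (T j))
    (hT0 : ∀ j, T j ≠ 0) (hfix : ∀ j, α (T j) = T j) : α = 1 ∨ α = -1 := by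
  have hα0 : α ≠ 0 := by
    rintro rfl
    exact hT0 0 (hfix 0).symm
  obtain ⟨r, s, h⟩ := hα.exists_of_ne_zero hα0
  obtain ⟨u, v, hv, huv, hr⟩ := h.isRat_fst.exists_coprime
  obtain ⟨hu1, hv1⟩ := h.natDegree_le_one hinj hv huv hr
  have h0 : u - v * X = 0 := by
    refine eq_zero_of_natDegree_lt_card_of_eval_eq_zero _ hT (fun j => ?_) ?_
    · have := h.eval_eq hv hr (hT0 j) (by rw [hfix]; exact hT0 j)
      rw [hfix] at this
      rw [eval_sub, eval_mul, eval_X, this, sub_self]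
    · have h1 : (v * X).natDegree ≤ 2 := natDegree_mul_le_of_le hv1 natDegree_X_le
      have h2 := natDegree_sub_le_of_le (hu1.trans one_le_two) h1
      simp only [Fintype.card_fin]
      lia
  refine h.eq_or_eq_neg_of_eventually ratWith_one ?_
  filter_upwards [hr, eventually_eval_ne_zero hv] with x h1 h2
  rw [h1, sub_eq_zero.1 h0, eval_mul, eval_X, mul_div_cancel_left₀ _ h2]

end Rigidity

/-! ### The curves `y² = x³ + ax` -/

section Gaussian

open Filter

variable {K : Type*} [Field K] [CharZero K] [DecidableEq K] {E : WeierstrassCurve K}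

/-- The map `(x, y) ↦ (-x, iy)` on a curve of the form `y² = x³ + ax`. -/
def gaussMap (h₁ : E.a₁ = 0) (h₂ : E.a₂ = 0) (h₃ : E.a₃ = 0) (h₆ : E.a₆ = 0) {i : K}
    (hi : i ^ 2 = -1) : E.toAffine.Point → E.toAffine.Point
  | .zero => .zero
  | .some x y h => .some (-x) (i * y) (by
      have hi0 : i ≠ 0 := by rintro rfl; norm_num at hi
      rw [WeierstrassCurve.Affine.nonsingular_iff, WeierstrassCurve.Affine.equation_iff] at h ⊢
      simp only [h₁, h₂, h₃, h₆] at h ⊢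
      refine ⟨by linear_combination y ^ 2 * hi - h.1, h.2.imp ?_ ?_⟩
      · intro h h'
        apply h
        linear_combination h'
      · intro h h'
        apply h
        refine mul_left_cancel₀ hi0 ?_
        linear_combination h')

variable {h₁ : E.a₁ = 0} {h₂ : E.a₂ = 0} {h₃ : E.a₃ = 0} {h₆ : E.a₆ = 0} {i : K} {hi : i ^ 2 = -1}

lemma gaussMap_zero : gaussMap h₁ h₂ h₃ h₆ hi 0 = 0 := rfl

lemma xc_gaussMap (P : E.toAffine.Point) : xc E (gaussMap h₁ h₂ h₃ h₆ hi P) = -xc E P := by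
  rcases P with _ | ⟨x, y, h⟩
  · exact neg_zero.symm
  · rfl

lemma tc_gaussMap (P : E.toAffine.Point) : tc E (gaussMap h₁ h₂ h₃ h₆ hi P) = i * tc E P := by
  rcases P with _ | ⟨x, y, h⟩
  · exact (mul_zero i).symm
  · simp only [gaussMap, tc_some, h₁, h₃]
    ring

lemma gaussMap_ne_zero {P : E.toAffine.Point} (hP : P ≠ 0) : gaussMap h₁ h₂ h₃ h₆ hi P ≠ 0 := by
  rcases P with _ | ⟨x, y, h⟩
  · exact absurd rfl hP
  · exact WeierstrassCurve.Affine.Point.some_ne_zero _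

lemma gaussMap_neg (P : E.toAffine.Point) :
    gaussMap h₁ h₂ h₃ h₆ hi (-P) = -gaussMap h₁ h₂ h₃ h₆ hi P := by
  by_cases hP : P = 0
  · rw [hP, neg_zero, gaussMap_zero, neg_zero]
  · refine point_ext (gaussMap_ne_zero (neg_ne_zero.2 hP)) (neg_ne_zero.2 (gaussMap_ne_zero hP))
      ?_ ?_
    · rw [xc_gaussMap, xc_neg, xc_neg, xc_gaussMap]
    · rw [tc_gaussMap, tc_neg, tc_neg, tc_gaussMap, mul_neg]

lemma gaussMap_add (P Q : E.toAffine.Point) : gaussMap h₁ h₂ h₃ h₆ hi (P + Q) =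
    gaussMap h₁ h₂ h₃ h₆ hi P + gaussMap h₁ h₂ h₃ h₆ hi Q := by
  have hi0 : i ≠ 0 := by rintro rfl; norm_num at hi
  have hb : E.b₂ = 0 := by rw [WeierstrassCurve.b₂, h₁, h₂]; ring
  by_cases hP : P = 0
  · rw [hP, gaussMap_zero, zero_add, zero_add]
  by_cases hQ : Q = 0
  · rw [hQ, gaussMap_zero, add_zero, add_zero]
  have hP' := gaussMap_ne_zero (h₁ := h₁) (h₂ := h₂) (h₃ := h₃) (h₆ := h₆) (hi := hi) hP
  have hQ' := gaussMap_ne_zero (h₁ := h₁) (h₂ := h₂) (h₃ := h₃) (h₆ := h₆) (hi := hi) hQ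
  by_cases hx : xc E P = xc E Q
  · rcases eq_or_eq_neg_of_xc_eq hP hQ hx with rfl | rfl
    · by_cases ht : tc E P = 0
      · have e : P = -P := point_ext hP (neg_ne_zero.2 hP) (xc_neg P).symm (by simp [ht])
        nth_rw 2 [e]
        rw [add_neg_cancel, gaussMap_zero]
        nth_rw 2 [e]
        rw [gaussMap_neg, add_neg_cancel]
      · have ht' : tc E (gaussMap h₁ h₂ h₃ h₆ hi P) ≠ 0 := by
          rw [tc_gaussMap]
          exact mul_ne_zero hi0 ht
        obtain ⟨a, b, c⟩ := tangent_law hP ht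
        obtain ⟨a', b', c'⟩ := tangent_law hP' ht'
        have hB : cubicB' E (-xc E P) = cubicB' E (xc E P) := by
          rw [cubicB', cubicB', hb]
          ring
        have ex : xc E (gaussMap h₁ h₂ h₃ h₆ hi P + gaussMap h₁ h₂ h₃ h₆ hi P) =
            -xc E (P + P) := by
          rw [b', b, xc_gaussMap, tc_gaussMap, hB, hb]
          field_simp
          rw [hi]
          ring
        refine point_ext (gaussMap_ne_zero a) a' ?_ ?_
        · rw [xc_gaussMap, ex]
        · rw [tc_gaussMap, c', c, ex, xc_gaussMap, tc_gaussMap, hB]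
          field_simp
          rw [hi]
          ring
    · rw [neg_add_cancel, gaussMap_neg, neg_add_cancel, gaussMap_zero]
  · have hd : xc E Q - xc E P ≠ 0 := sub_ne_zero.2 (Ne.symm hx)
    have hx' : xc E (gaussMap h₁ h₂ h₃ h₆ hi P) ≠ xc E (gaussMap h₁ h₂ h₃ h₆ hi Q) := by
      rw [xc_gaussMap, xc_gaussMap]
      exact fun h => hx (neg_injective h)
    obtain ⟨b, c⟩ := chord_law hP hQ hx
    obtain ⟨b', c'⟩ := chord_law hP' hQ' hx'
    have hm : (i * tc E Q - i * tc E P) / (-xc E Q - -xc E P) =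
        -(i * ((tc E Q - tc E P) / (xc E Q - xc E P))) := by
      rw [show -xc E Q - -xc E P = -(xc E Q - xc E P) by ring]
      field_simp
    have ex : xc E (gaussMap h₁ h₂ h₃ h₆ hi P + gaussMap h₁ h₂ h₃ h₆ hi Q) = -xc E (P + Q) := by
      rw [b', b, xc_gaussMap, tc_gaussMap, xc_gaussMap, tc_gaussMap, hm, hb]
      linear_combination ((tc E Q - tc E P) / (xc E Q - xc E P)) ^ 2 / 4 * hi
    refine point_ext (gaussMap_ne_zero (add_ne_zero_of_xc_ne hx)) (add_ne_zero_of_xc_ne hx') ?_ ?_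
    · rw [xc_gaussMap, ex]
    · rw [tc_gaussMap, c', c, ex, xc_gaussMap, tc_gaussMap, xc_gaussMap, tc_gaussMap, hm]
      ring

/-- The endomorphism `(x, y) ↦ (-x, iy)` of a curve of the form `y² = x³ + ax`. -/
def gaussEnd (h₁ : E.a₁ = 0) (h₂ : E.a₂ = 0) (h₃ : E.a₃ = 0) (h₆ : E.a₆ = 0) {i : K}
    (hi : i ^ 2 = -1) : AddMonoid.End E.toAffine.Point :=
  AddMonoidHom.mk' (gaussMap h₁ h₂ h₃ h₆ hi) gaussMap_add

lemma gaussEnd_apply (P : E.toAffine.Point) :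
    gaussEnd h₁ h₂ h₃ h₆ hi P = gaussMap h₁ h₂ h₃ h₆ hi P := rfl

lemma gaussEnd_mul_self : gaussEnd h₁ h₂ h₃ h₆ hi * gaussEnd h₁ h₂ h₃ h₆ hi = -1 := by
  ext P
  change gaussMap h₁ h₂ h₃ h₆ hi (gaussMap h₁ h₂ h₃ h₆ hi P) = -P
  by_cases hP : P = 0
  · rw [hP, gaussMap_zero, gaussMap_zero, neg_zero]
  · refine point_ext (gaussMap_ne_zero (gaussMap_ne_zero hP)) (neg_ne_zero.2 hP) ?_ ?_
    · rw [xc_gaussMap, xc_gaussMap, xc_neg, neg_neg]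
    · rw [tc_gaussMap, tc_gaussMap, tc_neg]
      linear_combination tc E P * hi

variable [IsAlgClosed K] [E.IsElliptic]

lemma ratHom_gaussEnd : RatHom (gaussEnd h₁ h₂ h₃ h₆ hi) := by
  refine .inr ⟨fun x => -x, fun _ => i, isRat_id.neg, isRat_const i,
    eventually_ne_zero.mono fun P hP => ?_⟩
  rw [gaussEnd_apply]
  exact ⟨gaussMap_ne_zero hP, xc_gaussMap P, tc_gaussMap P⟩

end Gaussian

section GaussianIntegers

lemma gauss_mul {R : Type*} [Ring R] {ι : R} (h : ι * ι = -1) (a b c d : ℤ) :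
    ((a : R) + b * ι) * (c + d * ι) = ((a * c - b * d : ℤ) : R) + ((a * d + b * c : ℤ) : R) * ι := by
  have h1 : (a : R) * (d * ι) = ((a * d : ℤ) : R) * ι := by push_cast; rw [mul_assoc]
  have h2 : (b : R) * ι * c = ((b * c : ℤ) : R) * ι := by
    push_cast
    rw [mul_assoc, (Int.cast_commute c ι).eq.symm, mul_assoc]
  have h3 : (b : R) * ι * (d * ι) = -((b * d : ℤ) : R) := by
    push_cast
    rw [mul_assoc, ← mul_assoc ι, (Int.cast_commute d ι).eq.symm, mul_assoc, h, mul_neg_one,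
      mul_neg]
  rw [mul_add, add_mul, add_mul, h1, h2, h3]
  push_cast
  noncomm_ring

lemma sub_mul_eq_add_neg_mul {R : Type*} [Ring R] (m n : ℤ) (ι : R) :
    (m : R) - n * ι = m + ((-n : ℤ) : R) * ι := by
  rw [Int.cast_neg, neg_mul, sub_eq_add_neg]

lemma gauss_mul_conj {R : Type*} [Ring R] {ι : R} (h : ι * ι = -1) (m n : ℤ) :
    ((m : R) + n * ι) * (m - n * ι) = ((m ^ 2 + n ^ 2 : ℤ) : R) := by
  have := gauss_mul h m n m (-n)
  rw [sub_mul_eq_add_neg_mul, this,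
    show m * -n + n * m = 0 by ring, Int.cast_zero, zero_mul, add_zero]
  congr 1
  ring

variable {K : Type*} [Field K] [CharZero K] [IsAlgClosed K] [DecidableEq K]
  {E : WeierstrassCurve K} [E.IsElliptic] {ι : AddMonoid.End E.toAffine.Point}

lemma ratHom_gauss (hι : RatHom ι) (m n : ℤ) :
    RatHom (m + n * ι : AddMonoid.End E.toAffine.Point) :=
  (ratHom_intCast m).add ((ratHom_intCast n).mul hι)

lemma gauss_ne_zero (hsq : ι * ι = -1) {m n : ℤ} (h : m ^ 2 + n ^ 2 ≠ 0) :
    (m + n * ι : AddMonoid.End E.toAffine.Point) ≠ 0 := by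
  intro h0
  have := gauss_mul_conj hsq m n
  rw [h0, zero_mul] at this
  exact intCast_end_ne_zero h this.symm

/-- If `m` is odd and `n` is even then `m + nι` fixes the points of order two, so that it is
injective only if it is `1` or `-1`. -/
lemma not_injective_gauss_of_odd (hι : RatHom ι) (hsq : ι * ι = -1)
    (T : Fin 3 → E.toAffine.Point) (hT : Function.Injective fun j => xc E (T j))
    (hT0 : ∀ j, T j ≠ 0) (hT2 : ∀ j, T j + T j = 0) {m n : ℤ} (hm : Odd m) (hn : Even n)
    (h : m ^ 2 + n ^ 2 ≠ 1) :
    ¬ Function.Injective (m + n * ι : AddMonoid.End E.toAffine.Point) := by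
  intro hinj
  obtain ⟨k, rfl⟩ := hm
  obtain ⟨l, rfl⟩ := hn
  have hfix : ∀ j, (((2 * k + 1 : ℤ) : AddMonoid.End E.toAffine.Point) + (l + l : ℤ) * ι) (T j) =
      T j := by
    intro j
    change (((2 * k + 1 : ℤ) : AddMonoid.End E.toAffine.Point)) (T j) +
      ((l + l : ℤ) : AddMonoid.End E.toAffine.Point) (ι (T j)) = T j
    have h2 : ι (T j) + ι (T j) = 0 := by
      rw [show ι (T j) + ι (T j) = ι (T j + T j) from (map_add ι _ _).symm, hT2]
      exact map_zero ι
    rw [AddMonoid.End.intCast_apply, AddMonoid.End.intCast_apply, add_zsmul, add_zsmul,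
      one_zsmul, mul_comm, mul_zsmul, two_zsmul, hT2, ← zsmul_add, h2, zsmul_zero, zsmul_zero,
      zero_add, add_zero]
  have key : ∀ e : ℤ, e ^ 2 = 1 →
      ((2 * k + 1 : ℤ) : AddMonoid.End E.toAffine.Point) + (l + l : ℤ) * ι = (e : ℤ) → False := by
    intro e he h1
    have h3 : (2 * k + 1 - e) ^ 2 + (l + l) ^ 2 = 0 := by
      by_contra h3
      refine gauss_ne_zero hsq h3 ?_
      rw [Int.cast_sub, sub_add_eq_add_sub, h1, sub_self]
    have h4 : l + l = 0 := by nlinarith [sq_nonneg (2 * k + 1 - e), sq_nonneg (l + l)]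
    have h5 : 2 * k + 1 - e = 0 := by
      rw [h4] at h3
      nlinarith [sq_nonneg (2 * k + 1 - e), sq_nonneg (l + l)]
    apply h
    rw [h4, show 2 * k + 1 = e by lia, he]
    norm_num
  rcases (ratHom_gauss hι _ _).eq_one_or_neg_one hinj T hT hT0 hfix with h1 | h1
  · exact key 1 (by norm_num) (by rw [h1, Int.cast_one])
  · exact key (-1) (by norm_num) (by rw [h1, Int.cast_neg, Int.cast_one])

/-- If `n` is odd and `m` is even, `ι (m + nι) = -n + mι` has the parity required by
`not_injective_gauss_of_odd`. -/
lemma not_injective_gauss (hι : RatHom ι) (hsq : ι * ι = -1)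
    (T : Fin 3 → E.toAffine.Point) (hT : Function.Injective fun j => xc E (T j))
    (hT0 : ∀ j, T j ≠ 0) (hT2 : ∀ j, T j + T j = 0) {m n : ℤ} (hmn : Odd (m ^ 2 + n ^ 2))
    (h : m ^ 2 + n ^ 2 ≠ 1) :
    ¬ Function.Injective (m + n * ι : AddMonoid.End E.toAffine.Point) := by
  rcases Int.even_or_odd n with hn | hn
  · refine not_injective_gauss_of_odd hι hsq T hT hT0 hT2 ?_ hn h
    by_contra hm
    rw [Int.not_odd_iff_even] at hm
    exact Int.not_odd_iff_even.2 ((hm.pow_of_ne_zero two_ne_zero).add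
      (hn.pow_of_ne_zero two_ne_zero)) hmn
  · have hm : Even m := by
      by_contra hm
      rw [Int.not_even_iff_odd] at hm
      exact Int.not_odd_iff_even.2 (hm.pow.add_odd hn.pow) hmn
    have hn' : Odd (-n) := hn.neg
    have := not_injective_gauss_of_odd hι hsq T hT hT0 hT2 hn' hm
      (by rw [neg_sq, add_comm]; exact h)
    intro hinj
    apply this
    have e := gauss_mul hsq 0 1 m n
    rw [Int.cast_zero, Int.cast_one, one_mul, zero_add] at e
    rw [show ((-n : ℤ) : AddMonoid.End E.toAffine.Point) + m * ι = ι * (m + n * ι) by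
      rw [e]; congr 2 <;> congr 1 <;> ring]
    have hι' : Function.Injective ι := by
      intro P Q hPQ
      have h1 : ∀ R, ι (ι R) = -R := fun R => DFunLike.congr_fun hsq R
      have h2 := h1 P
      rw [hPQ, h1] at h2
      exact (neg_injective h2).symm
    exact hι'.comp hinj

/-- For an odd prime `p = m² + n²` the kernels of `m + nι` and `m - nι` meet in zero: their sum is
`2m`, their product is `p`, and these are coprime. -/
lemma eq_zero_of_gauss_apply {p : ℕ} (hp : p.Prime) (h2 : p ≠ 2) (hsq : ι * ι = -1) {m n : ℤ}
    (hmn : m ^ 2 + n ^ 2 = p) {P : E.toAffine.Point}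
    (h : (m + n * ι : AddMonoid.End E.toAffine.Point) P = 0)
    (h' : (m - n * ι : AddMonoid.End E.toAffine.Point) P = 0) : P = 0 := by
  have h1 : (2 * m) • P = 0 := by
    rw [two_mul, add_zsmul, ← AddMonoid.End.intCast_apply]
    have e : (m : AddMonoid.End E.toAffine.Point) P + (m : AddMonoid.End E.toAffine.Point) P =
      (m + n * ι : AddMonoid.End E.toAffine.Point) P +
        (m - n * ι : AddMonoid.End E.toAffine.Point) P := by
      change _ = ((m : AddMonoid.End E.toAffine.Point) P + (n * ι : AddMonoid.End E.toAffine.Point) P) +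
        ((m : AddMonoid.End E.toAffine.Point) P - (n * ι : AddMonoid.End E.toAffine.Point) P)
      abel
    rw [e, h, h', add_zero]
  have h3 : (p : ℤ) • P = 0 := by
    rw [← hmn, ← AddMonoid.End.intCast_apply, ← gauss_mul_conj hsq]
    change (m + n * ι : AddMonoid.End E.toAffine.Point)
      ((m - n * ι : AddMonoid.End E.toAffine.Point) P) = 0
    rw [h']
    exact map_zero _
  have hpI : Prime (p : ℤ) := Nat.prime_iff_prime_int.1 hp
  have hcop : IsCoprime (2 * m) (p : ℤ) := by
    rw [isCoprime_comm, hpI.irreducible.coprime_iff_not_dvd]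
    intro hdvd
    rcases hpI.dvd_or_dvd hdvd with h4 | h4
    · exact h2 ((Nat.prime_dvd_prime_iff_eq hp Nat.prime_two).1 (by exact_mod_cast h4))
    · have h5 : (p : ℤ) ∣ n ^ 2 := by
        rw [show n ^ 2 = p - m ^ 2 by lia]
        exact (dvd_refl _).sub (dvd_pow h4 two_ne_zero)
      have h6 : (p : ℤ) ^ 2 ∣ p := by
        have := (pow_dvd_pow_of_dvd h4 2).add (pow_dvd_pow_of_dvd (hpI.dvd_of_dvd_pow h5) 2)
        rwa [hmn] at this
      have h7 := Int.le_of_dvd (by exact_mod_cast hp.pos) h6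
      have h8 : (2 : ℤ) ≤ p := by exact_mod_cast hp.two_le
      nlinarith
  obtain ⟨a, b, hab⟩ := hcop
  rw [← one_zsmul P, ← hab, add_zsmul, mul_zsmul, h1, mul_zsmul, h3, zsmul_zero, zsmul_zero,
    add_zero]

lemma isSplitting_gauss {p : ℕ} (hp : p.Prime) (h2 : p ≠ 2) (hι : RatHom ι) (hsq : ι * ι = -1)
    (T : Fin 3 → E.toAffine.Point) (hT : Function.Injective fun j => xc E (T j))
    (hT0 : ∀ j, T j ≠ 0) (hT2 : ∀ j, T j + T j = 0) {m n : ℤ} (hmn : m ^ 2 + n ^ 2 = p) :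
    IsSplitting E (p : AddMonoid.End E.toAffine.Point) (m + n * ι) (m - n * ι) ∧
      ¬ AreAssociate E (m + n * ι) (m - n * ι) := by
  have hodd : Odd (m ^ 2 + n ^ 2) := by
    rw [hmn]
    exact_mod_cast hp.odd_of_ne_two h2
  have hne1 : m ^ 2 + n ^ 2 ≠ 1 := by
    rw [hmn]
    exact_mod_cast hp.one_lt.ne'
  have hconj : (m - n * ι : AddMonoid.End E.toAffine.Point) = m + (-n : ℤ) * ι := by
    exact sub_mul_eq_add_neg_mul m n ι
  have hauto : ∀ {φ : AddMonoid.End E.toAffine.Point}, ¬ Function.Injective φ →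
      ¬ IsAutomorphism E φ := by
    intro φ hφ h
    refine hφ ((injective_iff_map_eq_zero _).2 fun P hP => h.eq_zero_of_apply hP)
  have hinj := not_injective_gauss hι hsq T hT hT0 hT2 hodd hne1
  refine ⟨⟨(ratHom_gauss hι m n).isEndomorphism, ?_, hauto hinj, ?_, ?_⟩, ?_⟩
  · rw [hconj]
    exact (ratHom_gauss hι m (-n)).isEndomorphism
  · rw [hconj]
    exact hauto (not_injective_gauss hι hsq T hT hT0 hT2 (by rwa [neg_sq]) (by rwa [neg_sq]))
  · rw [gauss_mul_conj hsq, hmn, Int.cast_natCast]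
  · rintro ⟨u, -, hu⟩
    refine hinj ((injective_iff_map_eq_zero _).2 fun P hP => ?_)
    refine eq_zero_of_gauss_apply hp h2 hsq hmn hP ?_
    rw [hu]
    change u ((m + n * ι : AddMonoid.End E.toAffine.Point) P) = 0
    rw [hP]
    exact map_zero u

lemma hasCM_of_mul_self_eq_neg_one (hι : RatHom ι) (hsq : ι * ι = -1) : HasCM E := by
  refine ⟨ι, hι.isEndomorphism, fun n hn => ?_⟩
  have : ((n ^ 2 + 1 : ℤ) : AddMonoid.End E.toAffine.Point) = 0 := by
    rw [pow_two]
    push_cast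
    rw [← hn, hsq, neg_add_cancel]
  exact intCast_end_ne_zero (by positivity) this

/-- The three points of order two of `y² = x³ + ax`. -/
lemma exists_two_torsion (h₁ : E.a₁ = 0) (h₂ : E.a₂ = 0) (h₃ : E.a₃ = 0) (h₆ : E.a₆ = 0)
    (h₄ : E.a₄ ≠ 0) : ∃ T : Fin 3 → E.toAffine.Point, (Function.Injective fun j => xc E (T j)) ∧
      (∀ j, T j ≠ 0) ∧ ∀ j, T j + T j = 0 := by
  obtain ⟨s, hs⟩ := IsAlgClosed.exists_pow_nat_eq (-E.a₄) (n := 2) (by norm_num)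
  have hs0 : s ≠ 0 := by
    rintro rfl
    apply h₄
    linear_combination hs
  have hx : ∀ j, (0 : K) ^ 2 = cubicB E ((![0, s, -s] : Fin 3 → K) j) := by
    have hb : ∀ x, cubicB E x = 4 * x * (x ^ 2 + E.a₄) := by
      intro x
      rw [cubicB, WeierstrassCurve.b₂, WeierstrassCurve.b₄, WeierstrassCurve.b₆, h₁, h₂, h₃, h₆]
      ring
    intro j
    fin_cases j <;> simp [hb, hs]
  choose T hT0 hTx hTt using fun j => exists_point (hx j)
  refine ⟨T, ?_, hT0, fun j => ?_⟩
  · simp only [hTx]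
    have hss : s ≠ -s := fun h => hs0 (self_eq_neg.1 h)
    intro j k hjk
    fin_cases j <;> fin_cases k <;> simp_all [eq_comm]
  · rw [add_eq_zero_iff_eq_neg]
    exact point_ext (hT0 j) (neg_ne_zero.2 (hT0 j)) (xc_neg _).symm (by rw [tc_neg, hTt, neg_zero])

end GaussianIntegers

section GaussianCurves

lemma isElliptic_geom {W : WeierstrassCurve ℤ} (hW : W.Δ ≠ 0) : (geom W).IsElliptic := by
  rw [WeierstrassCurve.isElliptic_iff, WeierstrassCurve.map_Δ, isUnit_iff_ne_zero]
  simpa using hW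

theorem curveE_splits (a : ℤ) (ha : a ≠ 0) :
    HasCM (geom (curveE a)) ∧
      ∀ i : AlgebraicClosure ℚ, i ^ 2 = -1 →
        ∃ ι : AddMonoid.End (geom (curveE a)).toAffine.Point,
          IsEndomorphism (geom (curveE a)) ι ∧
          (∀ x y h, ∃ h', ι (.some x y h) = .some (-x) (i * y) h') ∧
          ι * ι = -1 ∧
          ∀ p : ℕ, p.Prime → p % 4 = 1 →
            Splits (geom (curveE a)) (p : AddMonoid.End (geom (curveE a)).toAffine.Point) ∧
            (∃ m n : ℤ, m ^ 2 + n ^ 2 = p) ∧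
            ∀ m n : ℤ, m ^ 2 + n ^ 2 = p →
              IsSplitting (geom (curveE a)) (p : AddMonoid.End (geom (curveE a)).toAffine.Point)
                (m + n * ι) (m - n * ι) ∧
              ¬ AreAssociate (geom (curveE a)) (m + n * ι) (m - n * ι) := by
  have hΔ : (curveE a).Δ ≠ 0 := by
    have : (curveE a).Δ = -64 * a ^ 3 := by
      simp only [WeierstrassCurve.Δ, WeierstrassCurve.b₂, WeierstrassCurve.b₄,
        WeierstrassCurve.b₆, WeierstrassCurve.b₈, curveE]
      ring
    rw [this]
    exact mul_ne_zero (by norm_num) (pow_ne_zero 3 ha)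
  have := isElliptic_geom hΔ
  have h₁ : (geom (curveE a)).a₁ = 0 := by simp [curveE]
  have h₂ : (geom (curveE a)).a₂ = 0 := by simp [curveE]
  have h₃ : (geom (curveE a)).a₃ = 0 := by simp [curveE]
  have h₆ : (geom (curveE a)).a₆ = 0 := by simp [curveE]
  have h₄ : (geom (curveE a)).a₄ ≠ 0 := by simpa [curveE] using ha
  obtain ⟨T, hT, hT0, hT2⟩ := exists_two_torsion h₁ h₂ h₃ h₆ h₄
  constructor
  · obtain ⟨i, hi⟩ :=
      IsAlgClosed.exists_pow_nat_eq (-1 : AlgebraicClosure ℚ) (n := 2) (by norm_num)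
    exact hasCM_of_mul_self_eq_neg_one (ratHom_gaussEnd (h₁ := h₁) (h₂ := h₂) (h₃ := h₃)
      (h₆ := h₆) (hi := hi)) gaussEnd_mul_self
  intro i hi
  have hι := ratHom_gaussEnd (h₁ := h₁) (h₂ := h₂) (h₃ := h₃) (h₆ := h₆) (hi := hi)
  refine ⟨_, hι.isEndomorphism, fun x y h => ⟨_, rfl⟩, gaussEnd_mul_self, fun p hp hp4 => ?_⟩
  have h2 : p ≠ 2 := by rintro rfl; norm_num at hp4
  have hex : ∃ m n : ℤ, m ^ 2 + n ^ 2 = p := by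
    have := Fact.mk hp
    obtain ⟨m, n, h⟩ := Nat.Prime.sq_add_sq (p := p) (by lia)
    exact ⟨m, n, by exact_mod_cast h⟩
  have hall := fun (m n : ℤ) (hmn : m ^ 2 + n ^ 2 = p) =>
    isSplitting_gauss hp h2 hι gaussEnd_mul_self T hT hT0 hT2 hmn
  refine ⟨?_, hex, hall⟩
  obtain ⟨m, n, hmn⟩ := hex
  exact ⟨_, _, (hall m n hmn).1⟩

end GaussianCurves

/-! ### The torsion points behind a splitting of `p` -/

section Torsion

open Filter

variable {K : Type*} [Field K] [CharZero K] [IsAlgClosed K] [DecidableEq K]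
  {E : WeierstrassCurve K} [E.IsElliptic] {α β γ δ : AddMonoid.End E.toAffine.Point} {p : ℕ}

lemma natCast_end_ne_zero (hp : p.Prime) : (p : AddMonoid.End E.toAffine.Point) ≠ 0 := by
  exact_mod_cast intCast_end_ne_zero (E := E) (n := p) (by exact_mod_cast hp.ne_zero)

variable (E) in
/-- The non-zero points killed by `p`. -/
noncomputable def torsionPoints (hp : p.Prime) : Finset E.toAffine.Point :=
  (((ratHom_natCast p).finite_ker (natCast_end_ne_zero (E := E) hp)).subset
    (t := {P | P ≠ 0 ∧ p • P = 0}) fun P hP =>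
      (AddMonoid.End.natCast_apply p P).trans hP.2).toFinset

lemma mem_torsionPoints {hp : p.Prime} {P : E.toAffine.Point} :
    P ∈ torsionPoints E hp ↔ P ≠ 0 ∧ p • P = 0 := by
  simp [torsionPoints]

/-- The map `P ↦ x(P)` is two-to-one on the points of odd order. -/
lemma two_mul_card_image_xc {hp : p.Prime} (h2 : p ≠ 2) {A : Finset E.toAffine.Point}
    (hA : A ⊆ torsionPoints E hp) (hneg : ∀ P ∈ A, -P ∈ A) :
    2 * (A.image (xc E)).card = A.card := by
  classical
  have hfib : ∀ x ∈ A.image (xc E), (A.filter fun P => xc E P = x).card = 2 := by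
    intro x hx
    obtain ⟨P, hP, rfl⟩ := Finset.mem_image.1 hx
    obtain ⟨h0, hp0⟩ := mem_torsionPoints.1 (hA hP)
    have hne : P ≠ -P := by
      intro h
      have h3 : 2 • P = 0 := by rw [two_nsmul]; nth_rw 2 [h]; exact add_neg_cancel P
      have h4 := addOrderOf_dvd_of_nsmul_eq_zero hp0
      have h5 := addOrderOf_dvd_of_nsmul_eq_zero h3
      have h6 := Nat.dvd_gcd h4 h5
      rw [(Nat.coprime_primes hp Nat.prime_two).2 h2, Nat.dvd_one, AddMonoid.addOrderOf_eq_one_iff]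
        at h6
      exact h0 h6
    rw [Finset.card_eq_two]
    refine ⟨P, -P, hne, ?_⟩
    ext Q
    simp only [Finset.mem_filter, Finset.mem_insert, Finset.mem_singleton]
    constructor
    · rintro ⟨hQ, hx⟩
      exact eq_or_eq_neg_of_xc_eq (mem_torsionPoints.1 (hA hQ)).1 h0 hx
    · rintro (rfl | rfl)
      · exact ⟨hP, rfl⟩
      · exact ⟨hneg P hP, xc_neg P⟩
  exact le_antisymm (Finset.mul_card_image_le_card _ _ fun x hx => (hfib x hx).ge)
    (Finset.card_le_mul_card_image _ _ fun x hx => (hfib x hx).le)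

lemma two_mul_natDegree_preΨ (hp : p.Prime) (h2 : p ≠ 2) :
    2 * (E.preΨ p).natDegree = p ^ 2 - 1 := by
  have hodd := hp.odd_of_ne_two h2
  rw [WeierstrassCurve.natDegree_preΨ (n := (p : ℤ)) _ (by exact_mod_cast hp.ne_zero),
    if_neg (by simpa using hodd), Int.natAbs_natCast]
  obtain ⟨k, rfl⟩ := hodd
  rw [show (2 * k + 1) ^ 2 - 1 = 2 * (2 * k ^ 2 + 2 * k) by
    rw [show (2 * k + 1) ^ 2 = 2 * (2 * k ^ 2 + 2 * k) + 1 by ring, Nat.add_sub_cancel]]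
  lia

lemma preΨ_ne_zero_of_prime (hp : p.Prime) : E.preΨ p ≠ 0 :=
  WeierstrassCurve.preΨ_ne_zero (n := (p : ℤ)) _ (by exact_mod_cast hp.ne_zero)

lemma image_xc_torsionPoints_subset (hp : p.Prime) (h2 : p ≠ 2) :
    (torsionPoints E hp).image (xc E) ⊆ (E.preΨ p).roots.toFinset := by
  intro x hx
  obtain ⟨P, hP, rfl⟩ := Finset.mem_image.1 hx
  obtain ⟨h0, hp0⟩ := mem_torsionPoints.1 hP
  rw [Multiset.mem_toFinset, mem_roots (preΨ_ne_zero_of_prime hp)]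
  exact eval_preΨ_eq_zero hp h2 h0 hp0

/-- The degree of the division polynomial bounds the number of points killed by `p`. -/
lemma card_torsionPoints_le (hp : p.Prime) (h2 : p ≠ 2) :
    (torsionPoints E hp).card ≤ p ^ 2 - 1 := by
  rw [← two_mul_card_image_xc h2 subset_rfl, ← two_mul_natDegree_preΨ (E := E) hp h2]
  · refine Nat.mul_le_mul_left 2 ((Finset.card_le_card
      (image_xc_torsionPoints_subset hp h2)).trans ?_)
    exact (Multiset.toFinset_card_le _).trans (card_roots' _)
  · intro P hP
    rw [mem_torsionPoints] at hP ⊢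
    exact ⟨neg_ne_zero.2 hP.1, by rw [smul_neg, hP.2, neg_zero]⟩

/-- If there are `p²` points killed by `p`, then the division polynomial has as many distinct roots
as its degree allows. -/
lemma nodup_roots_preΨ (hp : p.Prime) (h2 : p ≠ 2)
    (h : p ^ 2 - 1 ≤ (torsionPoints E hp).card) : (E.preΨ p).roots.Nodup := by
  rw [← two_mul_card_image_xc h2 subset_rfl, ← two_mul_natDegree_preΨ (E := E) hp h2] at h
  · rw [← Multiset.toFinset_card_eq_card_iff_nodup]
    refine le_antisymm (Multiset.toFinset_card_le _) ((card_roots' _).trans ?_)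
    exact (Nat.le_of_mul_le_mul_left h two_pos).trans (Finset.card_le_card
      (image_xc_torsionPoints_subset hp h2))
  · intro P hP
    rw [mem_torsionPoints] at hP ⊢
    exact ⟨neg_ne_zero.2 hP.1, by rw [smul_neg, hP.2, neg_zero]⟩

lemma IsSplitting.ratHom_left (h : IsSplitting E (p : AddMonoid.End E.toAffine.Point) α β) :
    RatHom α := ratHom_of_isEndomorphism h.1

lemma IsSplitting.ratHom_right (h : IsSplitting E (p : AddMonoid.End E.toAffine.Point) α β) :
    RatHom β := ratHom_of_isEndomorphism h.2.1

lemma IsSplitting.symm (h : IsSplitting E (p : AddMonoid.End E.toAffine.Point) α β) :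
    IsSplitting E (p : AddMonoid.End E.toAffine.Point) β α :=
  ⟨h.2.1, h.1, h.2.2.2.1, h.2.2.1, by rw [h.ratHom_right.mul_comm h.ratHom_left, h.2.2.2.2]⟩

lemma IsSplitting.left_ne_zero (hp : p.Prime)
    (h : IsSplitting E (p : AddMonoid.End E.toAffine.Point) α β) : α ≠ 0 := by
  rintro rfl
  exact natCast_end_ne_zero (E := E) hp (by rw [← h.2.2.2.2, zero_mul])

lemma IsSplitting.nsmul_eq_zero (h : IsSplitting E (p : AddMonoid.End E.toAffine.Point) α β)
    {P : E.toAffine.Point} (hP : α P = 0) : p • P = 0 := by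
  have : (β * α) P = p • P := by rw [h.symm.2.2.2.2, AddMonoid.End.natCast_apply]
  rw [← this]
  change β (α P) = 0
  rw [hP]
  exact map_zero β

lemma IsSplitting.finite_ker (hp : p.Prime)
    (h : IsSplitting E (p : AddMonoid.End E.toAffine.Point) α β) : Finite (AddMonoidHom.ker α) :=
  (h.ratHom_left.finite_ker (h.left_ne_zero hp)).to_subtype

/-- The kernel of `α` contains a point of order `p`, since otherwise `α` would be an
automorphism. -/
lemma IsSplitting.le_card_ker (hp : p.Prime)
    (h : IsSplitting E (p : AddMonoid.End E.toAffine.Point) α β) :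
    p ≤ Nat.card (AddMonoidHom.ker α) := by
  have := h.finite_ker hp
  have hex : ∃ P, α P = 0 ∧ P ≠ 0 := by
    by_contra! hn
    exact h.2.2.1 (h.ratHom_left.isAutomorphism (h.left_ne_zero hp) hn)
  obtain ⟨P, hP, hP0⟩ := hex
  have := Fact.mk hp
  rw [← addOrderOf_eq_prime (h.nsmul_eq_zero hP) hP0]
  exact Nat.le_of_dvd Nat.card_pos (AddSubgroup.addOrderOf_dvd_natCard _ hP)

/-- If `p = αβ` then `β` maps the points killed by `p` onto the kernel of `α`. The summand `1`
accounts for the point zero. -/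
lemma IsSplitting.card_ker_mul_card_ker_le (hp : p.Prime)
    (h : IsSplitting E (p : AddMonoid.End E.toAffine.Point) α β) :
    Nat.card (AddMonoidHom.ker α) * Nat.card (AddMonoidHom.ker β) ≤
      (torsionPoints E hp).card + 1 := by
  classical
  have := h.finite_ker hp
  have := h.symm.finite_ker hp
  choose σ hσ using h.ratHom_right.surjective (h.symm.left_ne_zero hp)
  have hmem : ∀ Q R, α Q = 0 → β R = 0 → σ Q + R ∈ insert 0 (torsionPoints E hp) := by
    intro Q R hQ hR
    rw [Finset.mem_insert, or_iff_not_imp_left, mem_torsionPoints]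
    refine fun h0 => ⟨h0, ?_⟩
    have h1 : (α * β) (σ Q + R) = p • (σ Q + R) := by
      rw [h.2.2.2.2, AddMonoid.End.natCast_apply]
    rw [← h1]
    change α (β (σ Q + R)) = 0
    rw [show β (σ Q + R) = β (σ Q) + β R from map_add β _ _, hσ, hR, add_zero, hQ]
  rw [← Nat.card_prod, ← Finset.card_insert_of_notMem (a := (0 : E.toAffine.Point))
    (s := torsionPoints E hp) (by simp [mem_torsionPoints])]
  rw [← Fintype.card_coe, ← Nat.card_eq_fintype_card]
  refine Nat.card_le_card_of_injective
    (fun x => ⟨σ x.1.1 + x.2.1, hmem _ _ x.1.2 x.2.2⟩) ?_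
  rintro ⟨⟨Q, hQ⟩, ⟨R, hR⟩⟩ ⟨⟨Q', hQ'⟩, ⟨R', hR'⟩⟩ he
  have he' : σ Q + R = σ Q' + R' := congrArg Subtype.val he
  have hQQ : Q = Q' := by
    have h1 := congrArg β he'
    rw [show β (σ Q + R) = β (σ Q) + β R from map_add β _ _,
      show β (σ Q' + R') = β (σ Q') + β R' from map_add β _ _, hσ, hσ,
      show β R = 0 from hR, show β R' = 0 from hR', add_zero, add_zero] at h1
    exact h1
  subst hQQ
  have hRR : R = R' := add_left_cancel he'
  subst hRR
  rfl

/-- If `p` splits as `αβ` then there are `p²` points killed by `p`, and the kernels of `α` and `β`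
have order `p`. -/
lemma IsSplitting.card_eq (hp : p.Prime) (h2 : p ≠ 2)
    (h : IsSplitting E (p : AddMonoid.End E.toAffine.Point) α β) :
    Nat.card (AddMonoidHom.ker α) = p ∧ Nat.card (AddMonoidHom.ker β) = p ∧
      (torsionPoints E hp).card = p ^ 2 - 1 := by
  have h1 := h.le_card_ker hp
  have h3 := h.symm.le_card_ker hp
  have h4 := h.card_ker_mul_card_ker_le hp
  have h5 := card_torsionPoints_le (E := E) hp h2
  have hp0 := hp.pos
  have h6 : 0 < p ^ 2 := by positivity
  have h7 : Nat.card (AddMonoidHom.ker α) * Nat.card (AddMonoidHom.ker β) ≤ p * p := by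
    rw [← pow_two]; lia
  have h8 : p * p ≤ Nat.card (AddMonoidHom.ker α) * Nat.card (AddMonoidHom.ker β) :=
    Nat.mul_le_mul h1 h3
  refine ⟨?_, ?_, ?_⟩
  · nlinarith
  · nlinarith
  · rw [pow_two] at *
    lia

/-- A subgroup of prime order that is stable under `γ` and killed by `γδ` is killed by `γ` or by
`δ`. -/
lemma apply_eq_zero_or_of_mul (hp : p.Prime) {H : AddSubgroup E.toAffine.Point}
    (hH : Nat.card H = p) (hγ : ∀ P ∈ H, γ P ∈ H)
    (hδγ : ∀ P ∈ H, δ (γ P) = 0) : (∀ P ∈ H, γ P = 0) ∨ ∀ P ∈ H, δ P = 0 := by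
  by_contra! hn
  obtain ⟨⟨P, hP, hP0⟩, ⟨Q, hQ, hQ0⟩⟩ := hn
  have := Fact.mk hp
  have hmem : (⟨Q, hQ⟩ : H) ∈ AddSubgroup.zmultiples (⟨γ P, hγ P hP⟩ : H) :=
    mem_zmultiples_of_prime_card hH (fun h => hP0 (congrArg Subtype.val h))
  obtain ⟨k, hk⟩ := AddSubgroup.mem_zmultiples_iff.1 hmem
  have hk' : k • γ P = Q := congrArg Subtype.val hk
  apply hQ0
  rw [← hk', show δ (k • γ P) = k • δ (γ P) from map_zsmul δ k _, hδγ P hP, zsmul_zero]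

/-- The kernels of the factors in a second splitting of `p` together contain the kernels of the
factors in the first. -/
lemma IsSplitting.apply_eq_zero_or (hp : p.Prime) (h2 : p ≠ 2)
    (h : IsSplitting E (p : AddMonoid.End E.toAffine.Point) α β) (hγ : RatHom γ) (hδ : RatHom δ)
    (hγδ : γ * δ = p) {P : E.toAffine.Point} (hP : α P = 0) : γ P = 0 ∨ δ P = 0 := by
  refine (apply_eq_zero_or_of_mul (γ := γ) (δ := δ) hp (h.card_eq hp h2).1 ?_ ?_).imp
    (fun H => H P hP) (fun H => H P hP)
  · intro Q hQ
    have : (α * γ) Q = γ (α Q) := by rw [h.ratHom_left.mul_comm hγ]; rfl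
    change (α * γ) Q = 0
    rw [this, show α Q = 0 from hQ]
    exact map_zero γ
  · intro Q hQ
    change (δ * γ) Q = 0
    rw [hδ.mul_comm hγ, hγδ, AddMonoid.End.natCast_apply]
    exact h.nsmul_eq_zero hQ

variable (E) in
/-- The non-zero points killed by `α` or by `β`, among those killed by `p`. -/
noncomputable def kernelPoints (hp : p.Prime) (α β : AddMonoid.End E.toAffine.Point) :
    Finset E.toAffine.Point :=
  open Classical in (torsionPoints E hp).filter fun P => α P = 0 ∨ β P = 0

lemma IsSplitting.mem_kernelPoints {hp : p.Prime}
    (h : IsSplitting E (p : AddMonoid.End E.toAffine.Point) α β) {P : E.toAffine.Point} :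
    P ∈ kernelPoints E hp α β ↔ P ≠ 0 ∧ (α P = 0 ∨ β P = 0) := by
  rw [kernelPoints, Finset.mem_filter, mem_torsionPoints]
  refine ⟨fun H => ⟨H.1.1, H.2⟩, fun H => ⟨⟨H.1, ?_⟩, H.2⟩⟩
  rcases H.2 with H | H
  · exact h.nsmul_eq_zero H
  · exact h.symm.nsmul_eq_zero H

lemma card_filter_ker (hp : p.Prime) (hα : Nat.card (AddMonoidHom.ker α) = p)
    (hpα : ∀ P, α P = 0 → p • P = 0) [DecidablePred fun P => α P = 0] :
    ((torsionPoints E hp).filter fun P => α P = 0).card = p - 1 := by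
  have h1 : (insert 0 ((torsionPoints E hp).filter fun P => α P = 0)).card = p := by
    rw [← Fintype.card_coe, ← Nat.card_eq_fintype_card]
    refine (Nat.card_congr (Equiv.subtypeEquivRight fun P => ?_)).trans hα
    rw [Finset.mem_insert, Finset.mem_filter, mem_torsionPoints]
    change _ ↔ α P = 0
    constructor
    · rintro (rfl | H)
      · exact map_zero α
      · exact H.2
    · intro H
      by_cases h0 : P = 0
      · exact .inl h0
      · exact .inr ⟨⟨h0, hpα P H⟩, H⟩
  rw [Finset.card_insert_of_notMem (by simp [mem_torsionPoints])] at h1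
  lia

lemma IsSplitting.card_kernelPoints (hp : p.Prime) (h2 : p ≠ 2)
    (h : IsSplitting E (p : AddMonoid.End E.toAffine.Point) α β) :
    p - 1 ≤ (kernelPoints E hp α β).card ∧ (kernelPoints E hp α β).card ≤ 2 * (p - 1) ∧
      (¬ AreAssociate E α β → (kernelPoints E hp α β).card = 2 * (p - 1)) := by
  classical
  obtain ⟨hα, hβ, -⟩ := h.card_eq hp h2
  have cα := card_filter_ker hp hα fun P => h.nsmul_eq_zero
  have cβ := card_filter_ker hp hβ fun P => h.symm.nsmul_eq_zero
  have e : kernelPoints E hp α β = (torsionPoints E hp).filter (fun P => α P = 0) ∪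
      (torsionPoints E hp).filter fun P => β P = 0 := by
    rw [← Finset.filter_or]
    ext P
    simp [kernelPoints]
  refine ⟨?_, ?_, fun hna => ?_⟩
  · rw [e, ← cα]
    exact Finset.card_le_card Finset.subset_union_left
  · rw [e, two_mul]
    nth_rw 1 [← cα]
    rw [← cβ]
    exact Finset.card_union_le _ _
  · rw [e, Finset.card_union_of_disjoint, cα, cβ, two_mul]
    rw [Finset.disjoint_left]
    intro P h1 h3
    rw [Finset.mem_filter, mem_torsionPoints] at h1 h3
    apply hna
    -- Two subgroups of prime order that share a non-zero point coincide.
    have key : ∀ {γ δ : AddMonoid.End E.toAffine.Point}, Nat.card (AddMonoidHom.ker γ) = p →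
        γ P = 0 → δ P = 0 → ∀ Q, γ Q = 0 → δ Q = 0 := by
      intro γ δ hγ h4 h5 Q hQ
      have := Fact.mk hp
      have hmem : (⟨Q, hQ⟩ : AddMonoidHom.ker γ) ∈
          AddSubgroup.zmultiples (⟨P, h4⟩ : AddMonoidHom.ker γ) :=
        mem_zmultiples_of_prime_card hγ (fun h => h1.1.1 (congrArg Subtype.val h))
      obtain ⟨k, hk⟩ := AddSubgroup.mem_zmultiples_iff.1 hmem
      have hk' : k • P = Q := congrArg Subtype.val hk
      rw [← hk', show δ (k • P) = k • δ P from map_zsmul δ k _, h5, zsmul_zero]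
    exact areAssociate_of_ker_eq h.ratHom_left h.ratHom_right (h.left_ne_zero hp)
      (h.symm.left_ne_zero hp) fun Q => ⟨key hα h1.2 h3.2 Q, key hβ h3.2 h1.2 Q⟩

variable (E) in
/-- The `x`-coordinates of the non-zero points killed by `α` or by `β`. -/
noncomputable def kernelAbscissae (hp : p.Prime) (α β : AddMonoid.End E.toAffine.Point) :
    Finset K :=
  (kernelPoints E hp α β).image (xc E)

lemma IsSplitting.two_mul_card_kernelAbscissae {hp : p.Prime} (h2 : p ≠ 2)
    (h : IsSplitting E (p : AddMonoid.End E.toAffine.Point) α β) :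
    2 * (kernelAbscissae E hp α β).card = (kernelPoints E hp α β).card := by
  refine two_mul_card_image_xc (hp := hp) h2 (Finset.filter_subset _ _) fun P hP => ?_
  rw [h.mem_kernelPoints] at hP ⊢
  refine ⟨neg_ne_zero.2 hP.1, hP.2.imp ?_ ?_⟩
  · intro H
    rw [show α (-P) = -α P from map_neg α P, H, neg_zero]
  · intro H
    rw [show β (-P) = -β P from map_neg β P, H, neg_zero]

lemma IsSplitting.eval_preΨ_kernelAbscissae {hp : p.Prime} (h2 : p ≠ 2) {x : K}
    (hx : x ∈ kernelAbscissae E hp α β) : (E.preΨ p).eval x = 0 := by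
  obtain ⟨P, hP, rfl⟩ := Finset.mem_image.1 hx
  obtain ⟨h0, hp0⟩ := mem_torsionPoints.1 (Finset.filter_subset _ _ hP)
  exact eval_preΨ_eq_zero hp h2 h0 hp0

end Torsion

/-! ### Galois descent -/

section Galois

open Filter

lemma isGalois_algebraicNumbers : IsGalois ℚ (AlgebraicClosure ℚ) := by
  have : Algebra.IsAlgebraic ℚ (AlgebraicClosure ℚ) := by
    convert! AlgebraicClosure.isAlgebraic ℚ
  have : IsAlgClosure ℚ (AlgebraicClosure ℚ) := ⟨inferInstance, inferInstance⟩
  have := IsAlgClosure.normal ℚ (AlgebraicClosure ℚ)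
  exact ⟨⟩

/-- A non-zero polynomial over `ℚ` is proportional to a primitive polynomial over `ℤ`. -/
lemma exists_isPrimitive_map_eq {f : ℚ[X]} (hf : f ≠ 0) : ∃ (F : ℤ[X]) (c : ℚ), c ≠ 0 ∧
    F.IsPrimitive ∧ F.map (algebraMap ℤ ℚ) = C c * f := by
  obtain ⟨b, hb, h⟩ := IsLocalization.integerNormalization_spec (nonZeroDivisors ℤ) f
  set g := IsLocalization.integerNormalization (nonZeroDivisors ℤ) f with hg
  have hb0 : (b : ℚ) ≠ 0 := Int.cast_ne_zero.2 (nonZeroDivisors.ne_zero hb)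
  have hg0 : g ≠ 0 := by
    intro h0
    rw [h0, Polynomial.map_zero] at h
    exact hf ((smul_eq_zero.1 h.symm).resolve_left (nonZeroDivisors.ne_zero hb))
  have hc0 : (g.content : ℚ) ≠ 0 := Int.cast_ne_zero.2 (content_eq_zero_iff.not.2 hg0)
  refine ⟨g.primPart, (g.content : ℚ)⁻¹ * b, mul_ne_zero (inv_ne_zero hc0) hb0,
    g.isPrimitive_primPart, ?_⟩
  have h1 : C (g.content : ℚ) * g.primPart.map (algebraMap ℤ ℚ) = C (b : ℚ) * f := by
    have h2 := congrArg (Polynomial.map (algebraMap ℤ ℚ)) g.eq_C_content_mul_primPart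
    have h3 : b • f = C (b : ℚ) * f := by
      ext n
      simp
    rw [Polynomial.map_mul, map_C, h, h3] at h2
    exact h2.symm
  rw [C_mul, mul_assoc, ← h1, ← mul_assoc, ← C_mul, inv_mul_cancel₀ hc0, C_1, one_mul]

/-- A Galois-stable set of roots of an integer polynomial is the set of roots of a factor. -/
lemma exists_factor_of_stable {q : ℤ[X]} {S : Finset (AlgebraicClosure ℚ)}
    (hS : ∀ σ : AlgebraicClosure ℚ ≃ₐ[ℚ] AlgebraicClosure ℚ, ∀ x ∈ S, σ x ∈ S)
    (hq : ∀ x ∈ S, (q.map (Int.castRingHom (AlgebraicClosure ℚ))).eval x = 0) :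
    ∃ F G : ℤ[X], q = F * G ∧ F.IsPrimitive ∧ F.natDegree = S.card := by
  have := isGalois_algebraicNumbers
  let f : (AlgebraicClosure ℚ)[X] := ∏ x ∈ S, (X - C x)
  have hfix : ∀ σ : AlgebraicClosure ℚ ≃ₐ[ℚ] AlgebraicClosure ℚ,
      f.map (σ : AlgebraicClosure ℚ →+* AlgebraicClosure ℚ) = f := by
    intro σ
    have himage : S.image σ = S := Finset.eq_of_subset_of_card_le
      (Finset.image_subset_iff.2 (hS σ)) (Finset.card_image_of_injective _ σ.injective).ge
    simp only [f, Polynomial.map_prod, Polynomial.map_sub, map_X, map_C]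
    nth_rw 2 [← himage]
    rw [Finset.prod_image σ.injective.injOn]
    rfl
  obtain ⟨g, hg⟩ : f ∈ lifts (algebraMap ℚ (AlgebraicClosure ℚ)) := by
    rw [lifts_iff_coeff_lifts]
    intro n
    rw [InfiniteGalois.mem_range_algebraMap_iff_fixed]
    intro σ
    have := congrArg (coeff · n) (hfix σ)
    rw [coeff_map] at this
    exact this
  rw [coe_mapRingHom] at hg
  have hf : f.Monic := monic_prod_of_monic _ _ fun x _ => monic_X_sub_C x
  have hg0 : g ≠ 0 := by
    rintro rfl
    exact hf.ne_zero (by rw [← hg, Polynomial.map_zero])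
  have hZQ : (algebraMap ℚ (AlgebraicClosure ℚ)).comp (algebraMap ℤ ℚ) =
      Int.castRingHom (AlgebraicClosure ℚ) := RingHom.ext_int _ _
  have hdvd : g ∣ q.map (algebraMap ℤ ℚ) := by
    rw [← map_dvd_map' (algebraMap ℚ (AlgebraicClosure ℚ)), hg, Polynomial.map_map, hZQ]
    refine Finset.prod_dvd_of_coprime (fun x _ y _ hxy => ?_) fun x hx => ?_
    · exact pairwise_coprime_X_sub_C Function.injective_id hxy
    · exact dvd_iff_isRoot.2 (hq x hx)
  obtain ⟨F, c, hc, hF, hFg⟩ := exists_isPrimitive_map_eq hg0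
  obtain ⟨G, hG⟩ := hF.dvd_of_fraction_map_dvd_fraction_map (K := ℚ) (q := q) (by
    rw [hFg]
    exact (IsUnit.mul_left_dvd (isUnit_C.2 hc.isUnit)).2 hdvd)
  refine ⟨F, G, hG, hF, ?_⟩
  have h1 : (F.map (algebraMap ℤ ℚ)).natDegree = F.natDegree :=
    natDegree_map_eq_of_injective (algebraMap ℤ ℚ).injective_int F
  rw [← h1, hFg, natDegree_C_mul hc, ← natDegree_map (algebraMap ℚ (AlgebraicClosure ℚ)), hg]
  exact natDegree_finsetProd_X_sub_C_eq_card S fun x => x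

variable (W : WeierstrassCurve ℤ) (σ τ : AlgebraicClosure ℚ ≃ₐ[ℚ] AlgebraicClosure ℚ)

/-- The action of a Galois automorphism on the points of a curve with integer coefficients. -/
noncomputable def galPoint : AddMonoid.End (geom W).toAffine.Point :=
  WeierstrassCurve.Affine.Point.map (W' := W) (S := ℤ) (F := AlgebraicClosure ℚ)
    (K := AlgebraicClosure ℚ) (σ.toAlgHom.restrictScalars ℤ)

variable {W} {σ τ}

lemma xc_galPoint (P : (geom W).toAffine.Point) :
    xc (geom W) (galPoint W σ P) = σ (xc (geom W) P) := by
  rcases P with _ | ⟨x, y, h⟩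
  · exact (map_zero σ).symm
  · rfl

lemma tc_galPoint (P : (geom W).toAffine.Point) :
    tc (geom W) (galPoint W σ P) = σ (tc (geom W) P) := by
  rcases P with _ | ⟨x, y, h⟩
  · exact (map_zero σ).symm
  · change 2 * σ y + (geom W).a₁ * σ x + (geom W).a₃ =
      σ (2 * y + (geom W).a₁ * x + (geom W).a₃)
    rw [map_add, map_add, map_mul, map_mul, show σ 2 = 2 from map_ofNat σ 2]
    simp

lemma galPoint_ne_zero {P : (geom W).toAffine.Point} (hP : P ≠ 0) : galPoint W σ P ≠ 0 := by
  rcases P with _ | ⟨x, y, h⟩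
  · exact absurd rfl hP
  · exact WeierstrassCurve.Affine.Point.some_ne_zero _

lemma galPoint_symm_apply (P : (geom W).toAffine.Point) :
    galPoint W σ (galPoint W σ.symm P) = P := by
  by_cases hP : P = 0
  · rw [hP]
    rfl
  · refine point_ext (galPoint_ne_zero (galPoint_ne_zero hP)) hP ?_ ?_
    · rw [xc_galPoint, xc_galPoint, AlgEquiv.apply_symm_apply]
    · rw [tc_galPoint, tc_galPoint, AlgEquiv.apply_symm_apply]

lemma galPoint_apply_symm (P : (geom W).toAffine.Point) :
    galPoint W σ.symm (galPoint W σ P) = P :=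
  galPoint_symm_apply (σ := σ.symm) P

variable (σ) in
/-- The conjugate of an endomorphism under a Galois automorphism. -/
noncomputable def galConj (α : AddMonoid.End (geom W).toAffine.Point) :
    AddMonoid.End (geom W).toAffine.Point :=
  galPoint W σ * α * galPoint W σ.symm

lemma galConj_mul (α β : AddMonoid.End (geom W).toAffine.Point) :
    galConj σ α * galConj σ β = galConj σ (α * β) := by
  ext P
  change galPoint W σ (α (galPoint W σ.symm (galPoint W σ (β (galPoint W σ.symm P))))) =
    galPoint W σ (α (β (galPoint W σ.symm P)))
  rw [galPoint_apply_symm]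

lemma galConj_natCast (n : ℕ) :
    galConj σ (n : AddMonoid.End (geom W).toAffine.Point) = n := by
  ext P
  change galPoint W σ ((n : AddMonoid.End (geom W).toAffine.Point) (galPoint W σ.symm P)) =
    (n : AddMonoid.End (geom W).toAffine.Point) P
  rw [AddMonoid.End.natCast_apply, AddMonoid.End.natCast_apply,
    show galPoint W σ (n • galPoint W σ.symm P) = n • galPoint W σ (galPoint W σ.symm P) from
      map_nsmul _ _ _, galPoint_symm_apply]

lemma IsRat.galConj {g : AlgebraicClosure ℚ → AlgebraicClosure ℚ} (hg : IsRat g) :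
    IsRat fun x => σ (g (σ.symm x)) := by
  obtain ⟨u, v, hv, h⟩ := hg
  refine ⟨u.map (σ : AlgebraicClosure ℚ →+* AlgebraicClosure ℚ),
    v.map (σ : AlgebraicClosure ℚ →+* AlgebraicClosure ℚ),
    (Polynomial.map_ne_zero_iff (RingHom.injective _)).2 hv, ?_⟩
  have hτ : Tendsto σ.symm cofinite cofinite := σ.symm.injective.tendsto_cofinite
  filter_upwards [hτ.eventually h] with x hx
  have he : ∀ w : (AlgebraicClosure ℚ)[X],
      (w.map (σ : AlgebraicClosure ℚ →+* AlgebraicClosure ℚ)).eval x = σ (w.eval (σ.symm x)) := by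
    intro w
    have := eval_map_apply (σ : AlgebraicClosure ℚ →+* AlgebraicClosure ℚ) (p := w) (σ.symm x)
    simpa using this
  rw [hx, map_div₀, he, he]

lemma RatHom.galConj [(geom W).IsElliptic] {α : AddMonoid.End (geom W).toAffine.Point}
    (hα : RatHom α) : RatHom (galConj σ α) := by
  rcases hα with rfl | ⟨r, s, h⟩
  · left
    ext P
    exact map_zero (galPoint W σ)
  · refine .inr ⟨_, _, h.isRat_fst.galConj (σ := σ), h.isRat_snd.galConj (σ := σ), ?_⟩
    have hinj : Function.Injective (galPoint W σ.symm) :=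
      Function.LeftInverse.injective (g := galPoint W σ) galPoint_symm_apply
    filter_upwards [hinj.tendsto_cofinite.eventually h.eventually] with P hP
    have e : CMDiv.galConj σ α P = galPoint W σ (α (galPoint W σ.symm P)) := rfl
    rw [e, xc_galPoint, tc_galPoint, hP.2.1, hP.2.2, xc_galPoint, tc_galPoint, map_mul,
      AlgEquiv.apply_symm_apply]
    exact ⟨galPoint_ne_zero hP.1, rfl, rfl⟩

/-- The `x`-coordinates attached to a splitting of `p` are permuted by the Galois group, although
the endomorphisms need not be defined over `ℚ`. -/
lemma IsSplitting.kernelAbscissae_stable [(geom W).IsElliptic] {p : ℕ} {hp : p.Prime} (h2 : p ≠ 2)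
    {α β : AddMonoid.End (geom W).toAffine.Point}
    (h : IsSplitting (geom W) (p : AddMonoid.End (geom W).toAffine.Point) α β)
    (σ : AlgebraicClosure ℚ ≃ₐ[ℚ] AlgebraicClosure ℚ) {x : AlgebraicClosure ℚ}
    (hx : x ∈ kernelAbscissae (geom W) hp α β) : σ x ∈ kernelAbscissae (geom W) hp α β := by
  obtain ⟨P, hP, rfl⟩ := Finset.mem_image.1 hx
  rw [h.mem_kernelPoints] at hP
  refine Finset.mem_image.2 ⟨galPoint W σ P, ?_, xc_galPoint P⟩
  rw [h.mem_kernelPoints]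
  have hinj : Function.Injective (galPoint W σ.symm) :=
    Function.LeftInverse.injective (g := galPoint W σ) galPoint_symm_apply
  refine ⟨galPoint_ne_zero hP.1, ?_⟩
  -- The conjugates of `α` and `β` by the inverse of `σ` again split `p`.
  have hα := h.ratHom_left.galConj (σ := σ.symm)
  have hβ := h.ratHom_right.galConj (σ := σ.symm)
  have hαβ : galConj σ.symm α * galConj σ.symm β = (p : AddMonoid.End (geom W).toAffine.Point) := by
    rw [galConj_mul, h.2.2.2.2, galConj_natCast]
  have key : ∀ {γ : AddMonoid.End (geom W).toAffine.Point}, galConj σ.symm γ P = 0 →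
      γ (galPoint W σ P) = 0 := by
    intro γ hγ
    exact hinj (hγ.trans (map_zero (galPoint W σ.symm)).symm)
  rcases hP.2 with hP | hP
  · exact (h.apply_eq_zero_or hp h2 hα hβ hαβ hP).imp key key
  · exact (h.symm.apply_eq_zero_or hp h2 hα hβ hαβ hP).imp key key

end Galois

/-! ### Factors of the division polynomial -/

section Factorization

/-- Complementary factors of an integer polynomial are coprime if the polynomial has simple roots
and one of the factors is primitive. -/
lemma isRelPrime_of_nodup_roots {F G : ℤ[X]} (hF : F.IsPrimitive) (h0 : F * G ≠ 0)
    (h : ((F * G).map (Int.castRingHom (AlgebraicClosure ℚ))).roots.Nodup) : IsRelPrime F G := by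
  intro d hdF hdG
  have hd := isPrimitive_of_dvd hF hdF
  have hinj : Function.Injective (Int.castRingHom (AlgebraicClosure ℚ)) :=
    RingHom.injective_int _
  have hdeg : d.degree = 0 := by
    by_contra hne
    obtain ⟨x, hx⟩ := IsAlgClosed.exists_root (d.map (Int.castRingHom (AlgebraicClosure ℚ)))
      (by rwa [degree_map_eq_of_injective hinj])
    have hdvd : (X - C x) ^ 2 ∣ (F * G).map (Int.castRingHom (AlgebraicClosure ℚ)) := by
      rw [Polynomial.map_mul, pow_two]
      exact mul_dvd_mul ((dvd_iff_isRoot.2 hx).trans (Polynomial.map_dvd _ hdF))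
        ((dvd_iff_isRoot.2 hx).trans (Polynomial.map_dvd _ hdG))
    have h2 := (le_rootMultiplicity_iff ((Polynomial.map_ne_zero_iff hinj).2 h0)).2 hdvd
    rw [← count_roots] at h2
    have := Multiset.nodup_iff_count_le_one.1 h x
    lia
  rw [eq_C_of_degree_eq_zero hdeg] at hd ⊢
  exact isUnit_C.2 (hd _ dvd_rfl)

/-- A splitting of `p` separates the points of order `p` killed by one of the factors from the
others, and hence factors the division polynomial. -/
theorem IsSplitting.exists_factorization {W : WeierstrassCurve ℤ} (hW : W.Δ ≠ 0) {p : ℕ}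
    (hp : p.Prime) (h2 : p ≠ 2) {α β : AddMonoid.End (geom W).toAffine.Point}
    (h : IsSplitting (geom W) (p : AddMonoid.End (geom W).toAffine.Point) α β) :
    ∃ F G : ℤ[X], oddDivPoly W p = F * G ∧ IsRelPrime F G ∧
      p - 1 ≤ 2 * F.natDegree ∧ F.natDegree ≤ p - 1 ∧
      2 * (F.natDegree + G.natDegree) = p ^ 2 - 1 ∧
      (¬ AreAssociate (geom W) α β → F.natDegree = p - 1) := by
  have := isElliptic_geom hW
  have hmap : (oddDivPoly W p).map (Int.castRingHom (AlgebraicClosure ℚ)) = (geom W).preΨ p :=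
    (WeierstrassCurve.map_preΨ ..).symm
  have hinj : Function.Injective (Int.castRingHom (AlgebraicClosure ℚ)) :=
    RingHom.injective_int _
  have hne : oddDivPoly W p ≠ 0 := by
    intro h0
    apply preΨ_ne_zero_of_prime (E := geom W) hp
    rw [← hmap, h0, Polynomial.map_zero]
  obtain ⟨F, G, hFG, hF, hdeg⟩ := exists_factor_of_stable (q := oddDivPoly W p)
    (S := kernelAbscissae (geom W) hp α β)
    (fun σ x hx => h.kernelAbscissae_stable h2 σ hx)
    (fun x hx => by rw [hmap]; exact eval_preΨ_kernelAbscissae h2 hx)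
  have hcard := h.two_mul_card_kernelAbscissae (hp := hp) h2
  rw [← hdeg] at hcard
  obtain ⟨c1, c2, c3⟩ := h.card_kernelPoints hp h2
  rw [← hcard] at c1 c2 c3
  have hFG0 : F * G ≠ 0 := hFG ▸ hne
  refine ⟨F, G, hFG, ?_, c1, by lia, ?_, fun hna => by have := c3 hna; lia⟩
  · refine isRelPrime_of_nodup_roots hF hFG0 ?_
    rw [← hFG, hmap]
    exact nodup_roots_preΨ hp h2 (h.card_eq hp h2).2.2.ge
  · rw [← two_mul_natDegree_preΨ (E := geom W) hp h2, ← hmap, natDegree_map_eq_of_injective hinj,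
      hFG, natDegree_mul (left_ne_zero_of_mul hFG0) (right_ne_zero_of_mul hFG0)]

end Factorization

end CMDiv

open Polynomial CMDiv in
theorem mainTheorem4 :
    (∀ W : WeierstrassCurve ℤ, W.Δ ≠ 0 → HasCM (geom W) →
      ∀ p : ℕ, p.Prime → p ≠ 2 →
        (Splits (geom W) (p : AddMonoid.End (geom W).toAffine.Point) →
          ∃ u v : ℤ[X], oddDivPoly W p = u * v ∧ 0 < u.natDegree ∧ 0 < v.natDegree) ∧
        (∀ α β : AddMonoid.End (geom W).toAffine.Point,
          IsSplitting (geom W) (p : AddMonoid.End (geom W).toAffine.Point) α β →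
          ¬ AreAssociate (geom W) α β →
          ∃ f g : ℤ[X], oddDivPoly W p ^ 2 = f * g ∧ IsRelPrime f g ∧
            min f.natDegree g.natDegree = 2 * p - 2)) ∧
    (∀ a : ℤ, a ≠ 0 →
      HasCM (geom (curveE a)) ∧
      ∀ i : AlgebraicClosure ℚ, i ^ 2 = -1 →
        ∃ ι : AddMonoid.End (geom (curveE a)).toAffine.Point,
          IsEndomorphism (geom (curveE a)) ι ∧
          (∀ x y h, ∃ h', ι (.some x y h) = .some (-x) (i * y) h') ∧
          ι * ι = -1 ∧
          ∀ p : ℕ, p.Prime → p % 4 = 1 →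
            Splits (geom (curveE a)) (p : AddMonoid.End (geom (curveE a)).toAffine.Point) ∧
            (∃ m n : ℤ, m ^ 2 + n ^ 2 = p) ∧
            ∀ m n : ℤ, m ^ 2 + n ^ 2 = p →
              IsSplitting (geom (curveE a)) (p : AddMonoid.End (geom (curveE a)).toAffine.Point)
                (m + n * ι) (m - n * ι) ∧
              ¬ AreAssociate (geom (curveE a)) (m + n * ι) (m - n * ι)) := by
  refine ⟨fun W hW _ p hp h2 => ⟨?_, ?_⟩, fun a ha => curveE_splits a ha⟩
  · rintro ⟨α, β, h⟩
    obtain ⟨F, G, hFG, -, h1, h3, h4, -⟩ := h.exists_factorization hW hp h2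
    have h5 : 3 ≤ p := by have := hp.two_le; lia
    obtain ⟨k, rfl⟩ := Nat.exists_eq_add_of_le h5
    refine ⟨F, G, hFG, by lia, ?_⟩
    rw [show (3 + k) ^ 2 - 1 = k ^ 2 + 6 * k + 8 by
      rw [show (3 + k) ^ 2 = k ^ 2 + 6 * k + 8 + 1 by ring, Nat.add_sub_cancel]] at h4
    lia
  · intro α β h hna
    obtain ⟨F, G, hFG, hrel, -, -, h4, h6⟩ := h.exists_factorization hW hp h2
    have hF := h6 hna
    have h5 : 3 ≤ p := by have := hp.two_le; lia
    obtain ⟨k, rfl⟩ := Nat.exists_eq_add_of_le h5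
    refine ⟨F ^ 2, G ^ 2, by rw [hFG, mul_pow], hrel.pow, ?_⟩
    rw [show (3 + k) ^ 2 - 1 = k ^ 2 + 6 * k + 8 by
      rw [show (3 + k) ^ 2 = k ^ 2 + 6 * k + 8 + 1 by ring, Nat.add_sub_cancel]] at h4
    rw [natDegree_pow, natDegree_pow, min_eq_left] <;> lia
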